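/- Let $T>0$, $s\in\{0,1\}$, $0<H<1$. Let $k_{0,H}(x,x')=\tfrac12\big(|x|^{2H}+|x'|^{2H}-|x-x'|^{2H}\big)$ be the fractional Brownian motion kernel and $k_{1,H}(x,x')=\int_0^x\int_0^{x'}k_{0,H}(z,z')\,dz'\,dz$ the integrated fractional Brownian motion kernel, and let $f=(f(x))_{x\in[0,T]}$ be a jointly measurable centred Gaussian process with covariance $k_{s,H}$. For each $N\ge 1$ let $0=x_{N,0}<x_{N,1}<\dots<x_{N,N}=T$ be the uniform partition of $[0,T]$ (all subintervals have the same length), and write $X=(x_{N,1},\dots,x_{N,N})$. Let $\mathbb P$ be a probability measure on $[0,T]$ with a Lebesgue density taking values in $[c_0,C_0]$ for some constants $c_0,C_0>0$. Let $k(x,x')=\min(x,x')$ be the Brownian motion kernel. For a kernel $\kappa$, a finite point set $Z$ and observations $f(Z)$, noise-free zero-mean Gaussian process interpolation has posterior mean $m(x)=\kappa(x,Z)\,\kappa(Z,Z)^{-1}f(Z)$ and posterior covariance $\kappa(x,x')-\kappa(x,Z)\,\kappa(Z,Z)^{-1}\kappa(Z,x')$. Let $m_N,k_N$ be these functions for $\kappa=k$,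 $Z=X$, and put $$I=\int f\,d\mathbb P,\qquad I_{\mathrm{BQ}}=\int m_N\,d\mathbb P,\qquad \sigma^2_{\mathrm{BQ}}=\iint k_N(x,x')\,\mathbb P(dx)\,\mathbb P(dx').$$ Let $\hat\tau^2_{\mathrm{ML}}$ be the minimiser over $\tau^2>0$ of $$f(X)^\top\big(\tau^2k(X,X)\big)^{-1}f(X)+\log\det\big(\tau^2k(X,X)\big),$$ and let $\hat\tau^2_{\mathrm{CV}}$ be the minimiser over $\tau^2>0$ of the leave-one-out loss $$\sum_{n=1}^N\left(\frac{\big[f(x_{N,n})-m_{\setminus n}(x_{N,n})\big]^2}{\tau^2k_{\setminus n}(x_{N,n},x_{N,n})}+\log\big(\tau^2k_{\setminus n}(x_{N,n},x_{N,n})\big)\right),$$ where $m_{\setminus n},k_{\setminus n}$ are the posterior mean and covariance for the kernel $k$ and the data with the $n$-th point removed (both estimators are set to $0$ in the null event that no minimiser exists). Define $$R_{\mathrm{CV}}(N)=\frac{\mathbb E\big[(I-I_{\mathrm{BQ}})^2\big]}{\mathbb E[\hat\tau^2_{\mathrm{CV}}]\,\sigma^2_{\mathrm{BQ}}},\qquad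 R_{\mathrm{ML}}(N)=\frac{\mathbb E\big[(I-I_{\mathrm{BQ}})^2\big]}{\mathbb E[\hat\tau^2_{\mathrm{ML}}]\,\sigma^2_{\mathrm{BQ}}}.$$ Then, as $N\to\infty$, $R_{\mathrm{CV}}(N)=\Theta(1)$ for all $s\in\{0,1\}$ and $H\in(0,1)$, and $$R_{\mathrm{ML}}(N)=\begin{cases}\Theta(1)&\text{if } s=0,\\ \Theta(N^{-2H})&\text{if } s=1,\ H<1/2,\\ \Theta(N^{-1})&\text{if } s=1,\ H\ge 1/2.\end{cases}$$ -/

import Mathlib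

open MeasureTheory ProbabilityTheory

noncomputable section

namespace BQCalibration

/-! ### Kernels -/

/-- The Brownian motion kernel `k(x, x') = min(x, x')` of the prior. -/
def bmKernel (x x' : ℝ) : ℝ := min x x'

/-- The kernel of fractional Brownian motion with Hurst parameter `H`. -/
def fbmKernel (H x x' : ℝ) : ℝ :=
  (|x| ^ (2 * H) + |x'| ^ (2 * H) - |x - x'| ^ (2 * H)) / 2

/-- The kernel of integrated fractional Brownian motion with Hurst parameter `H`. -/
def ifbmKernel (H x x' : ℝ) : ℝ :=
  ∫ z in (0 : ℝ)..x, ∫ z' in (0 : ℝ)..x', fbmKernel H z z'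

/-- The kernel `k_{s,H}`: fractional Brownian motion for `s = 0`, integrated fractional Brownian
motion for `s = 1`. -/
def trueKernel : Fin 2 → ℝ → ℝ → ℝ → ℝ
  | 0, H => fbmKernel H
  | 1, H => ifbmKernel H

/-- `f ∼ GP(0, k)` on the index set `D`: the restriction of `f` to `D` is a Gaussian process under
`μ` with mean zero and covariance `k`. -/
structure IsCenteredGP {Ω : Type*} [MeasurableSpace Ω] (f : ℝ → Ω → ℝ) (D : Set ℝ)
    (k : ℝ → ℝ → ℝ) (μ : Measure Ω) : Prop where
  gaussian : IsGaussianProcess (fun (x : D) => f x) μ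
  mean_eq : ∀ x ∈ D, ∫ ω, f x ω ∂μ = 0
  cov_eq : ∀ x ∈ D, ∀ x' ∈ D, cov[f x, f x'; μ] = k x x'

/-! ### Partitions -/

/-- `x` is a sequence of partitions `0 = x_{N,0} < x_{N,1} < ⋯ < x_{N,N} = T`, `N ≥ 1`.
Only the values `x N n` with `n ≤ N` matter. -/
structure IsPartitionSeq (T : ℝ) (x : ℕ → ℕ → ℝ) : Prop where
  left : ∀ N, 1 ≤ N → x N 0 = 0
  right : ∀ N, 1 ≤ N → x N N = T
  lt : ∀ N, 1 ≤ N → ∀ n < N, x N n < x N (n + 1)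

/-- The longest subinterval of the `N`-th partition. -/
def maxGap (x : ℕ → ℕ → ℝ) (N : ℕ) : ℝ := ⨆ n : Fin N, (x N (n + 1) - x N n)

/-- The shortest subinterval of the `N`-th partition. -/
def minGap (x : ℕ → ℕ → ℝ) (N : ℕ) : ℝ := ⨅ n : Fin N, (x N (n + 1) - x N n)

/-- Quasi-uniformity with constant `C`: `sup_{N ≥ 1} (max_n Δx_{N,n} / min_n Δx_{N,n}) = C`. -/
def IsQuasiUniform (x : ℕ → ℕ → ℝ) (C : ℝ) : Prop :=
  1 ≤ C ∧ IsLUB {r : ℝ | ∃ N : ℕ, 1 ≤ N ∧ r = maxGap x N / minGap x N} C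

/-- Uniform partitions are the quasi-uniform ones with constant `1`. -/
def IsUniform (x : ℕ → ℕ → ℝ) : Prop := IsQuasiUniform x 1

/-- The input points `x_{N,1}, …, x_{N,N}`. -/
def points (x : ℕ → ℕ → ℝ) (N : ℕ) : Fin N → ℝ := fun n => x N (n + 1)

/-! ### Gaussian process interpolation -/

section Interpolation

variable {ι : Type*} [Fintype ι] [DecidableEq ι]

/-- The Gram matrix `k(X, X)`. -/
def gram (k : ℝ → ℝ → ℝ) (X : ι → ℝ) : Matrix ι ι ℝ := Matrix.of fun i j => k (X i) (X j)

/-- The posterior mean `k(x, X)ᵀ k(X, X)⁻¹ y` of noise-free zero-mean Gaussian process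
interpolation of the data `(X, y)`. -/
def postMean (k : ℝ → ℝ → ℝ) (X : ι → ℝ) (y : ι → ℝ) (x : ℝ) : ℝ :=
  (fun i => k x (X i)) ⬝ᵥ ((gram k X)⁻¹).mulVec y

/-- The posterior covariance `k(x, x') - k(x, X)ᵀ k(X, X)⁻¹ k(X, x')`. -/
def postCov (k : ℝ → ℝ → ℝ) (X : ι → ℝ) (x x' : ℝ) : ℝ :=
  k x x' - (fun i => k x (X i)) ⬝ᵥ ((gram k X)⁻¹).mulVec (fun i => k (X i) x')

end Interpolation

/-! ### Amplitude estimators -/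

/-- The kernel `k_τ = τ² k`, parametrised by `t = τ²`. -/
def scaledKernel (k : ℝ → ℝ → ℝ) (t x x' : ℝ) : ℝ := t * k x x'

/-- The loss whose minimisation is equivalent to maximising the log-likelihood of the data under
`GP(0, k)`: `yᵀ k(X, X)⁻¹ y + log det k(X, X)`. -/
def mlLoss (k : ℝ → ℝ → ℝ) {N : ℕ} (X y : Fin N → ℝ) : ℝ :=
  y ⬝ᵥ ((gram k X)⁻¹).mulVec y + Real.log (gram k X).det

/-- The mean at `X n` of the posterior given all data except the `n`-th observation. -/
def looMean (k : ℝ → ℝ → ℝ) {N : ℕ} (X y : Fin N → ℝ) (n : Fin N) : ℝ :=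
  postMean k (fun i : {i : Fin N // i ≠ n} => X i) (fun i => y i) (X n)

/-- The variance at `X n` of the posterior given all data except the `n`-th observation. -/
def looVar (k : ℝ → ℝ → ℝ) {N : ℕ} (X : Fin N → ℝ) (n : Fin N) : ℝ :=
  postCov k (fun i : {i : Fin N // i ≠ n} => X i) (X n) (X n)

/-- The leave-one-out cross-validation loss, whose minimisation is equivalent to maximising the
average log-predictive likelihood of the held-out observations. -/
def cvLoss (k : ℝ → ℝ → ℝ) {N : ℕ} (X y : Fin N → ℝ) : ℝ :=
  ∑ n : Fin N, ((y n - looMean k X y n) ^ 2 / looVar k X n + Real.log (looVar k X n))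

open Classical in
/-- A minimiser of `L` over `(0, ∞)`, and `0` if there is none (for the two losses here this happens
only if all residuals vanish, when the loss tends to `-∞` as `t → 0`). -/
def argminPos (L : ℝ → ℝ) : ℝ :=
  if h : ∃ t : ℝ, 0 < t ∧ ∀ u : ℝ, 0 < u → L t ≤ L u then h.choose else 0

/-- The maximum likelihood estimator of the squared amplitude `τ²`, for the Brownian motion
kernel. -/
def tauSqML {N : ℕ} (X y : Fin N → ℝ) : ℝ :=
  argminPos fun t => mlLoss (scaledKernel bmKernel t) X y

/-- The cross-validation estimator of the squared amplitude `τ²`, for the Brownian motion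
kernel. -/
def tauSqCV {N : ℕ} (X y : Fin N → ℝ) : ℝ :=
  argminPos fun t => cvLoss (scaledKernel bmKernel t) X y

/-! ### Bayesian quadrature -/

/-- The posterior mean of the integral against `P`. -/
def bqMean (P : Measure ℝ) {N : ℕ} (X y : Fin N → ℝ) : ℝ :=
  ∫ x, postMean bmKernel X y x ∂P

/-- The posterior variance of the integral against `P`. -/
def bqVar (P : Measure ℝ) {N : ℕ} (X : Fin N → ℝ) : ℝ :=
  ∫ x, ∫ x', postCov bmKernel X x x' ∂P ∂P

section Ratio

variable {Ω : Type*} [MeasurableSpace Ω]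

/-- The expected squared error `𝔼[(I - I_BQ)²]` with data `f(X)`. -/
def expSqError (μ : Measure Ω) (f : ℝ → Ω → ℝ) (P : Measure ℝ) {N : ℕ} (X : Fin N → ℝ) : ℝ :=
  ∫ ω, (∫ x, f x ω ∂P - bqMean P X (fun i => f (X i) ω)) ^ 2 ∂μ

/-- The ratio `𝔼[(I - I_BQ)²] / (𝔼[τ̂_CV²] σ²_BQ)`. -/
def ratioCV (μ : Measure Ω) (f : ℝ → Ω → ℝ) (P : Measure ℝ) {N : ℕ} (X : Fin N → ℝ) : ℝ :=
  expSqError μ f P X / ((∫ ω, tauSqCV X (fun i => f (X i) ω) ∂μ) * bqVar P X)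

/-- The ratio `𝔼[(I - I_BQ)²] / (𝔼[τ̂_ML²] σ²_BQ)`. -/
def ratioML (μ : Measure Ω) (f : ℝ → Ω → ℝ) (P : Measure ℝ) {N : ℕ} (X : Fin N → ℝ) : ℝ :=
  expSqError μ f P X / ((∫ ω, tauSqML X (fun i => f (X i) ω) ∂μ) * bqVar P X)

end Ratio

end BQCalibration

end

namespace BQCalibration

open Set Filter Topology

/-! Conditioning Brownian motion on a uniform grid of mesh h = T/N interpolates linearly between
nodes, with value 0 at the origin. Since f(0) = 0 almost surely, I - I_BQ is the integral against P
of the linear interpolation error of f. The interpolation error annihilates affine functions. In the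
spectral representations of both true kernels, the parts of the features other than sine and cosine
are affine, so after interpolation in both arguments one formula remains for s = 0 and s = 1: the
expected squared error is a constant times the `energy` ∫ |F_h(ξ)|² ξ^(-α) dξ, with α = 1 + 2s + 2H
and F_h the Fourier transform of the functional g ↦ ∫ `resid h g` dP. The posterior variance is the
case s = 0, H = 1/2, that is α = 2.

The energy has order h^min(α,4). Upper bounds come from kernels that can be inspected directly:
fractional Brownian motion with H < 1/2 for α < 2 (`energy_le_of_lt_two`), and integrated Brownian
motion, whose error covariance is local, for α = 4 (`energy_four_le`). Splitting the frequencies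
gives the remaining exponents (`energy_le_of_le_four`, `energy_le_of_four_le`). For the lower bound
h^α, frequencies near 2π/h are aliased on the grid to slow oscillations (`energy_ge`). For the lower
bound h^4, interpolation errs with one sign at frequencies of order 1/T (`energy_ge_pow_four`).

Both amplitude estimators are explicit on the grid: ML averages normalised squared increments
(`tauSqML_grid`) and CV averages normalised squared second differences, plus one increment at the
right end (`tauSqCV_grid`). Second differences have variance of order h^(α-1), so the bulk of CV has
mean h^(α-2). For s = 1 the boundary increment contributes h², which makes the order h^min(α-2,2).
This matches the energy divided by h², hence the CV ratio is Θ(1). ML sees only increments: its mean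
has order h^(2H-1) for s = 0, but order h for every integrated process. Hence the ML ratio is
h^(min(α,4)-3) when s = 1. -/

/-- The error at `x` of the interpolation `(1 - l) * g a + l * g b`. -/
def res (x a b l : ℝ) (g : ℝ → ℝ) : ℝ := g x - ((1 - l) * g a + l * g b)

theorem res_congr {x a b l : ℝ} {g g' : ℝ → ℝ} (hx : g x = g' x) (ha : g a = g' a)
    (hb : g b = g' b) : res x a b l g = res x a b l g' := by
  simp only [res, hx, ha, hb]

/-! ### Weighted integrals over the half line -/

/-- The bound `α < k + 1` gives integrability at 0 and `1 < α` at infinity. These weights dominate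
all the spectral integrals below. -/
theorem integrableOn_min_pow_mul_rpow (k : ℕ) {α : ℝ} (h1 : 1 < α) (h2 : α < k + 1) :
    IntegrableOn (fun ξ : ℝ => min 1 (ξ ^ k) * ξ ^ (-α)) (Ioi 0) := by
  rw [← Ioc_union_Ioi_eq_Ioi (zero_le_one' ℝ)]
  refine IntegrableOn.union ?_ ?_
  · have h : IntegrableOn (fun ξ : ℝ => ξ ^ ((k : ℝ) - α)) (Ioc 0 1) := by
      have := (intervalIntegral.intervalIntegrable_rpow' (a := 0) (b := 1)
        (r := (k : ℝ) - α) (by linarith))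
      rwa [intervalIntegrable_iff_integrableOn_Ioc_of_le zero_le_one] at this
    refine h.congr_fun (fun ξ hξ => ?_) measurableSet_Ioc
    have hp : ξ ^ k ≤ 1 := pow_le_one₀ hξ.1.le hξ.2
    simp only
    rw [min_eq_right hp, sub_eq_add_neg, Real.rpow_add hξ.1, Real.rpow_natCast]
  · have h : IntegrableOn (fun ξ : ℝ => ξ ^ (-α)) (Ioi 1) :=
      integrableOn_Ioi_rpow_of_lt (by linarith) one_pos
    refine h.congr_fun (fun ξ (hξ : 1 < ξ) => ?_) measurableSet_Ioi
    have hp : 1 ≤ ξ ^ k := one_le_pow₀ hξ.le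
    simp [min_eq_left hp]

theorem min_one_pow_sq {ξ : ℝ} (hξ : 0 < ξ) (k : ℕ) :
    (min 1 (ξ ^ k)) ^ 2 = min 1 (ξ ^ (2 * k)) := by
  rcases le_total ξ 1 with h | h
  · rw [min_eq_right (pow_le_one₀ hξ.le h), min_eq_right (pow_le_one₀ hξ.le h)]; ring
  · rw [min_eq_left (one_le_pow₀ h), min_eq_left (one_le_pow₀ h)]; ring

theorem integrableOn_bound_sq (k : ℕ) (M : ℝ) {α : ℝ} (h1 : 1 < α) (h2 : α < 2 * k + 1) :
    IntegrableOn (fun ξ : ℝ => (M * min 1 (ξ ^ k)) ^ 2 * |ξ ^ (-α)|) (Ioi 0) := by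
  have h := (integrableOn_min_pow_mul_rpow (2 * k) h1 (by push_cast; linarith)).const_mul (M ^ 2)
  refine IntegrableOn.congr_fun h (fun ξ (hξ : 0 < ξ) => ?_) measurableSet_Ioi
  rw [mul_pow, min_one_pow_sq hξ, abs_of_nonneg (Real.rpow_nonneg hξ.le _), mul_assoc]

/-- Scaling in frequency. It produces the self-similarity exponents without evaluating any integral.
-/
theorem integral_comp_mul_rpow (φ : ℝ → ℝ) {b : ℝ} (hb : 0 < b) (α : ℝ) :
    ∫ ξ in Ioi 0, φ (ξ * b) * ξ ^ (-α) = b ^ (α - 1) * ∫ ξ in Ioi 0, φ ξ * ξ ^ (-α) := by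
  have h := integral_comp_mul_left_Ioi (fun u => φ u * u ^ (-α)) 0 hb
  rw [mul_zero, smul_eq_mul] at h
  have h2 : ∫ ξ in Ioi 0, φ (b * ξ) * (b * ξ) ^ (-α)
      = b ^ (-α) * ∫ ξ in Ioi 0, φ (ξ * b) * ξ ^ (-α) := by
    rw [← integral_const_mul]
    refine setIntegral_congr_fun measurableSet_Ioi fun ξ (hξ : 0 < ξ) => ?_
    rw [Real.mul_rpow hb.le hξ.le, mul_comm b ξ]; ring
  rw [h2] at h
  have hbp : b ^ (α - 1) * b ^ (-α) = b⁻¹ := by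
    rw [← Real.rpow_add hb, ← Real.rpow_neg_one]; congr 1; ring
  have hb2 : b ^ (α - 1) ≠ 0 := (Real.rpow_pos_of_pos hb _).ne'
  have hb3 : b ^ (-α) ≠ 0 := (Real.rpow_pos_of_pos hb _).ne'
  rw [← hbp, mul_comm (b ^ (α - 1)), mul_assoc] at h
  exact mul_left_cancel₀ hb3 h

/-- Fubini for a kernel given by a two-component feature map, dominated by `G ^ 2 * |w|` uniformly
in the space variables. With Lebesgue measure on [0, x] it integrates the fractional kernel; with
`P` it produces the energy. -/
theorem integral_bilinear_swap {ρ ρ' : Measure ℝ} [IsFiniteMeasure ρ] [IsFiniteMeasure ρ']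
    {A B : ℝ → ℝ → ℝ} (hA : Measurable (Function.uncurry A)) (hB : Measurable (Function.uncurry B))
    {w G : ℝ → ℝ} (hw : Measurable w) (hG : IntegrableOn (fun ξ => G ξ ^ 2 * |w ξ|) (Ioi 0))
    (hρ : ∀ᵐ z ∂ρ, ∀ ξ, 0 < ξ → |A ξ z| ≤ G ξ ∧ |B ξ z| ≤ G ξ)
    (hρ' : ∀ᵐ z ∂ρ', ∀ ξ, 0 < ξ → |A ξ z| ≤ G ξ ∧ |B ξ z| ≤ G ξ) :
    IntegrableOn (fun ξ => ((∫ z, A ξ z ∂ρ) * (∫ z, A ξ z ∂ρ')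
        + (∫ z, B ξ z ∂ρ) * (∫ z, B ξ z ∂ρ')) * w ξ) (Ioi 0) ∧
      ∫ z, ∫ z', (∫ ξ in Ioi 0, (A ξ z * A ξ z' + B ξ z * B ξ z') * w ξ) ∂ρ' ∂ρ
        = ∫ ξ in Ioi 0, ((∫ z, A ξ z ∂ρ) * (∫ z, A ξ z ∂ρ')
          + (∫ z, B ξ z ∂ρ) * (∫ z, B ξ z ∂ρ')) * w ξ := by
  set m : Measure ℝ := volume.restrict (Ioi 0) with hm
  have hAm : Measurable fun q : (ℝ × ℝ) × ℝ => A q.2 q.1.1 :=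
    hA.comp (by fun_prop : Measurable fun q : (ℝ × ℝ) × ℝ => (q.2, q.1.1))
  have hAm' : Measurable fun q : (ℝ × ℝ) × ℝ => A q.2 q.1.2 :=
    hA.comp (by fun_prop : Measurable fun q : (ℝ × ℝ) × ℝ => (q.2, q.1.2))
  have hBm : Measurable fun q : (ℝ × ℝ) × ℝ => B q.2 q.1.1 :=
    hB.comp (by fun_prop : Measurable fun q : (ℝ × ℝ) × ℝ => (q.2, q.1.1))
  have hBm' : Measurable fun q : (ℝ × ℝ) × ℝ => B q.2 q.1.2 :=
    hB.comp (by fun_prop : Measurable fun q : (ℝ × ℝ) × ℝ => (q.2, q.1.2))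
  have hξ : ∀ᵐ q ∂((ρ.prod ρ').prod m), 0 < q.2 :=
    Measure.quasiMeasurePreserving_snd.ae (ae_restrict_mem measurableSet_Ioi)
  have hz : ∀ᵐ q ∂((ρ.prod ρ').prod m),
      ∀ ξ, 0 < ξ → |A ξ q.1.1| ≤ G ξ ∧ |B ξ q.1.1| ≤ G ξ :=
    Measure.quasiMeasurePreserving_fst.ae (Measure.quasiMeasurePreserving_fst.ae hρ)
  have hz' : ∀ᵐ q ∂((ρ.prod ρ').prod m),
      ∀ ξ, 0 < ξ → |A ξ q.1.2| ≤ G ξ ∧ |B ξ q.1.2| ≤ G ξ :=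
    Measure.quasiMeasurePreserving_fst.ae (Measure.quasiMeasurePreserving_snd.ae hρ')
  have hprod : ∀ C : ℝ → ℝ → ℝ, Measurable (fun q : (ℝ × ℝ) × ℝ => C q.2 q.1.1) →
      Measurable (fun q : (ℝ × ℝ) × ℝ => C q.2 q.1.2) →
      (∀ᵐ q ∂((ρ.prod ρ').prod m), |C q.2 q.1.1| ≤ G q.2 ∧ |C q.2 q.1.2| ≤ G q.2) →
      Integrable (fun q : (ℝ × ℝ) × ℝ => C q.2 q.1.1 * C q.2 q.1.2 * w q.2)
        ((ρ.prod ρ').prod m) := by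
    intro C h1 h2 h3
    have hG' : Integrable (fun q : (ℝ × ℝ) × ℝ => G q.2 ^ 2 * |w q.2|) ((ρ.prod ρ').prod m) :=
      hG.integrable.comp_snd (ρ.prod ρ')
    refine hG'.mono' ((h1.mul h2).mul (hw.comp measurable_snd)).aestronglyMeasurable ?_
    filter_upwards [h3] with q hq
    rw [Real.norm_eq_abs, abs_mul, abs_mul, sq]
    have := (abs_nonneg _).trans hq.1
    gcongr
    exacts [hq.1, hq.2]
  have iA := hprod A hAm hAm' (by
    filter_upwards [hξ, hz, hz'] with q h1 h2 h3 using ⟨(h2 _ h1).1, (h3 _ h1).1⟩)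
  have iB := hprod B hBm hBm' (by
    filter_upwards [hξ, hz, hz'] with q h1 h2 h3 using ⟨(h2 _ h1).2, (h3 _ h1).2⟩)
  have key : ∀ ξ, ∫ q : ℝ × ℝ, A ξ q.1 * A ξ q.2 * w ξ ∂(ρ.prod ρ')
      = (∫ z, A ξ z ∂ρ) * (∫ z, A ξ z ∂ρ') * w ξ := fun ξ => by
    rw [integral_mul_const, integral_prod_mul]
  have keyB : ∀ ξ, ∫ q : ℝ × ℝ, B ξ q.1 * B ξ q.2 * w ξ ∂(ρ.prod ρ')
      = (∫ z, B ξ z ∂ρ) * (∫ z, B ξ z ∂ρ') * w ξ := fun ξ => by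
    rw [integral_mul_const, integral_prod_mul]
  have jA := iA.integral_prod_right
  have jB := iB.integral_prod_right
  simp only [key] at jA
  simp only [keyB] at jB
  have iF : Integrable (Function.uncurry fun (q : ℝ × ℝ) ξ =>
      (A ξ q.1 * A ξ q.2 + B ξ q.1 * B ξ q.2) * w ξ) ((ρ.prod ρ').prod m) := by
    refine (iA.add iB).congr (ae_of_all _ fun q => ?_)
    simp [Function.uncurry, add_mul]
  refine ⟨(jA.add jB).congr (ae_of_all _ fun ξ => by simp [add_mul]), ?_⟩
  have h1 : ∫ z, ∫ z', (∫ ξ in Ioi 0, (A ξ z * A ξ z' + B ξ z * B ξ z') * w ξ) ∂ρ' ∂ρ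
      = ∫ q : ℝ × ℝ, (∫ ξ in Ioi 0,
        (A ξ q.1 * A ξ q.2 + B ξ q.1 * B ξ q.2) * w ξ) ∂(ρ.prod ρ') :=
    (integral_prod _ iF.integral_prod_left).symm
  rw [h1, integral_integral_swap iF]
  have hsA := iA.prod_left_ae
  have hsB := iB.prod_left_ae
  refine integral_congr_ae ?_
  filter_upwards [hsA, hsB] with ξ h2 h3
  simp only [add_mul]
  rw [integral_add h2 h3, key, keyB]

end BQCalibration

namespace BQCalibration
open Set Filter Topology

/-! ### Spectral representation of the kernels -/

theorem measurable_rpow_neg (α : ℝ) : Measurable fun ξ : ℝ => ξ ^ (-α) := by fun_prop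

/-- The constant in the spectral representation of fractional Brownian motion. -/
noncomputable def specConst (H : ℝ) : ℝ :=
  (2 * ∫ ξ in Ioi (0 : ℝ), (1 - Real.cos ξ) * ξ ^ (-(1 + 2 * H)))⁻¹

theorem abs_one_sub_cos_le (y : ℝ) : |1 - Real.cos y| ≤ |y| := by
  simpa [abs_sub_comm] using Real.abs_cos_sub_cos_le 0 y

theorem abs_one_sub_cos_le_two (y : ℝ) : |1 - Real.cos y| ≤ 2 := by
  rw [abs_le]; constructor <;> linarith [Real.cos_le_one y, Real.neg_one_le_cos y]

theorem le_mul_min_one {u ξ z M : ℝ} (hξ : 0 < ξ) (hz : 0 ≤ z) (hzM : z ≤ M) (h1 : u ≤ 2)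
    (h2 : u ≤ ξ * z) : u ≤ (2 + M) * min 1 (ξ ^ 1) := by
  rw [pow_one]
  rcases le_total ξ 1 with h | h
  · rw [min_eq_right h]; nlinarith
  · rw [min_eq_left h]; linarith

theorem spec_bound {z M : ℝ} (hz : 0 ≤ z) (hzM : z ≤ M) {ξ : ℝ} (hξ : 0 < ξ) :
    |1 - Real.cos (ξ * z)| ≤ (2 + M) * min 1 (ξ ^ 1) ∧
      |Real.sin (ξ * z)| ≤ (2 + M) * min 1 (ξ ^ 1) := by
  have h : |ξ * z| = ξ * z := abs_of_nonneg (by positivity)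
  refine ⟨le_mul_min_one hξ hz hzM (abs_one_sub_cos_le_two _) ?_,
    le_mul_min_one hξ hz hzM ((Real.abs_sin_le_one _).trans one_le_two) ?_⟩
  · exact (abs_one_sub_cos_le _).trans h.le
  · exact Real.abs_sin_le_abs.trans h.le

theorem integrableOn_one_sub_cos {H : ℝ} (hH0 : 0 < H) (hH1 : H < 1) (x : ℝ) :
    IntegrableOn (fun ξ : ℝ => (1 - Real.cos (ξ * x)) * ξ ^ (-(1 + 2 * H))) (Ioi 0) := by
  have h := (integrableOn_min_pow_mul_rpow 2 (α := 1 + 2 * H) (by linarith)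
    (by push_cast; linarith)).const_mul (2 + x ^ 2)
  refine Integrable.mono' h (by fun_prop) ?_
  filter_upwards [ae_restrict_mem measurableSet_Ioi] with ξ (hξ : 0 < ξ)
  rw [norm_mul, Real.norm_eq_abs, Real.norm_eq_abs, abs_of_nonneg (Real.rpow_nonneg hξ.le _),
    ← mul_assoc]
  gcongr
  have h0 : 0 ≤ 1 - Real.cos (ξ * x) := by linarith [Real.cos_le_one (ξ * x)]
  rw [abs_of_nonneg h0]
  have h2 := Real.one_sub_sq_div_two_le_cos (x := ξ * x)
  have h3 := Real.neg_one_le_cos (ξ * x)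
  rcases le_total ξ 1 with h | h
  · rw [min_eq_right (pow_le_one₀ hξ.le h)]; nlinarith [sq_nonneg (ξ * x), sq_nonneg ξ]
  · rw [min_eq_left (one_le_pow₀ h)]; nlinarith [sq_nonneg x]

theorem setIntegral_Ioi_pos {g : ℝ → ℝ} (hg : IntegrableOn g (Ioi 0))
    (h0 : ∀ ξ, 0 < ξ → 0 ≤ g ξ) (h1 : ∀ ξ, 0 < ξ → ξ < 1 → 0 < g ξ) :
    0 < ∫ ξ in Ioi 0, g ξ := by
  rw [setIntegral_pos_iff_support_of_nonneg_ae
    ((ae_restrict_mem measurableSet_Ioi).mono fun ξ hξ => h0 ξ hξ) hg]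
  refine lt_of_lt_of_le ?_ (measure_mono (s := Ioo (0 : ℝ) 1) fun ξ hξ => ⟨(h1 ξ hξ.1 hξ.2).ne', hξ.1⟩)
  simp

theorem cos_lt_one_of_mem {ξ : ℝ} (h0 : 0 < ξ) (h1 : ξ < 1) : Real.cos ξ < 1 := by
  have := Real.cos_lt_cos_of_nonneg_of_le_pi le_rfl (by linarith [Real.pi_gt_three]) h0
  rwa [Real.cos_zero] at this

theorem specConst_pos {H : ℝ} (hH0 : 0 < H) (hH1 : H < 1) : 0 < specConst H := by
  rw [specConst, inv_pos]
  refine mul_pos two_pos (setIntegral_Ioi_pos ?_ ?_ ?_)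
  · simpa using integrableOn_one_sub_cos hH0 hH1 1
  · intro ξ hξ
    exact mul_nonneg (by linarith [Real.cos_le_one ξ]) (Real.rpow_nonneg hξ.le _)
  · intro ξ hξ h1
    exact mul_pos (by linarith [cos_lt_one_of_mem hξ h1]) (Real.rpow_pos_of_pos hξ _)

/-- Rescaling by |x| leaves exactly the integral inverted in `specConst`. -/
theorem integral_one_sub_cos {H : ℝ} (hH0 : 0 < H) (hH1 : H < 1) (x : ℝ) :
    specConst H * ∫ ξ in Ioi (0 : ℝ), (1 - Real.cos (ξ * x)) * ξ ^ (-(1 + 2 * H))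
      = |x| ^ (2 * H) / 2 := by
  rcases eq_or_ne x 0 with rfl | hx
  · simp [Real.zero_rpow (by positivity : 2 * H ≠ 0)]
  · have hx' : 0 < |x| := abs_pos.2 hx
    have h := integral_comp_mul_rpow (fun u => 1 - Real.cos u) hx' (1 + 2 * H)
    have h2 : ∀ ξ : ℝ, Real.cos (ξ * |x|) = Real.cos (ξ * x) := fun ξ => by
      rcases abs_choice x with h | h <;> rw [h]
      rw [mul_neg, Real.cos_neg]
    simp only [h2] at h
    rw [h, add_sub_cancel_left]
    have hc := (specConst_pos hH0 hH1).ne'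
    rw [specConst] at hc ⊢
    -- Positivity of `specConst` is reused backwards: the integral inside it is nonzero because its
    -- inverse is.
    have := inv_ne_zero hc
    rw [inv_inv] at this
    have h3 := right_ne_zero_of_mul this
    field_simp

/-- The two components of the spectral feature map of `trueKernel s H`. -/
noncomputable def specA : Fin 2 → ℝ → ℝ → ℝ
  | 0, ξ, x => 1 - Real.cos (ξ * x)
  | 1, ξ, x => x - Real.sin (ξ * x) / ξ

noncomputable def specB : Fin 2 → ℝ → ℝ → ℝ
  | 0, ξ, x => Real.sin (ξ * x)
  | 1, ξ, x => (1 - Real.cos (ξ * x)) / ξ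

/-- The addition formula for the cosine gives (1 - cos a)(1 - cos b) + sin a sin b = (1 - cos a) +
(1 - cos b) - (1 - cos(a - b)), and each summand integrates to a power. -/
theorem fbmKernel_spectral {H : ℝ} (hH0 : 0 < H) (hH1 : H < 1) (x x' : ℝ) :
    IntegrableOn (fun ξ => (specA 0 ξ x * specA 0 ξ x' + specB 0 ξ x * specB 0 ξ x')
        * ξ ^ (-(1 + 2 * H))) (Ioi 0) ∧
      fbmKernel H x x' = specConst H * ∫ ξ in Ioi 0,
        (specA 0 ξ x * specA 0 ξ x' + specB 0 ξ x * specB 0 ξ x') * ξ ^ (-(1 + 2 * H)) := by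
  have e : ∀ ξ : ℝ, (specA 0 ξ x * specA 0 ξ x' + specB 0 ξ x * specB 0 ξ x')
        * ξ ^ (-(1 + 2 * H)) = (1 - Real.cos (ξ * x)) * ξ ^ (-(1 + 2 * H))
        + (1 - Real.cos (ξ * x')) * ξ ^ (-(1 + 2 * H))
        - (1 - Real.cos (ξ * (x - x'))) * ξ ^ (-(1 + 2 * H)) := fun ξ => by
    rw [mul_sub ξ x x', Real.cos_sub]
    simp only [specA, specB]; ring
  have i := integrableOn_one_sub_cos hH0 hH1
  simp only [e]
  refine ⟨((i x).add (i x')).sub (i (x - x')), ?_⟩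
  have e1 := integral_sub ((i x).add (i x')) (i (x - x'))
  have e2 := integral_add (i x) (i x')
  simp only [Pi.add_apply] at e1
  rw [e1, e2, mul_sub, mul_add,
    integral_one_sub_cos hH0 hH1, integral_one_sub_cos hH0 hH1, integral_one_sub_cos hH0 hH1,
    fbmKernel]
  ring

theorem integral_one_sub_cos_mul {ξ : ℝ} (hξ : ξ ≠ 0) (x : ℝ) :
    ∫ z in (0 : ℝ)..x, (1 - Real.cos (ξ * z)) = x - Real.sin (ξ * x) / ξ := by
  rw [intervalIntegral.integral_sub (by simp) (by apply Continuous.intervalIntegrable; fun_prop),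
    intervalIntegral.integral_comp_mul_left (fun z => Real.cos z) hξ]
  simp [div_eq_inv_mul]

theorem integral_sin_mul {ξ : ℝ} (hξ : ξ ≠ 0) (x : ℝ) :
    ∫ z in (0 : ℝ)..x, Real.sin (ξ * z) = (1 - Real.cos (ξ * x)) / ξ := by
  rw [intervalIntegral.integral_comp_mul_left (fun z => Real.sin z) hξ]
  simp [div_eq_inv_mul]

/-- Integrating the kernel in both arguments integrates its features: the components for s = 1 are
the primitives of those for s = 0. -/
theorem ifbmKernel_spectral {H : ℝ} (hH0 : 0 < H) (hH1 : H < 1) {x x' : ℝ} (hx : 0 ≤ x)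
    (hx' : 0 ≤ x') :
    IntegrableOn (fun ξ => (specA 1 ξ x * specA 1 ξ x' + specB 1 ξ x * specB 1 ξ x')
        * ξ ^ (-(1 + 2 * H))) (Ioi 0) ∧
      ifbmKernel H x x' = specConst H * ∫ ξ in Ioi 0,
        (specA 1 ξ x * specA 1 ξ x' + specB 1 ξ x * specB 1 ξ x') * ξ ^ (-(1 + 2 * H)) := by
  have hb : ∀ y : ℝ, y ≤ max x x' → ∀ᵐ z ∂(volume.restrict (Ioc 0 y)), ∀ ξ, 0 < ξ →
      |specA 0 ξ z| ≤ (2 + max x x') * min 1 (ξ ^ 1) ∧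
        |specB 0 ξ z| ≤ (2 + max x x') * min 1 (ξ ^ 1) := fun y hy => by
    filter_upwards [ae_restrict_mem measurableSet_Ioc] with z hz ξ hξ
    exact spec_bound hz.1.le (hz.2.trans hy) hξ
  have hmA : Measurable (Function.uncurry (specA 0)) := by
    simp only [Function.uncurry_def, specA]; fun_prop
  have hmB : Measurable (Function.uncurry (specB 0)) := by
    simp only [Function.uncurry_def, specB]; fun_prop
  obtain ⟨h1, h2⟩ := integral_bilinear_swap hmA hmB (measurable_rpow_neg (1 + 2 * H))
    (integrableOn_bound_sq 1 (2 + max x x') (by linarith) (by push_cast; linarith))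
    (hb x (le_max_left _ _)) (hb x' (le_max_right _ _))
  have eA : ∀ y, 0 ≤ y → ∀ ξ : ℝ, 0 < ξ → ∫ z in Ioc 0 y, specA 0 ξ z = specA 1 ξ y :=
    fun y hy ξ hξ => by
      rw [← intervalIntegral.integral_of_le hy]; exact integral_one_sub_cos_mul hξ.ne' y
  have eB : ∀ y, 0 ≤ y → ∀ ξ : ℝ, 0 < ξ → ∫ z in Ioc 0 y, specB 0 ξ z = specB 1 ξ y :=
    fun y hy ξ hξ => by
      rw [← intervalIntegral.integral_of_le hy]; exact integral_sin_mul hξ.ne' y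
  have e : EqOn (fun ξ => ((∫ z in Ioc 0 x, specA 0 ξ z) * (∫ z in Ioc 0 x', specA 0 ξ z)
      + (∫ z in Ioc 0 x, specB 0 ξ z) * (∫ z in Ioc 0 x', specB 0 ξ z)) * ξ ^ (-(1 + 2 * H)))
      (fun ξ => (specA 1 ξ x * specA 1 ξ x' + specB 1 ξ x * specB 1 ξ x')
        * ξ ^ (-(1 + 2 * H))) (Ioi 0) := fun ξ (hξ : 0 < ξ) => by
    simp only [eA x hx ξ hξ, eA x' hx' ξ hξ, eB x hx ξ hξ, eB x' hx' ξ hξ]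
  refine ⟨h1.congr_fun e measurableSet_Ioi, ?_⟩
  rw [← setIntegral_congr_fun measurableSet_Ioi e, ← h2, ifbmKernel,
    intervalIntegral.integral_of_le hx, ← integral_const_mul]
  simp only [intervalIntegral.integral_of_le hx', ← integral_const_mul,
    (fbmKernel_spectral hH0 hH1 _ _).2]

theorem trueKernel_spectral (s : Fin 2) {H : ℝ} (hH0 : 0 < H) (hH1 : H < 1) {x x' : ℝ}
    (hx : 0 ≤ x) (hx' : 0 ≤ x') :
    IntegrableOn (fun ξ => (specA s ξ x * specA s ξ x' + specB s ξ x * specB s ξ x')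
        * ξ ^ (-(1 + 2 * H))) (Ioi 0) ∧
      trueKernel s H x x' = specConst H * ∫ ξ in Ioi 0,
        (specA s ξ x * specA s ξ x' + specB s ξ x * specB s ξ x') * ξ ^ (-(1 + 2 * H)) := by
  fin_cases s
  · exact fbmKernel_spectral hH0 hH1 x x'
  · exact ifbmKernel_spectral hH0 hH1 hx hx'

end BQCalibration

namespace BQCalibration
open Set Filter Topology

/-! ### Interpolation errors of the kernels -/

theorem res_integral {F : ℝ → ℝ → ℝ} {x a b : ℝ} (l : ℝ)
    (hx : IntegrableOn (fun ξ => F ξ x) (Ioi 0)) (ha : IntegrableOn (fun ξ => F ξ a) (Ioi 0))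
    (hb : IntegrableOn (fun ξ => F ξ b) (Ioi 0)) :
    IntegrableOn (fun ξ => res x a b l (F ξ)) (Ioi 0) ∧
      res x a b l (fun y => ∫ ξ in Ioi 0, F ξ y) = ∫ ξ in Ioi 0, res x a b l (F ξ) := by
  have h1 := ha.const_mul (1 - l)
  have h2 := hb.const_mul l
  refine ⟨hx.sub (h1.add h2), ?_⟩
  simp only [res]
  have e := integral_sub hx (h1.add h2)
  simp only [Pi.add_apply] at e
  rw [e, integral_add h1 h2, integral_const_mul, integral_const_mul]

/-- The decay exponent of the spectral density of `trueKernel s H`. -/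
def specExp (s : Fin 2) (H : ℝ) : ℝ := 1 + 2 * ((s : ℕ) : ℝ) + 2 * H

/-- Since `x` is the convex combination of `a` and `b`, `res` kills constants and the identity. What
survives of the features is ±cos, ±sin for s = 0 and the same divided by ξ for s = 1; the resulting
factor ξ^(-2) is absorbed in `specExp`. -/
theorem res_res_trueKernel (s : Fin 2) {H : ℝ} (hH0 : 0 < H) (hH1 : H < 1)
    {x a b l x' a' b' l' : ℝ} (hx0 : 0 ≤ x) (ha0 : 0 ≤ a) (hb0 : 0 ≤ b)
    (hx0' : 0 ≤ x') (ha0' : 0 ≤ a') (hb0' : 0 ≤ b') (hx : x = (1 - l) * a + l * b)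
    (hx' : x' = (1 - l') * a' + l' * b') :
    res x a b l (fun y => res x' a' b' l' (trueKernel s H y)) = specConst H * ∫ ξ in Ioi 0,
      (res x a b l (fun y => Real.cos (ξ * y)) * res x' a' b' l' (fun y => Real.cos (ξ * y))
        + res x a b l (fun y => Real.sin (ξ * y)) * res x' a' b' l' (fun y => Real.sin (ξ * y)))
        * ξ ^ (-specExp s H) := by
  have key := fun (y y' : ℝ) => trueKernel_spectral s hH0 hH1 (x := y) (x' := y')
  have step : ∀ y, 0 ≤ y → IntegrableOn (fun ξ => res x' a' b' l' fun y' =>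
      (specA s ξ y * specA s ξ y' + specB s ξ y * specB s ξ y') * ξ ^ (-(1 + 2 * H))) (Ioi 0) ∧
      res x' a' b' l' (trueKernel s H y) = specConst H * ∫ ξ in Ioi 0, res x' a' b' l' fun y' =>
      (specA s ξ y * specA s ξ y' + specB s ξ y * specB s ξ y') * ξ ^ (-(1 + 2 * H)) := by
    intro y hy
    obtain ⟨h1, h2⟩ := res_integral (F := fun ξ y' =>
      (specA s ξ y * specA s ξ y' + specB s ξ y * specB s ξ y') * ξ ^ (-(1 + 2 * H))) l'
      (key y x' hy hx0').1 (key y a' hy ha0').1 (key y b' hy hb0').1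
    refine ⟨h1, ?_⟩
    rw [← h2]
    simp only [res, (key y x' hy hx0').2, (key y a' hy ha0').2, (key y b' hy hb0').2]
    ring
  obtain ⟨h1, h2⟩ := res_integral (F := fun ξ y => res x' a' b' l' fun y' =>
      (specA s ξ y * specA s ξ y' + specB s ξ y * specB s ξ y') * ξ ^ (-(1 + 2 * H))) l
      (step x hx0).1 (step a ha0).1 (step b hb0).1
  have e : res x a b l (fun y => res x' a' b' l' (trueKernel s H y)) = specConst H *
      res x a b l (fun y => ∫ ξ in Ioi 0, res x' a' b' l' fun y' =>
      (specA s ξ y * specA s ξ y' + specB s ξ y * specB s ξ y') * ξ ^ (-(1 + 2 * H))) := by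
    rw [res_congr (g' := fun y => specConst H * ∫ ξ in Ioi 0, res x' a' b' l' fun y' =>
      (specA s ξ y * specA s ξ y' + specB s ξ y * specB s ξ y') * ξ ^ (-(1 + 2 * H)))
      (step x hx0).2 (step a ha0).2 (step b hb0).2]
    simp only [res]; ring
  rw [e, h2]
  congr 1
  refine setIntegral_congr_fun measurableSet_Ioi fun ξ (hξ : 0 < ξ) => ?_
  have hp : ξ ^ (-(1 + 2 * H)) = ξ ^ (-specExp s H) * ξ ^ (2 * (s : ℕ)) := by
    rw [← Real.rpow_natCast, ← Real.rpow_add hξ, specExp]; congr 1; push_cast; ring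
  simp only [hp]
  generalize ξ ^ (-specExp s H) = W
  fin_cases s
  · simp only [res, specA, specB]; simp; ring
  · simp only [res, specA, specB]; simp [hx, hx']; field_simp; ring

/-- The error at `x` of piecewise linear interpolation on the grid `h ℤ`. -/
noncomputable def resid (h : ℝ) (g : ℝ → ℝ) (x : ℝ) : ℝ :=
  res x (h * ⌊x / h⌋) (h * ⌊x / h⌋ + h) (Int.fract (x / h)) g

/-- The covariance of the interpolation errors at `x` and `x'` when `K` is the covariance of the
process. -/
noncomputable def resid2 (h : ℝ) (K : ℝ → ℝ → ℝ) (x x' : ℝ) : ℝ :=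
  resid h (fun y => resid h (K y) x') x

theorem cell_eq {h : ℝ} (hh : 0 < h) (x : ℝ) :
    x = (1 - Int.fract (x / h)) * (h * ⌊x / h⌋) + Int.fract (x / h) * (h * ⌊x / h⌋ + h) := by
  have : Int.fract (x / h) = x / h - ⌊x / h⌋ := rfl
  rw [this]; field_simp; ring

theorem cell_nonneg {h x : ℝ} (hh : 0 < h) (hx : 0 ≤ x) : 0 ≤ h * (⌊x / h⌋ : ℝ) := by
  have : (0 : ℤ) ≤ ⌊x / h⌋ := Int.floor_nonneg.2 (by positivity)
  have : (0 : ℝ) ≤ ⌊x / h⌋ := by exact_mod_cast this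
  positivity

theorem cell_le {h : ℝ} (hh : 0 < h) (x : ℝ) : h * (⌊x / h⌋ : ℝ) ≤ x := by
  have := Int.floor_le (x / h)
  rw [le_div_iff₀ hh] at this; linarith

theorem lt_cell_add {h : ℝ} (hh : 0 < h) (x : ℝ) : x < h * (⌊x / h⌋ : ℝ) + h := by
  have := Int.lt_floor_add_one (x / h)
  rw [div_lt_iff₀ hh] at this; linarith

theorem resid2_trueKernel (s : Fin 2) {H : ℝ} (hH0 : 0 < H) (hH1 : H < 1) {h : ℝ} (hh : 0 < h)
    {x x' : ℝ} (hx : 0 ≤ x) (hx' : 0 ≤ x') :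
    resid2 h (trueKernel s H) x x' = specConst H * ∫ ξ in Ioi 0,
      (resid h (fun y => Real.cos (ξ * y)) x * resid h (fun y => Real.cos (ξ * y)) x'
        + resid h (fun y => Real.sin (ξ * y)) x * resid h (fun y => Real.sin (ξ * y)) x')
        * ξ ^ (-specExp s H) :=
  res_res_trueKernel s hH0 hH1 hx (cell_nonneg hh hx) (by linarith [cell_nonneg hh hx])
    hx' (cell_nonneg hh hx') (by linarith [cell_nonneg hh hx']) (cell_eq hh x) (cell_eq hh x')

theorem measurable_resid (h : ℝ) {g : ℝ → ℝ → ℝ} (hg : Measurable (Function.uncurry g)) :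
    Measurable (Function.uncurry fun ξ x => resid h (g ξ) x) := by
  have hfl : Measurable fun q : ℝ × ℝ => (⌊q.2 / h⌋ : ℝ) :=
    (measurable_from_top (f := fun n : ℤ => (n : ℝ))).comp (measurable_snd.div_const h).floor
  have hfr : Measurable fun q : ℝ × ℝ => Int.fract (q.2 / h) := (measurable_snd.div_const h).fract
  have h1 : Measurable fun q : ℝ × ℝ => g q.1 (h * ⌊q.2 / h⌋) :=
    hg.comp (measurable_fst.prodMk (hfl.const_mul h))
  have h2 : Measurable fun q : ℝ × ℝ => g q.1 (h * ⌊q.2 / h⌋ + h) :=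
    hg.comp (measurable_fst.prodMk ((hfl.const_mul h).add_const h))
  exact hg.sub (((measurable_const.sub hfr).mul h1).add (hfr.mul h2))

/-! ### Pointwise bounds on interpolation errors -/

theorem res_nonneg_of_concaveOn {x a b l : ℝ} (hl0 : 0 ≤ l) (hl1 : l ≤ 1)
    (hx : x = (1 - l) * a + l * b) {S : Set ℝ} {g : ℝ → ℝ} (hg : ConcaveOn ℝ S g) (ha : a ∈ S)
    (hb : b ∈ S) : 0 ≤ res x a b l g := by
  have := hg.2 ha hb (by linarith : 0 ≤ 1 - l) hl0 (by ring)
  simp only [smul_eq_mul] at this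
  rw [res, hx]; linarith

/-- If `g'' ≤ -m` on the cell then the interpolation error is at least `m (x - a) (b - x) / 2`. -/
theorem res_ge_of_deriv2_le {x a b l : ℝ} (hl0 : 0 ≤ l) (hl1 : l ≤ 1) (hab : a ≤ b)
    (hx : x = (1 - l) * a + l * b) {g g' g'' : ℝ → ℝ} {m : ℝ}
    (h1 : ∀ y ∈ Icc a b, HasDerivAt g (g' y) y) (h2 : ∀ y ∈ Icc a b, HasDerivAt g' (g'' y) y)
    (hm : ∀ y ∈ Icc a b, g'' y ≤ -m) :
    m / 2 * (l * (1 - l) * (b - a) ^ 2) ≤ res x a b l g := by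
  -- The interpolation error of y² is exactly -l(1 - l)(b - a)², so concavity of the corrected
  -- function is the claim.
  have hc : ConcaveOn ℝ (Icc a b) fun y => g y + m / 2 * y ^ 2 := by
    have d1 : ∀ y ∈ Icc a b, HasDerivAt (fun y => g y + m / 2 * y ^ 2) (g' y + m * y) y :=
      fun y hy => by
        refine ((h1 y hy).add ((hasDerivAt_pow 2 y).const_mul (m / 2))).congr_deriv ?_
        push_cast; ring
    refine concaveOn_of_hasDerivWithinAt2_nonpos (convex_Icc a b)
      (f' := fun y => g' y + m * y) (f'' := fun y => g'' y + m)
      (fun y hy => (d1 y hy).continuousAt.continuousWithinAt)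
      (fun y hy => (d1 y (interior_subset hy)).hasDerivWithinAt) (fun y hy => ?_) (fun y hy => ?_)
    · refine (((h2 y (interior_subset hy)).add
        ((hasDerivAt_id' y).const_mul m)).congr_deriv ?_).hasDerivWithinAt
      ring
    · linarith [hm y (interior_subset hy)]
  have := res_nonneg_of_concaveOn hl0 hl1 hx hc (left_mem_Icc.2 hab) (right_mem_Icc.2 hab)
  simp only [res] at this ⊢
  rw [hx] at this ⊢
  nlinarith [this]

theorem abs_res_le_of_deriv2 {x a b l : ℝ} (hl0 : 0 ≤ l) (hl1 : l ≤ 1) (hab : a ≤ b)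
    (hx : x = (1 - l) * a + l * b) {g g' g'' : ℝ → ℝ} {M : ℝ}
    (h1 : ∀ y ∈ Icc a b, HasDerivAt g (g' y) y) (h2 : ∀ y ∈ Icc a b, HasDerivAt g' (g'' y) y)
    (hM : ∀ y ∈ Icc a b, |g'' y| ≤ M) : |res x a b l g| ≤ M * (b - a) ^ 2 := by
  have hM0 : 0 ≤ M := (abs_nonneg _).trans (hM a (left_mem_Icc.2 hab))
  have i1 := res_ge_of_deriv2_le hl0 hl1 hab hx (m := -M) h1 h2
    (fun y hy => by linarith [(abs_le.1 (hM y hy)).2])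
  have i2 := res_ge_of_deriv2_le hl0 hl1 hab hx (g := fun y => -g y) (m := -M)
    (fun y hy => (h1 y hy).neg) (fun y hy => (h2 y hy).neg)
    (fun y hy => by linarith [(abs_le.1 (hM y hy)).1])
  have e : res x a b l (fun y => -g y) = -res x a b l g := by simp only [res]; ring
  rw [e] at i2
  have hb : M / 2 * (l * (1 - l) * (b - a) ^ 2) ≤ M * (b - a) ^ 2 := by
    have : l * (1 - l) ≤ 1 := by nlinarith
    have h3 : 0 ≤ M * (b - a) ^ 2 := by positivity
    nlinarith
  rw [abs_le]; constructor <;> linarith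

theorem abs_res_le {x a b l B : ℝ} (hl0 : 0 ≤ l) (hl1 : l ≤ 1) {g : ℝ → ℝ} (hx : |g x| ≤ B)
    (ha : |g a| ≤ B) (hb : |g b| ≤ B) : |res x a b l g| ≤ 2 * B := by
  rw [abs_le] at *
  rw [res]
  constructor <;> nlinarith

theorem hasDerivAt_cos_mul (ξ y : ℝ) :
    HasDerivAt (fun y => Real.cos (ξ * y)) (-ξ * Real.sin (ξ * y)) y := by
  convert ((hasDerivAt_id' y).const_mul ξ).cos using 1; ring

theorem hasDerivAt_sin_mul (ξ y : ℝ) :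
    HasDerivAt (fun y => Real.sin (ξ * y)) (ξ * Real.cos (ξ * y)) y := by
  convert ((hasDerivAt_id' y).const_mul ξ).sin using 1; ring

theorem abs_resid_trig_le {h : ℝ} (hh : 0 < h) (ξ x : ℝ) :
    |resid h (fun y => Real.cos (ξ * y)) x| ≤ ξ ^ 2 * h ^ 2 ∧
      |resid h (fun y => Real.sin (ξ * y)) x| ≤ ξ ^ 2 * h ^ 2 ∧
      |resid h (fun y => Real.cos (ξ * y)) x| ≤ 2 ∧
      |resid h (fun y => Real.sin (ξ * y)) x| ≤ 2 := by
  have f0 := Int.fract_nonneg (x / h)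
  have f1 := (Int.fract_lt_one (x / h)).le
  have hab : h * (⌊x / h⌋ : ℝ) ≤ h * (⌊x / h⌋ : ℝ) + h := by linarith
  refine ⟨?_, ?_, ?_, ?_⟩
  · have := abs_res_le_of_deriv2 f0 f1 hab (cell_eq hh x) (M := ξ ^ 2)
      (fun y _ => hasDerivAt_cos_mul ξ y) (fun y _ => (hasDerivAt_sin_mul ξ y).const_mul (-ξ))
      (fun y _ => by
        rw [← mul_assoc, abs_mul, neg_mul, abs_neg, ← sq, abs_of_nonneg (sq_nonneg ξ)]
        exact mul_le_of_le_one_right (sq_nonneg ξ) (Real.abs_cos_le_one _))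
    simpa [resid] using this
  · have := abs_res_le_of_deriv2 f0 f1 hab (cell_eq hh x) (M := ξ ^ 2)
      (fun y _ => hasDerivAt_sin_mul ξ y) (fun y _ => (hasDerivAt_cos_mul ξ y).const_mul ξ)
      (fun y _ => by
        rw [← mul_assoc, abs_mul, mul_neg, abs_neg, ← sq, abs_of_nonneg (sq_nonneg ξ)]
        exact mul_le_of_le_one_right (sq_nonneg ξ) (Real.abs_sin_le_one _))
    simpa [resid] using this
  · simpa [resid] using abs_res_le f0 f1 (g := fun y => Real.cos (ξ * y)) (B := 1)
      (Real.abs_cos_le_one _) (Real.abs_cos_le_one _) (Real.abs_cos_le_one _)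
  · simpa [resid] using abs_res_le f0 f1 (g := fun y => Real.sin (ξ * y)) (B := 1)
      (Real.abs_sin_le_one _) (Real.abs_sin_le_one _) (Real.abs_sin_le_one _)

end BQCalibration

namespace BQCalibration
open Set Filter Topology

/-! ### The energy of the interpolation error functional -/

/-- Squared modulus at frequency `ξ` of the Fourier transform of the functional
`g ↦ ∫ resid h g dP`. -/
noncomputable def specDensity (P : Measure ℝ) (h ξ : ℝ) : ℝ :=
  (∫ x, resid h (fun y => Real.cos (ξ * y)) x ∂P) ^ 2
    + (∫ x, resid h (fun y => Real.sin (ξ * y)) x ∂P) ^ 2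

noncomputable def energy (P : Measure ℝ) (h α : ℝ) : ℝ :=
  ∫ ξ in Ioi 0, specDensity P h ξ * ξ ^ (-α)

theorem specDensity_nonneg (P : Measure ℝ) (h ξ : ℝ) : 0 ≤ specDensity P h ξ := by
  unfold specDensity; positivity

theorem measurable_resid_cos (h : ℝ) :
    Measurable (Function.uncurry fun ξ x => resid h (fun y => Real.cos (ξ * y)) x) :=
  measurable_resid h (by simp only [Function.uncurry_def]; fun_prop)

theorem measurable_resid_sin (h : ℝ) :
    Measurable (Function.uncurry fun ξ x => resid h (fun y => Real.sin (ξ * y)) x) :=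
  measurable_resid h (by simp only [Function.uncurry_def]; fun_prop)

/-- The transformed residuals are O(min(1, ξ²)). Squared, they allow exponents up to 5 at zero
frequency and need more than 1 at infinity. -/
theorem energy_swap (P : Measure ℝ) [IsFiniteMeasure P] {h α : ℝ} (hh : 0 < h) (h1 : 1 < α)
    (h5 : α < 5) :
    IntegrableOn (fun ξ => specDensity P h ξ * ξ ^ (-α)) (Ioi 0) ∧
      ∫ x, ∫ x', (∫ ξ in Ioi 0,
        (resid h (fun y => Real.cos (ξ * y)) x * resid h (fun y => Real.cos (ξ * y)) x'
        + resid h (fun y => Real.sin (ξ * y)) x * resid h (fun y => Real.sin (ξ * y)) x')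
        * ξ ^ (-α)) ∂P ∂P = energy P h α := by
  have hb : ∀ᵐ z ∂P, ∀ ξ, 0 < ξ →
      |resid h (fun y => Real.cos (ξ * y)) z| ≤ (2 + h ^ 2) * min 1 (ξ ^ 2) ∧
        |resid h (fun y => Real.sin (ξ * y)) z| ≤ (2 + h ^ 2) * min 1 (ξ ^ 2) := by
    refine ae_of_all _ fun z ξ hξ => ?_
    obtain ⟨a1, a2, a3, a4⟩ := abs_resid_trig_le hh ξ z
    rcases le_total ξ 1 with h | h
    · rw [min_eq_right (pow_le_one₀ hξ.le h)]
      constructor <;> nlinarith [sq_nonneg ξ]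
    · rw [min_eq_left (one_le_pow₀ h)]
      constructor <;> nlinarith
  obtain ⟨i, e⟩ := integral_bilinear_swap (ρ := P) (ρ' := P) (measurable_resid_cos h)
    (measurable_resid_sin h) (measurable_rpow_neg α)
    (integrableOn_bound_sq 2 (2 + h ^ 2) h1 (by push_cast; linarith)) hb hb
  simp only [← sq] at i e
  exact ⟨i, e⟩

theorem specExp_mem (s : Fin 2) {H : ℝ} (hH0 : 0 < H) (hH1 : H < 1) :
    1 < specExp s H ∧ specExp s H < 5 := by
  unfold specExp
  have : ((s : ℕ) : ℝ) ≤ 1 := by exact_mod_cast Nat.lt_succ_iff.1 s.2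
  have : (0 : ℝ) ≤ ((s : ℕ) : ℝ) := Nat.cast_nonneg _
  constructor <;> linarith

theorem integral_resid2_trueKernel (P : Measure ℝ) [IsFiniteMeasure P] (s : Fin 2) {H h : ℝ}
    (hH0 : 0 < H) (hH1 : H < 1) (hh : 0 < h) (hP : ∀ᵐ x ∂P, 0 ≤ x) :
    ∫ x, ∫ x', resid2 h (trueKernel s H) x x' ∂P ∂P = specConst H * energy P h (specExp s H) := by
  obtain ⟨h1, h5⟩ := specExp_mem s hH0 hH1
  rw [← (energy_swap P hh h1 h5).2, ← integral_const_mul]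
  refine integral_congr_ae ?_
  filter_upwards [hP] with x hx
  rw [← integral_const_mul]
  refine integral_congr_ae ?_
  filter_upwards [hP] with x' hx'
  exact resid2_trueKernel s hH0 hH1 hh hx hx'

/-! ### Upper bounds on the energy -/

theorem integral_le_mul_integral {P : Measure ℝ} {C : ℝ} (hC : 0 ≤ C)
    (hPC : P ≤ ENNReal.ofReal C • volume) {g : ℝ → ℝ} (hg0 : ∀ x, 0 ≤ g x) (hg : Integrable g) :
    Integrable g P ∧ ∫ x, g x ∂P ≤ C * ∫ x, g x := by
  have hi : Integrable g (ENNReal.ofReal C • volume) := hg.smul_measure ENNReal.ofReal_ne_top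
  refine ⟨hi.mono_measure hPC, ?_⟩
  have := integral_mono_measure hPC (ae_of_all _ hg0) hi
  rwa [integral_smul_measure, ENNReal.toReal_ofReal hC, smul_eq_mul] at this

/-- Only the inner integral is compared with Lebesgue measure; the outer one uses just the total
mass 1. -/
theorem abs_integral_integral_le {P : Measure ℝ} [IsProbabilityMeasure P] {C B : ℝ} (hC : 0 ≤ C)
    (hPC : P ≤ ENNReal.ofReal C • volume) (hP : ∀ᵐ x ∂P, 0 ≤ x) {D g : ℝ → ℝ → ℝ}
    (hD : ∀ x x', 0 ≤ x → 0 ≤ x' → |D x x'| ≤ g x x') (hg0 : ∀ x x', 0 ≤ g x x')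
    (hg : ∀ x, Integrable (g x)) (hB : ∀ x, ∫ x', g x x' ≤ B) :
    |∫ x, ∫ x', D x x' ∂P ∂P| ≤ C * B := by
  rw [← Real.norm_eq_abs]
  refine (norm_integral_le_of_norm_le_const (C := C * B) ?_).trans (by simp)
  filter_upwards [hP] with x hx
  obtain ⟨i, e⟩ := integral_le_mul_integral hC hPC (hg0 x) (hg x)
  refine (norm_integral_le_of_norm_le i ?_).trans (e.trans ?_)
  · filter_upwards [hP] with x' hx' using hD x x' hx hx'
  · exact mul_le_mul_of_nonneg_left (hB x) hC

theorem cell_mem {h : ℝ} (hh : 0 < h) (x : ℝ) :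
    |x - h * (⌊x / h⌋ : ℝ)| ≤ h ∧ |x - (h * (⌊x / h⌋ : ℝ) + h)| ≤ h := by
  have h1 := cell_le hh x
  have h2 := lt_cell_add hh x
  constructor <;> rw [abs_le] <;> constructor <;> linarith

/-- Bounding the two-dimensional interpolation error through values of the kernel near
`(x, x')`. -/
theorem abs_resid2_le {h B : ℝ} (hh : 0 < h) {x x' : ℝ} {K : ℝ → ℝ → ℝ}
    (hK : ∀ y, |x - y| ≤ h → |resid h (K y) x'| ≤ B) : |resid2 h K x x'| ≤ 2 * B :=
  abs_res_le (g := fun y => resid h (K y) x') (Int.fract_nonneg _) (Int.fract_lt_one _).le (hK x (by simpa using hh.le))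
    (hK _ (cell_mem hh x).1) (hK _ (cell_mem hh x).2)

theorem abs_resid_le {h B : ℝ} (hh : 0 < h) {x : ℝ} {g : ℝ → ℝ}
    (hg : ∀ y, |x - y| ≤ h → |g y| ≤ B) : |resid h g x| ≤ 2 * B :=
  abs_res_le (Int.fract_nonneg _) (Int.fract_lt_one _).le (hg x (by simpa using hh.le))
    (hg _ (cell_mem hh x).1) (hg _ (cell_mem hh x).2)

/-! ### Error covariance of fractional Brownian motion with H < 1/2 -/

theorem resid2_fbmKernel (h H x x' : ℝ) :
    resid2 h (fbmKernel H) x x' = -(1 / 2) * resid2 h (fun y y' => |y - y'| ^ (2 * H)) x x' := by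
  simp only [resid2, resid, res, fbmKernel]; ring

theorem hasDerivAt_signed_rpow {σ y y' : ℝ} (r : ℝ) (h : 0 < σ * (y - y')) :
    HasDerivAt (fun z => (σ * (y - z)) ^ r) (-σ * r * (σ * (y - y')) ^ (r - 1)) y' := by
  have h1 : HasDerivAt (fun z => σ * (y - z)) (-σ) y' := by
    simpa using ((hasDerivAt_id' y').const_sub y).const_mul σ
  refine (h1.rpow_const (Or.inl h.ne')).congr_deriv ?_
  ring

/-- Here σ is the sign of x - x'. Away from the diagonal the power is smooth, so the residual in x'
is controlled by a second derivative; the residual in x costs only the factor 2. The separation |x -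
x'| - 2h is at least (|x - x'| + h)/4 exactly when |x - x'| ≥ 3h. -/
theorem abs_resid2_fbm_far {h H : ℝ} (hh : 0 < h) (hH0 : 0 < H) (hH1 : H < 1 / 2) {x x' σ : ℝ}
    (hσ : σ ^ 2 = 1) (hσx : σ * (x - x') = |x - x'|) (hfar : 3 * h < |x - x'|) :
    |resid2 h (fun y y' => |y - y'| ^ (2 * H)) x x'|
      ≤ 2 * (((|x - x'| + h) / 4) ^ (2 * H - 2) * h ^ 2) := by
  have hσ1 : |σ| = 1 := by
    rcases (mul_self_eq_one_iff (a := σ)).1 (by rwa [← sq]) with h | h <;> simp [h]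
  refine abs_resid2_le hh fun y hy => ?_
  have hδ : 0 < (|x - x'| + h) / 4 := by positivity
  have hd : ∀ y', |x' - y'| ≤ h → (|x - x'| + h) / 4 ≤ σ * (y - y') := fun y' hy' => by
    have e : σ * (y - y') = |x - x'| - σ * (x - y) + σ * (x' - y') := by rw [← hσx]; ring
    have b1 : |σ * (x - y)| ≤ h := by rwa [abs_mul, hσ1, one_mul]
    have b2 : |σ * (x' - y')| ≤ h := by rwa [abs_mul, hσ1, one_mul]
    rw [abs_le] at b1 b2
    rw [e]; linarith
  have hcell : ∀ y' ∈ Icc (h * (⌊x' / h⌋ : ℝ)) (h * (⌊x' / h⌋ : ℝ) + h), |x' - y'| ≤ h :=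
    fun y' hy' => by
      have h1 := cell_le hh x'
      have h2 := lt_cell_add hh x'
      rw [abs_le]; constructor <;> linarith [hy'.1, hy'.2]
  have eabs : ∀ y', |x' - y'| ≤ h → |y - y'| ^ (2 * H) = (σ * (y - y')) ^ (2 * H) := fun y' hy' => by
    congr 1
    have := hd y' hy'
    rw [← abs_of_pos (hδ.trans_le this), abs_mul, hσ1, one_mul]
  have e : resid h (fun y' => |y - y'| ^ (2 * H)) x' = resid h (fun y' => (σ * (y - y')) ^ (2 * H)) x' :=
    res_congr (eabs _ (by simpa using hh.le)) (eabs _ (cell_mem hh x').1) (eabs _ (cell_mem hh x').2)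
  rw [e]
  have key := abs_res_le_of_deriv2 (Int.fract_nonneg (x' / h)) (Int.fract_lt_one _).le
    (by linarith) (cell_eq hh x') (M := ((|x - x'| + h) / 4) ^ (2 * H - 2))
    (fun y' hy' => hasDerivAt_signed_rpow (2 * H) (hδ.trans_le (hd y' (hcell y' hy'))))
    (fun y' hy' => (hasDerivAt_signed_rpow (2 * H - 1)
      (hδ.trans_le (hd y' (hcell y' hy')))).const_mul (-σ * (2 * H)))
    (fun y' hy' => by
      have h1 := hd y' (hcell y' hy')
      have h2 : (σ * (y - y')) ^ (2 * H - 1 - 1) ≤ ((|x - x'| + h) / 4) ^ (2 * H - 2) := by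
        rw [show 2 * H - 1 - 1 = 2 * H - 2 by ring]
        exact Real.rpow_le_rpow_of_nonpos hδ h1 (by linarith)
      have h3 : 0 ≤ (σ * (y - y')) ^ (2 * H - 1 - 1) := Real.rpow_nonneg (hδ.le.trans h1) _
      rw [show -σ * (2 * H) * (-σ * (2 * H - 1) * (σ * (y - y')) ^ (2 * H - 1 - 1))
        = σ ^ 2 * (2 * H * (2 * H - 1)) * (σ * (y - y')) ^ (2 * H - 1 - 1) by ring, hσ, one_mul,
        abs_mul, abs_of_nonneg h3]
      refine (mul_le_of_le_one_left h3 ?_).trans h2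
      -- The coefficient 2H(2H - 1) lies in [-1, 1].
      rw [abs_le]; constructor <;> nlinarith)
  simpa [resid] using key

/-- Near the diagonal all arguments differ by at most 5h and h^(2H) is comparable with the right
side; far from it, smoothness takes over. The constant is 4 · 5 · 16 and is not sharp. -/
theorem abs_resid2_fbmKernel_le {h H : ℝ} (hh : 0 < h) (hH0 : 0 < H) (hH1 : H < 1 / 2) (x x' : ℝ) :
    |resid2 h (fbmKernel H) x x'| ≤ 320 * (h ^ 2 * (|x - x'| + h) ^ (2 * H - 2)) := by
  rw [resid2_fbmKernel, abs_mul, abs_neg, abs_of_pos (by norm_num : (0 : ℝ) < 1 / 2)]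
  have hs : 0 < |x - x'| + h := by positivity
  have hpos : 0 ≤ h ^ 2 * (|x - x'| + h) ^ (2 * H - 2) := by positivity
  rcases le_or_gt (|x - x'|) (3 * h) with hn | hf
  · have h1 : |resid2 h (fun y y' => |y - y'| ^ (2 * H)) x x'| ≤ 2 * (2 * (5 * h) ^ (2 * H)) := by
      refine abs_resid2_le hh fun y hy => abs_resid_le hh fun y' hy' => ?_
      rw [abs_of_nonneg (by positivity)]
      refine Real.rpow_le_rpow (abs_nonneg _) ?_ (by positivity)
      rw [abs_le] at *; constructor <;> linarith
    have h2 : (5 * h) ^ (2 * H) ≤ 5 * h ^ (2 * H) := by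
      rw [Real.mul_rpow (by norm_num) hh.le]
      gcongr
      calc (5 : ℝ) ^ (2 * H) ≤ 5 ^ (1 : ℝ) :=
            Real.rpow_le_rpow_of_exponent_le (by norm_num) (by linarith)
        _ = 5 := Real.rpow_one _
    have h3 : h ^ (2 * H) ≤ 16 * (h ^ 2 * (|x - x'| + h) ^ (2 * H - 2)) := by
      have a : (4 * h) ^ (2 * H - 2) ≤ (|x - x'| + h) ^ (2 * H - 2) :=
        Real.rpow_le_rpow_of_nonpos hs (by linarith) (by linarith)
      have b : (4 : ℝ) ^ (-2 : ℝ) ≤ 4 ^ (2 * H - 2) :=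
        Real.rpow_le_rpow_of_exponent_le (by norm_num) (by linarith)
      have b' : (4 : ℝ) ^ (-2 : ℝ) = 1 / 16 := by norm_num [Real.rpow_neg]
      rw [Real.mul_rpow (by norm_num) hh.le] at a
      have c : h ^ (2 * H) = h ^ 2 * h ^ (2 * H - 2) := by
        rw [← Real.rpow_natCast, ← Real.rpow_add hh]; congr 1; push_cast; ring
      have d : 0 < h ^ (2 * H - 2) := by positivity
      rw [c]
      have : h ^ (2 * H - 2) ≤ 16 * (|x - x'| + h) ^ (2 * H - 2) := by
        rw [b'] at b
        linarith [mul_le_mul_of_nonneg_right b d.le]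
      nlinarith [sq_nonneg h]
    linarith
  · have h1 : |resid2 h (fun y y' => |y - y'| ^ (2 * H)) x x'|
        ≤ 2 * (((|x - x'| + h) / 4) ^ (2 * H - 2) * h ^ 2) := by
      rcases abs_choice (x - x') with e | e
      · exact abs_resid2_fbm_far hh hH0 hH1 (σ := 1) (by norm_num) (by rw [one_mul, e]) hf
      · exact abs_resid2_fbm_far hh hH0 hH1 (σ := -1) (by norm_num) (by rw [e]; ring) hf
    have h2 : ((|x - x'| + h) / 4) ^ (2 * H - 2) ≤ 16 * (|x - x'| + h) ^ (2 * H - 2) := by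
      rw [div_eq_mul_inv, Real.mul_rpow hs.le (by norm_num), mul_comm]
      gcongr
      rw [Real.inv_rpow (by norm_num), ← Real.rpow_neg (by norm_num)]
      calc (4 : ℝ) ^ (-(2 * H - 2)) ≤ 4 ^ (2 : ℝ) :=
            Real.rpow_le_rpow_of_exponent_le (by norm_num) (by linarith)
        _ = 16 := by norm_num
    nlinarith [sq_nonneg h]

theorem integral_shifted_rpow {h : ℝ} (hh : 0 < h) {r : ℝ} (hr : r < -1) (x : ℝ) :
    Integrable (fun x' : ℝ => (|x - x'| + h) ^ r) ∧
      ∫ x', (|x - x'| + h) ^ r = h ^ (r + 1) * ∫ u : ℝ, (1 + |u|) ^ r := by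
  have i0 : Integrable fun u : ℝ => (1 + |u|) ^ r := by
    have := integrable_one_add_norm (E := ℝ) (μ := volume) (r := -r) (by simp; linarith)
    simpa using this
  have e : ∀ u : ℝ, (|u| + h) ^ r = h ^ r * (1 + |u / h|) ^ r := fun u => by
    rw [← Real.mul_rpow hh.le (by positivity), abs_div, abs_of_pos hh]
    congr 1; field_simp; ring
  have i1 : Integrable fun u : ℝ => (|u| + h) ^ r := by
    simp only [e]; exact (i0.comp_div hh.ne').const_mul _
  refine ⟨i1.comp_sub_left x, ?_⟩
  rw [integral_sub_left_eq_self (fun u : ℝ => (|u| + h) ^ r) volume x]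
  simp only [e]
  rw [integral_const_mul, Measure.integral_comp_div (fun u : ℝ => (1 + |u|) ^ r) h, abs_of_pos hh,
    smul_eq_mul, ← mul_assoc, Real.rpow_add_one hh.ne']

/-- For H = (α - 1)/2 < 1/2 the exponent 2H - 2 is below -1, so integrating the covariance bound in
x' gives h² · h^(2H-1) = h^α. -/
theorem energy_le_of_lt_two {P : Measure ℝ} [IsProbabilityMeasure P] {C : ℝ} (hC : 0 ≤ C)
    (hPC : P ≤ ENNReal.ofReal C • volume) (hP : ∀ᵐ x ∂P, 0 ≤ x) {α : ℝ} (h1 : 1 < α) (h2 : α < 2) :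
    ∃ K : ℝ, ∀ h, 0 < h → energy P h α ≤ K * h ^ α := by
  set H := (α - 1) / 2 with hH
  have hH0 : 0 < H := by rw [hH]; linarith
  have hH1 : H < 1 / 2 := by rw [hH]; linarith
  have hα : specExp 0 H = α := by rw [specExp, hH]; simp; ring
  have hc := specConst_pos hH0 (by linarith : H < 1)
  set M := ∫ u : ℝ, (1 + |u|) ^ (2 * H - 2)
  refine ⟨C * (320 * M) / specConst H, fun h hh => ?_⟩
  have i := fun x => integral_shifted_rpow hh (r := 2 * H - 2) (by linarith) x
  have key := abs_integral_integral_le hC hPC hP (D := resid2 h (fbmKernel H))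
    (g := fun x x' => 320 * (h ^ 2 * (|x - x'| + h) ^ (2 * H - 2))) (B := 320 * M * h ^ α)
    (fun x x' _ _ => abs_resid2_fbmKernel_le hh hH0 hH1 x x') (fun x x' => by positivity)
    (fun x => ((i x).1.const_mul _).const_mul _) (fun x => by
      rw [integral_const_mul, integral_const_mul, (i x).2]
      have : h ^ α = h ^ 2 * h ^ (2 * H - 2 + 1) := by
        rw [← Real.rpow_natCast, ← Real.rpow_add hh]; congr 1; rw [hH]; push_cast; ring
      rw [this]; apply le_of_eq; ring)
  have e := integral_resid2_trueKernel P 0 hH0 (by linarith : H < 1) hh hP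
  rw [hα] at e
  have e' := (le_abs_self _).trans key
  have e2 : ∫ x, ∫ x', resid2 h (fbmKernel H) x x' ∂P ∂P = specConst H * energy P h α := e
  rw [e2] at e'
  rw [div_mul_eq_mul_div, le_div_iff₀ hc]
  linarith

/-! ### Locality of the error covariance for integrated Brownian motion, exponent 4 -/

theorem hasDerivAt_mul_abs {t : ℝ} (ht : t ≠ 0) : HasDerivAt (fun t : ℝ => t * |t| / 2) |t| t := by
  refine (((hasDerivAt_id' t).mul (hasDerivAt_abs ht)).div_const 2).congr_deriv ?_
  rcases ht.lt_or_gt with h | h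
  · rw [sign_neg h, abs_of_neg h]; simp
  · rw [sign_pos h, abs_of_pos h]; simp

theorem hasDerivAt_abs_cube {t : ℝ} (ht : t ≠ 0) :
    HasDerivAt (fun t : ℝ => |t| ^ 3 / 3) (t * |t|) t := by
  refine (((hasDerivAt_abs ht).pow 3).div_const 3).congr_deriv ?_
  rcases ht.lt_or_gt with h | h
  · rw [sign_neg h, abs_of_neg h]; simp; ring
  · rw [sign_pos h, abs_of_pos h]; simp; ring

theorem integral_abs_line (a b : ℝ) : ∫ t in a..b, |t| = b * |b| / 2 - a * |a| / 2 :=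
  integral_eq_of_hasDerivAt_off_countable (fun t : ℝ => t * |t| / 2) _ (countable_singleton 0)
    (by fun_prop) (fun t ht => hasDerivAt_mul_abs (by simpa using ht.2))
    (by apply Continuous.intervalIntegrable; fun_prop)

theorem integral_mul_abs_line (a b : ℝ) : ∫ t in a..b, t * |t| = |b| ^ 3 / 3 - |a| ^ 3 / 3 :=
  integral_eq_of_hasDerivAt_off_countable (fun t : ℝ => |t| ^ 3 / 3) _ (countable_singleton 0)
    (by fun_prop) (fun t ht => hasDerivAt_abs_cube (by simpa using ht.2))
    (by apply Continuous.intervalIntegrable; fun_prop)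

theorem ifbmKernel_half {x x' : ℝ} (hx : 0 ≤ x) (hx' : 0 ≤ x') :
    ifbmKernel (1 / 2) x x'
      = |x - x'| ^ 3 / 12 + (x ^ 2 * x' + x * x' ^ 2) / 4 - (x ^ 3 + x' ^ 3) / 12 := by
  have inner : ∀ z, 0 ≤ z → ∫ z' in (0 : ℝ)..x', fbmKernel (1 / 2) z z'
      = (z * x' + x' ^ 2 / 2 - (z ^ 2 / 2 - (z - x') * |z - x'| / 2)) / 2 := by
    intro z hz
    have e : ∀ z' ∈ uIcc 0 x', fbmKernel (1 / 2) z z' = (z + z' - |z - z'|) / 2 := by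
      intro z' hz'
      rw [uIcc_of_le hx'] at hz'
      simp [fbmKernel, abs_of_nonneg hz, abs_of_nonneg hz'.1]
    rw [intervalIntegral.integral_congr e, intervalIntegral.integral_div,
      intervalIntegral.integral_sub (by apply Continuous.intervalIntegrable; fun_prop)
        (by apply Continuous.intervalIntegrable; fun_prop),
      intervalIntegral.integral_comp_sub_left (fun t => |t|) z, integral_abs_line,
      intervalIntegral.integral_add (by simp) (by simp)]
    simp [abs_of_nonneg hz]
    ring
  have e : ∀ z ∈ uIcc 0 x, ∫ z' in (0 : ℝ)..x', fbmKernel (1 / 2) z z'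
      = z * (x' / 2) + (x' ^ 2 / 4) - z ^ 2 * (1 / 4) + ((z - x') * |z - x'|) * (1 / 4) := by
    intro z hz
    rw [uIcc_of_le hx] at hz
    rw [inner z hz.1]; ring
  rw [ifbmKernel, intervalIntegral.integral_congr e,
    intervalIntegral.integral_add (by apply Continuous.intervalIntegrable; fun_prop)
      (by apply Continuous.intervalIntegrable; fun_prop),
    intervalIntegral.integral_sub (by apply Continuous.intervalIntegrable; fun_prop)
      (by apply Continuous.intervalIntegrable; fun_prop),
    intervalIntegral.integral_add (by apply Continuous.intervalIntegrable; fun_prop)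
      (by apply Continuous.intervalIntegrable; fun_prop),
    intervalIntegral.integral_mul_const, intervalIntegral.integral_mul_const,
    intervalIntegral.integral_mul_const,
    intervalIntegral.integral_comp_sub_right (fun t => t * |t|) x', integral_mul_abs_line]
  simp [abs_of_nonneg hx']
  ring

/-- Every monomial in `ifbmKernel_half` besides the cube |x - x'|³ is affine in one of the two
variables, hence invisible to the double residual. -/
theorem resid2_ifbmKernel_half {h : ℝ} (hh : 0 < h) {x x' : ℝ} (hx : 0 ≤ x) (hx' : 0 ≤ x') :
    resid2 h (ifbmKernel (1 / 2)) x x' = resid2 h (fun y y' => |y - y'| ^ 3 / 12) x x' := by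
  have a := cell_nonneg hh hx
  have a' := cell_nonneg hh hx'
  have e := cell_eq hh x
  have e' := cell_eq hh x'
  simp only [resid2, resid, res]
  generalize h * (⌊x / h⌋ : ℝ) = u at *
  generalize h * (⌊x' / h⌋ : ℝ) = u' at *
  generalize Int.fract (x / h) = l at *
  generalize Int.fract (x' / h) = l' at *
  simp only [ifbmKernel_half, hx, hx', a, a', add_nonneg a hh.le, add_nonneg a' hh.le]
  generalize |x - x'| = t1, |x - u'| = t2, |x - (u' + h)| = t3, |u - x'| = t4, |u - u'| = t5,
    |u - (u' + h)| = t6, |u + h - x'| = t7, |u + h - u'| = t8, |u + h - (u' + h)| = t9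
  subst e e'
  ring

/-- Points at distance at least h lie in different cells. There |y - y'|³ is ±(y - y')³, a sum of
monomials each affine in y or in y'. -/
theorem resid2_cube_eq_zero {h : ℝ} (hh : 0 < h) {x x' : ℝ} (hf : h ≤ |x - x'|) :
    resid2 h (fun y y' => |y - y'| ^ 3 / 12) x x' = 0 := by
  have e := cell_eq hh x
  have e' := cell_eq hh x'
  have l1 := cell_le hh x
  have l2 := lt_cell_add hh x
  have l1' := cell_le hh x'
  have l2' := lt_cell_add hh x'
  have hne : ⌊x / h⌋ ≠ ⌊x' / h⌋ := fun he => by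
    rw [he] at l1 l2
    exact absurd hf (not_le.2 (abs_lt.2 ⟨by linarith, by linarith⟩))
  simp only [resid2, resid, res]
  rcases lt_or_gt_of_ne hne with hlt | hlt
  · have h1 : (⌊x / h⌋ : ℝ) + 1 ≤ ⌊x' / h⌋ := by exact_mod_cast hlt
    have h2 : h * (⌊x / h⌋ : ℝ) + h ≤ h * ⌊x' / h⌋ := by nlinarith
    generalize h * (⌊x / h⌋ : ℝ) = u at *
    generalize h * (⌊x' / h⌋ : ℝ) = u' at *
    generalize Int.fract (x / h) = l at *
    generalize Int.fract (x' / h) = l' at *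
    repeat rw [abs_of_nonpos (by linarith)]
    rw [e, e']; ring
  · have h1 : (⌊x' / h⌋ : ℝ) + 1 ≤ ⌊x / h⌋ := by exact_mod_cast hlt
    have h2 : h * (⌊x' / h⌋ : ℝ) + h ≤ h * ⌊x / h⌋ := by nlinarith
    generalize h * (⌊x / h⌋ : ℝ) = u at *
    generalize h * (⌊x' / h⌋ : ℝ) = u' at *
    generalize Int.fract (x / h) = l at *
    generalize Int.fract (x' / h) = l' at *
    repeat rw [abs_of_nonneg (by linarith)]
    rw [e, e']; ring

/-- The covariance lives on the band |x - x'| < h and is at most 9h³ there, with 9 = 2 · 2 · 27/12.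
Integrating over length 2h gives 18h⁴. -/
theorem energy_four_le {P : Measure ℝ} [IsProbabilityMeasure P] {C : ℝ} (hC : 0 ≤ C)
    (hPC : P ≤ ENNReal.ofReal C • volume) (hP : ∀ᵐ x ∂P, 0 ≤ x) :
    ∃ K : ℝ, ∀ h, 0 < h → energy P h 4 ≤ K * h ^ 4 := by
  have hc := specConst_pos (H := 1 / 2) (by norm_num) (by norm_num)
  refine ⟨C * 18 / specConst (1 / 2), fun h hh => ?_⟩
  have key := abs_integral_integral_le hC hPC hP (D := resid2 h (ifbmKernel (1 / 2)))
    (g := fun x => (Metric.ball x h).indicator fun _ => 9 * h ^ 3) (B := 18 * h ^ 4)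
    (fun x x' hx hx' => by
      rw [resid2_ifbmKernel_half hh hx hx']
      by_cases hn : x' ∈ Metric.ball x h
      · rw [indicator_of_mem hn]
        rw [Metric.mem_ball, Real.dist_eq, abs_lt] at hn
        have : |resid2 h (fun y y' => |y - y'| ^ 3 / 12) x x'| ≤ 2 * (2 * ((3 * h) ^ 3 / 12)) := by
          refine abs_resid2_le hh fun y hy => abs_resid_le hh fun y' hy' => ?_
          rw [abs_of_nonneg (by positivity)]
          gcongr
          rw [abs_le] at *; constructor <;> linarith
        refine this.trans (le_of_eq (by ring))
      · rw [indicator_of_notMem hn]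
        rw [Metric.mem_ball, Real.dist_eq, not_lt, abs_sub_comm] at hn
        rw [resid2_cube_eq_zero hh hn, abs_zero])
    (fun x x' => indicator_nonneg (fun _ _ => by positivity) _)
    (fun x => (integrable_indicator_iff measurableSet_ball).2 (by
      rw [integrableOn_const_iff]; right; rw [Real.volume_ball]; exact ENNReal.ofReal_lt_top))
    (fun x => by
      rw [integral_indicator measurableSet_ball, setIntegral_const, measureReal_def, Real.volume_ball,
        ENNReal.toReal_ofReal (by linarith), smul_eq_mul]
      apply le_of_eq; ring)
  have e := integral_resid2_trueKernel P 1 (H := 1 / 2) (by norm_num) (by norm_num) hh hP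
  have hα : specExp 1 (1 / 2) = 4 := by norm_num [specExp]
  rw [hα] at e
  have e' := (le_abs_self _).trans key
  have e2 : ∫ x, ∫ x', resid2 h (ifbmKernel (1 / 2)) x x' ∂P ∂P
    = specConst (1 / 2) * energy P h 4 := e
  rw [e2] at e'
  rw [div_mul_eq_mul_div, le_div_iff₀ hc]
  linarith

end BQCalibration

/-! ### Upper bounds for the remaining exponents -/

namespace BQCalibration
open Set Filter Topology

/-- Interpolation between exponents 3/2 and 4: one of (hξ)^(α-3/2) and (hξ)^(α-4) is at least 1,
according to whether hξ ≥ 1. Any exponent in (1, 2) could replace 3/2. -/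
theorem energy_le_of_le_four {P : Measure ℝ} [IsProbabilityMeasure P] {C : ℝ} (hC : 0 ≤ C)
    (hPC : P ≤ ENNReal.ofReal C • volume) (hP : ∀ᵐ x ∂P, 0 ≤ x) {α : ℝ} (h1 : 1 < α) (h4 : α ≤ 4) :
    ∃ K : ℝ, ∀ h, 0 < h → energy P h α ≤ K * h ^ α := by
  rcases lt_or_ge α 2 with h2 | h2
  · exact energy_le_of_lt_two hC hPC hP h1 h2
  obtain ⟨K1, hK1⟩ := energy_le_of_lt_two hC hPC hP (α := 3 / 2) (by norm_num) (by norm_num)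
  obtain ⟨K2, hK2⟩ := energy_four_le hC hPC hP
  refine ⟨K1 + K2, fun h hh => ?_⟩
  have i1 := (energy_swap P hh (α := 3 / 2) (by norm_num) (by norm_num)).1
  have i2 := (energy_swap P hh (α := 4) (by norm_num) (by norm_num)).1
  have iα := (energy_swap P hh (α := α) h1 (by linarith)).1
  have key : energy P h α ≤ h ^ (α - 3 / 2) * energy P h (3 / 2) + h ^ (α - 4) * energy P h 4 := by
    rw [energy, energy, energy, ← integral_const_mul, ← integral_const_mul,
      ← integral_add (i1.const_mul _) (i2.const_mul _)]
    refine setIntegral_mono_on iα ((i1.const_mul _).add (i2.const_mul _)) measurableSet_Ioi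
      fun ξ (hξ : 0 < ξ) => ?_
    have hF := specDensity_nonneg P h ξ
    have hpt : ξ ^ (-α) ≤ h ^ (α - 3 / 2) * ξ ^ (-(3 / 2 : ℝ)) + h ^ (α - 4) * ξ ^ (-4 : ℝ) := by
      have e : ∀ b : ℝ, h ^ (α - b) * ξ ^ (-b) = (h * ξ) ^ (α - b) * ξ ^ (-α) := fun b => by
        rw [Real.mul_rpow hh.le hξ.le, mul_assoc, ← Real.rpow_add hξ]; congr 2; ring
      have hp : 0 < ξ ^ (-α) := Real.rpow_pos_of_pos hξ _
      have hhξ : 0 < h * ξ := mul_pos hh hξ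
      rw [e, e, ← add_mul]
      refine le_mul_of_one_le_left hp.le ?_
      rcases le_total 1 (h * ξ) with h' | h'
      · have := Real.one_le_rpow h' (by linarith : 0 ≤ α - 3 / 2)
        have := Real.rpow_nonneg hhξ.le (α - 4)
        linarith
      · have := Real.one_le_rpow_of_pos_of_le_one_of_nonpos hhξ h' (by linarith : α - 4 ≤ 0)
        have := Real.rpow_nonneg hhξ.le (α - 3 / 2)
        linarith
    calc specDensity P h ξ * ξ ^ (-α) ≤ specDensity P h ξ *
          (h ^ (α - 3 / 2) * ξ ^ (-(3 / 2 : ℝ)) + h ^ (α - 4) * ξ ^ (-4 : ℝ)) := by gcongr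
      _ = _ := by ring
  have b1 : h ^ (α - 3 / 2) * energy P h (3 / 2) ≤ K1 * h ^ α := by
    calc _ ≤ h ^ (α - 3 / 2) * (K1 * h ^ (3 / 2 : ℝ)) := by gcongr; exact hK1 h hh
      _ = K1 * (h ^ (α - 3 / 2) * h ^ (3 / 2 : ℝ)) := by ring
      _ = _ := by rw [← Real.rpow_add hh]; congr 2; ring
  have b2 : h ^ (α - 4) * energy P h 4 ≤ K2 * h ^ α := by
    calc _ ≤ h ^ (α - 4) * (K2 * h ^ 4) := by gcongr; exact hK2 h hh
      _ = K2 * (h ^ (α - 4) * h ^ (4 : ℝ)) := by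
          rw [show h ^ (4 : ℝ) = h ^ 4 by norm_cast]; ring
      _ = _ := by rw [← Real.rpow_add hh]; congr 2; ring
  linarith

theorem abs_integral_resid_trig_le {P : Measure ℝ} [IsProbabilityMeasure P] {h : ℝ} (hh : 0 < h)
    (ξ : ℝ) : specDensity P h ξ ≤ 2 * (ξ ^ 2 * h ^ 2) ^ 2 := by
  have b1 : |∫ x, resid h (fun y => Real.cos (ξ * y)) x ∂P| ≤ ξ ^ 2 * h ^ 2 := by
    rw [← Real.norm_eq_abs]
    refine (norm_integral_le_of_norm_le_const (C := ξ ^ 2 * h ^ 2)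
      (ae_of_all _ fun x => (abs_resid_trig_le hh ξ x).1)).trans (by simp)
  have b2 : |∫ x, resid h (fun y => Real.sin (ξ * y)) x ∂P| ≤ ξ ^ 2 * h ^ 2 := by
    rw [← Real.norm_eq_abs]
    refine (norm_integral_le_of_norm_le_const (C := ξ ^ 2 * h ^ 2)
      (ae_of_all _ fun x => (abs_resid_trig_le hh ξ x).2.1)).trans (by simp)
  have := sq_le_sq' (abs_le.1 b1).1 (abs_le.1 b1).2
  have := sq_le_sq' (abs_le.1 b2).1 (abs_le.1 b2).2
  unfold specDensity
  linarith

/-- Saturation at h⁴. Frequencies above 1 are covered by exponent 4; below 1 the density is at most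
2ξ⁴h⁴, and ξ^(4-α) is integrable at 0 because α < 5. -/
theorem energy_le_of_four_le {P : Measure ℝ} [IsProbabilityMeasure P] {C : ℝ} (hC : 0 ≤ C)
    (hPC : P ≤ ENNReal.ofReal C • volume) (hP : ∀ᵐ x ∂P, 0 ≤ x) {α : ℝ} (h4 : 4 ≤ α) (h5 : α < 5) :
    ∃ K : ℝ, ∀ h, 0 < h → energy P h α ≤ K * h ^ 4 := by
  obtain ⟨K2, hK2⟩ := energy_four_le hC hPC hP
  refine ⟨K2 + 2 * ∫ ξ in Ioi (0 : ℝ), min 1 (ξ ^ 4) * ξ ^ (-α), fun h hh => ?_⟩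
  have i2 := (energy_swap P hh (α := 4) (by norm_num) (by norm_num)).1
  have iα := (energy_swap P hh (α := α) (by linarith) h5).1
  have im := integrableOn_min_pow_mul_rpow 4 (α := α) (by linarith) (by push_cast; linarith)
  have key : energy P h α ≤ energy P h 4
      + 2 * h ^ 4 * ∫ ξ in Ioi (0 : ℝ), min 1 (ξ ^ 4) * ξ ^ (-α) := by
    rw [energy, energy, ← integral_const_mul, ← integral_add i2 (im.const_mul _)]
    refine setIntegral_mono_on iα (i2.add (im.const_mul _)) measurableSet_Ioi
      fun ξ (hξ : 0 < ξ) => ?_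
    have hF := specDensity_nonneg P h ξ
    have hp : 0 < ξ ^ (-α) := Real.rpow_pos_of_pos hξ _
    have hp4 : 0 < ξ ^ (-4 : ℝ) := Real.rpow_pos_of_pos hξ _
    rcases le_total ξ 1 with h' | h'
    · rw [min_eq_right (pow_le_one₀ hξ.le h')]
      have b := mul_le_mul_of_nonneg_right (abs_integral_resid_trig_le (P := P) hh ξ) hp.le
      have c : 0 ≤ specDensity P h ξ * ξ ^ (-4 : ℝ) := by positivity
      calc _ ≤ _ := b
        _ = 2 * h ^ 4 * (ξ ^ 4 * ξ ^ (-α)) := by ring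
        _ ≤ _ := by linarith
    · have b : ξ ^ (-α) ≤ ξ ^ (-4 : ℝ) := Real.rpow_le_rpow_of_exponent_le h' (by linarith)
      have c : 0 ≤ 2 * h ^ 4 * (min 1 (ξ ^ 4) * ξ ^ (-α)) := by positivity
      have d := mul_le_mul_of_nonneg_left b hF
      linarith
  have := hK2 h hh
  linarith

/-! ### Lower bounds on the energy -/

theorem energy_ge_of_specDensity_ge (P : Measure ℝ) [IsFiniteMeasure P] {h α u v m : ℝ}
    (hh : 0 < h) (h1 : 1 < α) (h5 : α < 5) (hu : 0 < u) (huv : u ≤ v)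
    (hF : ∀ ξ ∈ Icc u v, m ≤ specDensity P h ξ) : m * v ^ (-α) * (v - u) ≤ energy P h α := by
  have i := (energy_swap P hh h1 h5).1
  have hsub : Icc u v ⊆ Ioi 0 := fun ξ hξ => hu.trans_le hξ.1
  calc m * v ^ (-α) * (v - u) = ∫ _ξ in Icc u v, m * v ^ (-α) := by
        rw [setIntegral_const, measureReal_def, Real.volume_Icc,
          ENNReal.toReal_ofReal (by linarith), smul_eq_mul, mul_comm]
    _ ≤ ∫ ξ in Icc u v, specDensity P h ξ * ξ ^ (-α) := by
        refine setIntegral_mono_on continuousOn_const.integrableOn_Icc (i.mono_set hsub) measurableSet_Icc fun ξ hξ => ?_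
        have hξ0 : 0 < ξ := hsub hξ
        have hle : v ^ (-α) ≤ ξ ^ (-α) :=
          Real.rpow_le_rpow_of_nonpos hξ0 hξ.2 (by linarith)
        have := Real.rpow_nonneg (hu.le.trans huv) (-α)
        exact mul_le_mul (hF ξ hξ) hle this (specDensity_nonneg _ _ _)
    _ ≤ energy P h α := by
        refine setIntegral_mono_set i ?_ hsub.eventuallyLE
        filter_upwards [ae_restrict_mem measurableSet_Ioi] with ξ (hξ : 0 < ξ)
        exact mul_nonneg (specDensity_nonneg _ _ _) (Real.rpow_nonneg hξ.le _)

/-- The Riemann–Lebesgue lemma applied to the density of `P`. -/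
theorem tendsto_integral_cos {P : Measure ℝ} [IsFiniteMeasure P] (hP : P ≪ volume) :
    Tendsto (fun ξ : ℝ => ∫ x, Real.cos (ξ * x) ∂P) atTop (𝓝 0) := by
  set f : ℝ → ℂ := fun x => ((P.rnDeriv volume x).toReal : ℂ)
  have h1 := Real.tendsto_integral_exp_smul_cocompact f
  have hf : Integrable f := Measure.integrable_toReal_rnDeriv.ofReal
  have h2 : Tendsto (fun ξ : ℝ => ξ / (2 * Real.pi)) atTop (cocompact ℝ) :=
    (tendsto_id.atTop_div_const (by positivity)).mono_right atTop_le_cocompact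
  have h3 := (Complex.continuous_re.tendsto 0).comp (h1.comp h2)
  rw [Complex.zero_re] at h3
  refine h3.congr fun ξ => ?_
  simp only [Function.comp]
  rw [← integral_rnDeriv_smul hP]
  have hi : Integrable fun v => Real.fourierChar (-(v * (ξ / (2 * Real.pi)))) • f v := by
    simpa [mul_comm] using (Real.fourierIntegral_convergent_iff (μ := volume) (f := f) (ξ / (2 * Real.pi))).2 hf
  have := (Complex.reCLM.integral_comp_comm hi).symm
  simp only [Complex.reCLM_apply] at this
  rw [this]
  refine integral_congr_ae (ae_of_all _ fun x => ?_)
  simp only [f]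
  rw [Circle.smul_def, Real.fourierChar_apply, smul_eq_mul, Complex.re_mul_ofReal, mul_comm,
    Complex.exp_ofReal_mul_I_re, smul_eq_mul]
  congr 1
  rw [← Real.cos_neg]
  congr 1
  field_simp

theorem integrable_resid_cos (P : Measure ℝ) [IsFiniteMeasure P] {h : ℝ} (hh : 0 < h) (ξ : ℝ) :
    Integrable (fun x => resid h (fun y => Real.cos (ξ * y)) x) P :=
  Integrable.of_bound ((measurable_resid_cos h).comp measurable_prodMk_left).aestronglyMeasurable 2
    (ae_of_all _ fun x => (abs_resid_trig_le hh ξ x).2.2.1)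

theorem cell_add_le {h T : ℝ} (hh : 0 < h) {N : ℕ} (hT : T = N * h) {x : ℝ} (hx : x < T) :
    h * (⌊x / h⌋ : ℝ) + h ≤ T := by
  have h1 : x / h < (N : ℤ) := by rw [div_lt_iff₀ hh]; push_cast; linarith
  have h2 : ⌊x / h⌋ + 1 ≤ (N : ℤ) := Int.floor_lt.2 h1
  have h3 : (⌊x / h⌋ : ℝ) + 1 ≤ N := by exact_mod_cast h2
  rw [hT]; nlinarith

/-- Aliasing. At frequency 2π/h + η with η ≤ 1/(2T) the nodes see only cos(ηy) ≥ 7/8, so the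
interpolant stays above 7/8, while the true cosine has integral below 1/2. The density is thus
bounded below on a window of fixed length at height of order 1/h. -/
theorem energy_ge {P : Measure ℝ} [IsProbabilityMeasure P] (hP : P ≪ volume) {T : ℝ} (hT : 0 < T)
    (hPT : ∀ᵐ x ∂P, x ∈ Ico 0 T) {α : ℝ} (h1 : 1 < α) (h5 : α < 5) :
    ∃ c > 0, ∀ᶠ N : ℕ in atTop, c * (T / N) ^ α ≤ energy P (T / N) α := by
  obtain ⟨R, hR⟩ := ((tendsto_integral_cos hP).eventually (gt_mem_nhds one_half_pos)
    |> eventually_atTop.1)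
  -- 9/64 is (7/8 - 1/2)²; 8 exceeds 2π + 1/2 and bounds the window's frequencies by 8/h; 1/(2T) is
  -- the length of the window.
  refine ⟨9 / 64 * 8 ^ (-α) * (1 / (2 * T)), by positivity, ?_⟩
  filter_upwards [eventually_ge_atTop 1, eventually_ge_atTop ⌈R * T⌉₊] with N hN hNR
  have hN0 : (0 : ℝ) < N := by exact_mod_cast hN
  have hN1 : (1 : ℝ) ≤ N := by exact_mod_cast hN
  have hRN : R * T ≤ N := (Nat.le_ceil _).trans (by exact_mod_cast hNR)
  set h := T / N with hh_def
  have hh : 0 < h := by positivity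
  have hTN : T = N * h := by rw [hh_def]; field_simp
  have hhT : h ≤ T := by rw [hTN]; nlinarith
  have hpi := Real.pi_gt_three
  have hpi' := Real.pi_lt_d2
  have hu : 0 < 2 * Real.pi / h := by positivity
  have hRu : R ≤ 2 * Real.pi / h := by
    rw [le_div_iff₀ hh, hh_def, mul_div_assoc', div_le_iff₀ hN0]; nlinarith
  have key := energy_ge_of_specDensity_ge P hh h1 h5 (u := 2 * Real.pi / h)
    (v := 2 * Real.pi / h + 1 / (2 * T)) (m := 9 / 64) hu (by simp; positivity)
    (fun ξ hξ => by
      obtain ⟨η, rfl⟩ : ∃ η, ξ = 2 * Real.pi / h + η := ⟨ξ - 2 * Real.pi / h, by ring⟩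
      have hη0 : 0 ≤ η := by linarith [hξ.1]
      have hη1 : η ≤ 1 / (2 * T) := by linarith [hξ.2]
      have hnode : ∀ k : ℤ, Real.cos ((2 * Real.pi / h + η) * (h * k)) = Real.cos (η * (h * k)) :=
        fun k => by
          rw [← Real.cos_add_int_mul_two_pi (η * (h * k)) k]; congr 1; field_simp; ring
      have hcos : ∀ y, 0 ≤ y → y ≤ T → 7 / 8 ≤ Real.cos (η * y) := fun y hy hyT => by
        have h2 : η * y ≤ 1 / 2 := by
          calc η * y ≤ 1 / (2 * T) * T := by gcongr
            _ = 1 / 2 := by field_simp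
        have h3 : 0 ≤ η * y := by positivity
        have := Real.one_sub_sq_div_two_le_cos (x := η * y)
        nlinarith
      have hle : ∫ x, resid h (fun y => Real.cos ((2 * Real.pi / h + η) * y)) x ∂P
          ≤ ∫ x, (Real.cos ((2 * Real.pi / h + η) * x) - 7 / 8) ∂P := by
        refine integral_mono_ae (integrable_resid_cos P hh _) ?_ ?_
        · refine (Integrable.of_bound (by fun_prop) 1 (ae_of_all _ fun x => ?_)).sub
            (integrable_const _)
          exact Real.abs_cos_le_one _
        · filter_upwards [hPT] with x hx
          have a0 := cell_nonneg hh hx.1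
          have b0 := cell_add_le hh hTN hx.2
          have e1 := hnode ⌊x / h⌋
          have e2 := hnode (⌊x / h⌋ + 1)
          push_cast at e2
          have e3 : h * ((⌊x / h⌋ : ℝ) + 1) = h * (⌊x / h⌋ : ℝ) + h := by ring
          rw [e3] at e2
          have c1 := hcos _ a0 (by linarith)
          have c2 := hcos (h * (⌊x / h⌋ : ℝ) + h) (by linarith) b0
          have f0 := Int.fract_nonneg (x / h)
          have f1 := (Int.fract_lt_one (x / h)).le
          simp only [resid, res]
          rw [e1, e2]
          nlinarith
      have hRL := hR _ (hRu.trans hξ.1)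
      rw [integral_sub (Integrable.of_bound (by fun_prop) 1
        (ae_of_all _ fun x => Real.abs_cos_le_one _)) (integrable_const _)] at hle
      simp only [integral_const, probReal_univ, one_smul] at hle
      have hneg : ∫ x, resid h (fun y => Real.cos ((2 * Real.pi / h + η) * y)) x ∂P ≤ -(3 / 8) := by
        linarith
      unfold specDensity
      nlinarith [sq_nonneg (∫ x, resid h (fun y => Real.sin ((2 * Real.pi / h + η) * y)) x ∂P)])
  refine le_trans ?_ key
  have hv : 2 * Real.pi / h + 1 / (2 * T) ≤ 8 / h := by
    have : 1 / (2 * T) ≤ 1 / (2 * h) := by gcongr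
    calc _ ≤ 2 * Real.pi / h + 1 / (2 * h) := by gcongr
      _ = (2 * Real.pi + 1 / 2) / h := by field_simp
      _ ≤ 8 / h := by gcongr; linarith
  have hvp : (8 / h) ^ (-α) ≤ (2 * Real.pi / h + 1 / (2 * T)) ^ (-α) :=
    Real.rpow_le_rpow_of_nonpos (by positivity) hv (by linarith)
  rw [Real.div_rpow (by norm_num) hh.le, Real.rpow_neg hh.le, div_inv_eq_mul] at hvp
  rw [add_sub_cancel_left]
  calc _ = 9 / 64 * (8 ^ (-α) * h ^ α) * (1 / (2 * T)) := by ring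
    _ ≤ _ := by gcongr

theorem integral_fract_cells {h T : ℝ} (hh : 0 < h) {N : ℕ} (hT : T = N * h) :
    ∫ x in Icc 0 T, Int.fract (x / h) * (1 - Int.fract (x / h)) = T / 6 := by
  have hT0 : 0 ≤ T := by rw [hT]; positivity
  set φ : ℝ → ℝ := fun u => Int.fract u * (1 - Int.fract u) with hφ
  have hper : Function.Periodic φ 1 := fun u => by simp [hφ, Int.fract_add_one]
  have h1 : ∫ u in (0 : ℝ)..1, φ u = 1 / 6 := by
    have e : ∀ u ∈ uIcc (0 : ℝ) 1, φ u = u - u ^ 2 := fun u hu => by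
      rw [uIcc_of_le zero_le_one] at hu
      rcases hu.2.lt_or_eq with h' | h'
      · rw [hφ]; simp only; rw [Int.fract_eq_self.2 ⟨hu.1, h'⟩]; ring
      · simp [hφ, h']
    rw [intervalIntegral.integral_congr e, intervalIntegral.integral_sub (by simp) (by simp)]
    norm_num
  have hb : ∀ (μ : Measure ℝ) [IsFiniteMeasure μ], Integrable φ μ := fun μ _ =>
    Integrable.of_bound (by fun_prop : Measurable φ).aestronglyMeasurable 1 (ae_of_all _ fun u => by
      have h0 := Int.fract_nonneg u
      have h1 := Int.fract_lt_one u
      rw [Real.norm_eq_abs, abs_le]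
      simp only [hφ]
      constructor <;> nlinarith)
  have h2 := hper.intervalIntegral_add_zsmul_eq N 0 fun t₁ t₂ => ⟨hb _, hb _⟩
  simp only [zero_add, h1] at h2
  rw [integral_Icc_eq_integral_Ioc, ← intervalIntegral.integral_of_le hT0,
    intervalIntegral.integral_comp_div φ hh.ne', zero_div]
  have : T / h = (N : ℤ) • (1 : ℝ) := by rw [hT]; field_simp; simp
  rw [this, h2, hT]
  simp; ring

/-- For ξ in [1/(2T), 1/T] the cosine is at least 1/2 on [0, T], so it is uniformly concave there
and all interpolation errors are nonnegative. They add up to order h², without cancellation, on a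
fixed frequency window. -/
theorem energy_ge_pow_four {P : Measure ℝ} [IsProbabilityMeasure P] {T c : ℝ} (hT : 0 < T)
    (hc : 0 < c) (hPT : ∀ᵐ x ∂P, x ∈ Ico 0 T)
    (hPc : ENNReal.ofReal c • volume.restrict (Icc 0 T) ≤ P) {α : ℝ} (h1 : 1 < α) (h5 : α < 5) :
    ∃ k > 0, ∀ N : ℕ, 1 ≤ N → k * (T / N) ^ 4 ≤ energy P (T / N) α := by
  refine ⟨((1 / (2 * T)) ^ 2 / 4 * (c * (T / 6))) ^ 2 * (1 / T) ^ (-α) * (1 / T - 1 / (2 * T)),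
    ?_, fun N hN => ?_⟩
  · have : 1 / T - 1 / (2 * T) = 1 / (2 * T) := by field_simp; ring
    rw [this]; positivity
  have hN0 : (0 : ℝ) < N := by exact_mod_cast hN
  set h := T / N with hh_def
  have hh : 0 < h := by positivity
  have hTN : T = N * h := by rw [hh_def]; field_simp
  have hφm : Measurable fun x : ℝ => Int.fract (x / h) * (1 - Int.fract (x / h)) := by fun_prop
  have hφ0 : ∀ x : ℝ, 0 ≤ Int.fract (x / h) * (1 - Int.fract (x / h)) := fun x =>
    mul_nonneg (Int.fract_nonneg _) (by linarith [(Int.fract_lt_one (x / h)).le])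
  have hφ1 : ∀ x : ℝ, ‖Int.fract (x / h) * (1 - Int.fract (x / h))‖ ≤ 1 := fun x => by
    rw [Real.norm_eq_abs, abs_of_nonneg (hφ0 x)]
    nlinarith [Int.fract_nonneg (x / h), Int.fract_lt_one (x / h)]
  have hφP : Integrable (fun x : ℝ => Int.fract (x / h) * (1 - Int.fract (x / h))) P :=
    Integrable.of_bound hφm.aestronglyMeasurable 1 (ae_of_all _ hφ1)
  -- The lower density bound enters here; 1/6 is the mean of u(1 - u) over a period.
  have hint : c * (T / 6) ≤ ∫ x, Int.fract (x / h) * (1 - Int.fract (x / h)) ∂P := by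
    have := integral_mono_measure hPc (ae_of_all _ hφ0) hφP
    rwa [integral_smul_measure, ENNReal.toReal_ofReal hc.le, smul_eq_mul,
      integral_fract_cells hh hTN] at this
  have key := energy_ge_of_specDensity_ge P hh h1 h5 (u := 1 / (2 * T)) (v := 1 / T)
    (m := ((1 / (2 * T)) ^ 2 / 4 * (c * (T / 6)) * h ^ 2) ^ 2) (by positivity)
    (by gcongr; linarith)
    (fun ξ hξ => by
      have hξ0 : 0 < ξ := lt_of_lt_of_le (by positivity) hξ.1
      have hcos : ∀ y, 0 ≤ y → y ≤ T → 1 / 2 ≤ Real.cos (ξ * y) := fun y hy hyT => by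
        have h2 : ξ * y ≤ 1 := by
          calc ξ * y ≤ 1 / T * T := by gcongr; exact hξ.2
            _ = 1 := by field_simp
        have h3 : 0 ≤ ξ * y := by positivity
        have := Real.one_sub_sq_div_two_le_cos (x := ξ * y)
        nlinarith
      have hle : ∫ x, (1 / (2 * T)) ^ 2 / 4 * h ^ 2 *
          (Int.fract (x / h) * (1 - Int.fract (x / h))) ∂P
          ≤ ∫ x, resid h (fun y => Real.cos (ξ * y)) x ∂P := by
        refine integral_mono_ae (hφP.const_mul _) (integrable_resid_cos P hh _) ?_
        filter_upwards [hPT] with x hx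
        have a0 := cell_nonneg hh hx.1
        have b0 := cell_add_le hh hTN hx.2
        have := res_ge_of_deriv2_le (Int.fract_nonneg (x / h)) (Int.fract_lt_one (x / h)).le
          (by linarith) (cell_eq hh x) (m := ξ ^ 2 / 2)
          (fun y _ => hasDerivAt_cos_mul ξ y) (fun y _ => (hasDerivAt_sin_mul ξ y).const_mul (-ξ))
          (fun y hy => by
            have := hcos y (a0.trans hy.1) (hy.2.trans b0)
            nlinarith [sq_nonneg ξ])
        rw [add_sub_cancel_left] at this
        refine le_trans ?_ this
        have hsq : (1 / (2 * T)) ^ 2 ≤ ξ ^ 2 := by gcongr; exact hξ.1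
        have hq : 0 ≤ h ^ 2 * (Int.fract (x / h) * (1 - Int.fract (x / h))) :=
          mul_nonneg (by positivity) (hφ0 x)
        nlinarith
      rw [integral_const_mul] at hle
      have hle2 : (1 / (2 * T)) ^ 2 / 4 * (c * (T / 6)) * h ^ 2
          ≤ ∫ x, resid h (fun y => Real.cos (ξ * y)) x ∂P := by
        refine le_trans ?_ hle
        calc _ = (1 / (2 * T)) ^ 2 / 4 * h ^ 2 * (c * (T / 6)) := by ring
          _ ≤ _ := by gcongr
      have := pow_le_pow_left₀ (by positivity) hle2 2
      unfold specDensity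
      nlinarith [sq_nonneg (∫ x, resid h (fun y => Real.sin (ξ * y)) x ∂P)])
  refine le_trans (le_of_eq ?_) key
  ring

end BQCalibration

namespace BQCalibration
open Set Filter Topology Matrix

/-! ### Brownian motion interpolation on a uniform grid -/

/-- The points `h, 2h, …, Nh`. -/
def gridPts (N : ℕ) (h : ℝ) : Fin N → ℝ := fun j => ((j : ℕ) + 1) * h

/-- The summation matrix. -/
def sumMatrix (N : ℕ) : Matrix (Fin N) (Fin N) ℝ := Matrix.of fun i l => if l ≤ i then 1 else 0

theorem det_sumMatrix (N : ℕ) : (sumMatrix N).det = 1 := by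
  rw [Matrix.det_of_isLowerTriangular]
  · simp [sumMatrix]
  · intro i j hij
    have : i < j := hij
    simp [sumMatrix, this]

/-- Brownian motion at the nodes is a cumulative sum of independent increments of variance h: entry
(i, j) counts the increments common to both. -/
theorem gram_gridPts (N : ℕ) {h : ℝ} (hh : 0 ≤ h) :
    gram bmKernel (gridPts N h) = h • (sumMatrix N * (sumMatrix N)ᵀ) := by
  ext i j
  have e : ∀ l : Fin N, sumMatrix N i l * (sumMatrix N)ᵀ l j
      = if l ∈ Finset.Iic (min i j) then (1 : ℝ) else 0 := fun l => by
    by_cases h1 : l ≤ i <;> by_cases h2 : l ≤ j <;> simp [sumMatrix, h1, h2]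
  rw [Matrix.smul_apply, Matrix.mul_apply, Finset.sum_congr rfl fun l _ => e l]
  simp only [Finset.sum_ite_mem, Finset.univ_inter, Finset.sum_const, Fin.card_Iic, gram, bmKernel,
    gridPts, Matrix.of_apply, nsmul_eq_mul, mul_one, smul_eq_mul]
  rw [← min_mul_of_nonneg _ _ hh, min_add_add_right, mul_comm]
  congr 1
  rcases le_total i j with h | h
  · rw [min_eq_left h, min_eq_left (by exact_mod_cast h)]; push_cast; ring
  · rw [min_eq_right h, min_eq_right (by exact_mod_cast h)]; push_cast; ring

theorem posDef_gram_gridPts (N : ℕ) {h : ℝ} (hh : 0 < h) :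
    (gram bmKernel (gridPts N h)).PosDef := by
  rw [gram_gridPts N hh.le]
  have hinj : Function.Injective (sumMatrix N).vecMul :=
    Matrix.vecMul_injective_of_isUnit ((Matrix.isUnit_iff_isUnit_det _).2 (by simp [det_sumMatrix]))
  have := Matrix.PosDef.mul_conjTranspose_self (sumMatrix N) hinj
  rw [Matrix.conjTranspose_eq_transpose_of_trivial] at this
  exact this.smul hh

theorem gram_scaledKernel {ι : Type*} (k : ℝ → ℝ → ℝ) (t : ℝ) (X : ι → ℝ) :
    gram (scaledKernel k t) X = t • gram k X := by
  ext i j; simp [gram, scaledKernel]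

theorem isUnit_det_gram_scaled {ι : Type*} [Fintype ι] [DecidableEq ι] (N : ℕ) {h t : ℝ}
    (hh : 0 < h) (ht : 0 < t) {e : ι → Fin N} (he : Function.Injective e) :
    IsUnit (gram (scaledKernel bmKernel t) (fun i => gridPts N h (e i))).det := by
  have h1 := ((posDef_gram_gridPts N hh).submatrix he).smul ht
  have h2 : gram (scaledKernel bmKernel t) (fun i => gridPts N h (e i))
      = t • (gram bmKernel (gridPts N h)).submatrix e e := by
    rw [gram_scaledKernel]; rfl
  rw [h2]
  exact (Matrix.isUnit_iff_isUnit_det _).1 h1.isUnit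

/-- Identifies the interpolant without inverting the Gram matrix: weights that reproduce the kernel
at the nodes are the prediction weights. -/
theorem postMean_eq_sum {ι : Type*} [Fintype ι] [DecidableEq ι] {k : ℝ → ℝ → ℝ} {X : ι → ℝ} {x : ℝ}
    {w : ι → ℝ} (hK : IsUnit (gram k X).det) (hw : ∀ i, k x (X i) = ∑ j, w j * k (X j) (X i))
    (y : ι → ℝ) : postMean k X y x = ∑ j, w j * y j := by
  have h1 : (fun i => k x (X i)) = w ᵥ* gram k X := by
    ext i; simp [Matrix.vecMul, dotProduct, gram, hw]
  rw [postMean, h1, ← Matrix.dotProduct_mulVec, Matrix.mulVec_mulVec, Matrix.mul_nonsing_inv _ hK,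
    Matrix.one_mulVec]
  rfl

/-- Index m = 0 stands for the origin, which is not a data point but contributes nothing since g(0)
= 0. The alternative u = 0 covers a missing neighbour beyond the last node. -/
theorem sum_node {N m : ℕ} {h u : ℝ} (hm : m ≤ N ∨ u = 0) {g : ℝ → ℝ} (hg : g 0 = 0) :
    ∑ j : Fin N, (if (j : ℕ) + 1 = m then u else 0) * g (gridPts N h j) = u * g (m * h) := by
  rcases hm with hm | rfl
  · rcases m with _ | m
    · simp [hg]
    · rw [Finset.sum_eq_single (⟨m, hm⟩ : Fin N)]
      · simp [gridPts]
      · intro j _ hj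
        have : (j : ℕ) ≠ m := fun e => hj (Fin.ext e)
        simp [this]
      · simp
  · simp

/-- The only kink of min(·, node) is at a node, so the function is affine on every cell. -/
theorem resid_min_node {h : ℝ} (hh : 0 < h) (m : ℤ) (x : ℝ) :
    resid h (fun y => min y (h * m)) x = 0 := by
  have e := cell_eq hh x
  have l1 := cell_le hh x
  have l2 := lt_cell_add hh x
  simp only [resid, res]
  rcases le_or_gt m ⌊x / h⌋ with hm | hm
  · have : (m : ℝ) ≤ ⌊x / h⌋ := by exact_mod_cast hm
    have : h * m ≤ h * ⌊x / h⌋ := by gcongr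
    rw [min_eq_right (by linarith), min_eq_right (by linarith), min_eq_right (by linarith)]; ring
  · have : (⌊x / h⌋ : ℝ) + 1 ≤ m := by exact_mod_cast hm
    have : h * ⌊x / h⌋ + h ≤ h * m := by nlinarith
    rw [min_eq_left (by linarith), min_eq_left (by linarith), min_eq_left (by linarith)]
    linarith

theorem floor_eq_nat {h : ℝ} (hh : 0 < h) {N : ℕ} {x : ℝ} (hx : 0 ≤ x) (hxN : x < N * h) :
    ∃ n : ℕ, n < N ∧ ⌊x / h⌋ = n := by
  obtain ⟨n, hn⟩ := Int.eq_ofNat_of_zero_le (Int.floor_nonneg.2 (div_nonneg hx hh.le))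
  refine ⟨n, ?_, hn⟩
  have h1 : x / h < (N : ℤ) := by rw [div_lt_iff₀ hh]; push_cast; linarith
  have h2 := Int.floor_lt.2 h1
  rw [hn] at h2
  exact_mod_cast h2

theorem scaledKernel_one (k : ℝ → ℝ → ℝ) : scaledKernel k 1 = k := by
  funext x x'; simp [scaledKernel]

theorem postMean_grid {N : ℕ} {h : ℝ} (hh : 0 < h) {x : ℝ} (hx : 0 ≤ x) (hxN : x < N * h)
    {g : ℝ → ℝ} (hg : g 0 = 0) :
    postMean bmKernel (gridPts N h) (fun i => g (gridPts N h i)) x = g x - resid h g x := by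
  obtain ⟨n, hn, hfl⟩ := floor_eq_nat hh hx hxN
  set l := Int.fract (x / h) with hl
  have hsum : ∀ G : ℝ → ℝ, G 0 = 0 → ∑ j : Fin N, ((if (j : ℕ) + 1 = n then 1 - l else 0)
      + (if (j : ℕ) + 1 = n + 1 then l else 0)) * G (gridPts N h j) = G x - resid h G x := by
    intro G hG
    simp only [add_mul, Finset.sum_add_distrib]
    rw [sum_node (Or.inl hn.le) hG, sum_node (Or.inl hn) hG]
    simp only [resid, res, hfl, ← hl]
    push_cast
    rw [mul_comm h, ← add_one_mul]
    ring
  have hK := isUnit_det_gram_scaled N hh one_pos (Function.injective_id (α := Fin N))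
  rw [scaledKernel_one] at hK
  rw [postMean_eq_sum (X := gridPts N h) hK (w := fun j : Fin N => (if (j : ℕ) + 1 = n then 1 - l else 0)
      + (if (j : ℕ) + 1 = n + 1 then l else 0)) ?_, hsum g hg]
  intro i
  have hpos : 0 ≤ gridPts N h i := by unfold gridPts; positivity
  have h0 := hsum (fun y => min y (gridPts N h i)) (by simp [hpos])
  have h1 := resid_min_node hh ((i : ℕ) + 1) x
  have e : h * (((i : ℕ) + 1 : ℤ) : ℝ) = gridPts N h i := by simp [gridPts, mul_comm]
  rw [e] at h1
  rw [h1, sub_zero] at h0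
  exact h0.symm

/-- The posterior covariance interpolates in one argument only. The second residual is free, because
it subtracts sections at nodes, whose residuals vanish. -/
theorem postCov_grid {N : ℕ} {h : ℝ} (hh : 0 < h) {x x' : ℝ} (hx : 0 ≤ x) (hxN : x < N * h)
    (hx' : 0 ≤ x') : postCov bmKernel (gridPts N h) x x' = resid2 h bmKernel x x' := by
  have h1 : postCov bmKernel (gridPts N h) x x' = resid h (fun y => min y x') x := by
    have := postMean_grid hh hx hxN (g := fun y => min y x') (by simp [hx'])
    have e : postCov bmKernel (gridPts N h) x x' = min x x'
      - postMean bmKernel (gridPts N h) (fun i => min (gridPts N h i) x') x := rfl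
    rw [e, this]; ring
  have r1 := resid_min_node hh ⌊x' / h⌋ x
  have r2 := resid_min_node hh (⌊x' / h⌋ + 1) x
  have e3 : h * ((⌊x' / h⌋ + 1 : ℤ) : ℝ) = h * (⌊x' / h⌋ : ℝ) + h := by push_cast; ring
  rw [e3] at r2
  have e4 : resid2 h bmKernel x x' = resid h (fun y => min y x') x
      - ((1 - Int.fract (x' / h)) * resid h (fun y => min y (h * (⌊x' / h⌋ : ℝ))) x
        + Int.fract (x' / h) * resid h (fun y => min y (h * (⌊x' / h⌋ : ℝ) + h)) x) := by
    simp only [resid2, resid, res, bmKernel]; ring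
  rw [h1, e4, r1, r2]; ring

/-- The weight of the right neighbour in leave-one-out prediction. -/
noncomputable def looWeight {N : ℕ} (n : Fin N) : ℝ := if (n : ℕ) + 1 < N then 1 / 2 else 0

theorem sum_loo {N : ℕ} {h : ℝ} (n : Fin N) {g : ℝ → ℝ} (hg : g 0 = 0) :
    ∑ j : {i : Fin N // i ≠ n}, ((if ((j : Fin N) : ℕ) + 1 = n then 1 - looWeight n else 0)
      + (if ((j : Fin N) : ℕ) + 1 = n + 2 then looWeight n else 0)) * g (gridPts N h j)
      = (1 - looWeight n) * g ((n : ℕ) * h) + looWeight n * g (((n : ℕ) + 2 : ℕ) * h) := by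
  have h1 := sum_node (N := N) (m := n) (h := h) (u := 1 - looWeight n) (Or.inl n.2.le) hg
  have h2 := sum_node (N := N) (m := n + 2) (h := h) (u := looWeight n) (by
    by_cases hn : (n : ℕ) + 1 < N
    · left; omega
    · right; simp [looWeight, hn]) hg
  rw [← h1, ← h2, ← Finset.sum_add_distrib]
  simp only [← add_mul]
  rw [← Finset.sum_subtype (Finset.univ.filter fun i : Fin N => i ≠ n) (by simp)
    (fun j : Fin N => ((if (j : ℕ) + 1 = n then 1 - looWeight n else 0)
      + (if (j : ℕ) + 1 = n + 2 then looWeight n else 0)) * g (gridPts N h j))]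
  refine Finset.sum_filter_of_ne fun j _ hj => ?_
  rintro rfl
  simp at hj

/-- The point with index n sits at (n + 1)h, so its neighbours are nh and (n + 2)h, with equal
weights by uniformity. The last point has no right neighbour and is predicted by the left one alone.
-/
theorem loo_kernel {N : ℕ} {h : ℝ} (hh : 0 < h) (n i : Fin N) (hi : i ≠ n) :
    min (gridPts N h n) (gridPts N h i) = (1 - looWeight n) * min ((n : ℕ) * h) (gridPts N h i)
      + looWeight n * min (((n : ℕ) + 2 : ℕ) * h) (gridPts N h i) := by
  simp only [gridPts]
  rcases lt_or_gt_of_ne hi with hlt | hlt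
  · have : ((i : ℕ) : ℝ) + 1 ≤ n := by exact_mod_cast hlt
    rw [min_eq_right (by gcongr ?_ * h; linarith), min_eq_right (by gcongr),
      min_eq_right (by push_cast; gcongr ?_ * h; linarith)]
    ring
  · have h1 : ((n : ℕ) : ℝ) + 1 ≤ i := by exact_mod_cast hlt
    have h2 : (n : ℕ) + 1 < N := lt_of_le_of_lt hlt i.2
    rw [min_eq_left (by gcongr ?_ * h; linarith), min_eq_left (by gcongr ?_ * h; linarith),
      min_eq_left (by push_cast; gcongr ?_ * h; linarith), looWeight, if_pos h2]
    push_cast; ring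

theorem postMean_loo {N : ℕ} {h t : ℝ} (hh : 0 < h) (ht : 0 < t) (n : Fin N) {g : ℝ → ℝ}
    (hg : g 0 = 0) :
    postMean (scaledKernel bmKernel t) (fun i : {i : Fin N // i ≠ n} => gridPts N h i)
        (fun i => g (gridPts N h i)) (gridPts N h n)
      = (1 - looWeight n) * g ((n : ℕ) * h) + looWeight n * g (((n : ℕ) + 2 : ℕ) * h) := by
  have hK := isUnit_det_gram_scaled N hh ht
    (Subtype.val_injective (p := fun i : Fin N => i ≠ n))
  rw [postMean_eq_sum hK (w := fun j : {i : Fin N // i ≠ n} =>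
      (if ((j : Fin N) : ℕ) + 1 = n then 1 - looWeight n else 0)
      + (if ((j : Fin N) : ℕ) + 1 = n + 2 then looWeight n else 0)) ?_, sum_loo n hg]
  intro i
  have hpos : 0 ≤ gridPts N h i := by unfold gridPts; positivity
  have h0 := sum_loo (h := h) n (g := fun y => t * min y (gridPts N h i)) (by simp [hpos])
  have h1 := loo_kernel hh n i i.2
  simp only [scaledKernel, bmKernel]
  rw [h0, h1]; ring

theorem looMean_grid {N : ℕ} {h t : ℝ} (hh : 0 < h) (ht : 0 < t) (n : Fin N) {g : ℝ → ℝ}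
    (hg : g 0 = 0) :
    looMean (scaledKernel bmKernel t) (gridPts N h) (fun i => g (gridPts N h i)) n
      = (1 - looWeight n) * g ((n : ℕ) * h) + looWeight n * g (((n : ℕ) + 2 : ℕ) * h) :=
  postMean_loo hh ht n hg

theorem looVar_grid {N : ℕ} {h t : ℝ} (hh : 0 < h) (ht : 0 < t) (n : Fin N) :
    looVar (scaledKernel bmKernel t) (gridPts N h) n = t * ((1 - looWeight n) * h) := by
  have hpos : 0 ≤ gridPts N h n := by unfold gridPts; positivity
  have h0 := postMean_loo hh ht n (g := fun y => t * min y (gridPts N h n)) (by simp [hpos])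
  have e : looVar (scaledKernel bmKernel t) (gridPts N h) n
    = t * min (gridPts N h n) (gridPts N h n)
      - postMean (scaledKernel bmKernel t) (fun i : {i : Fin N // i ≠ n} => gridPts N h i)
        (fun i => t * min (gridPts N h i) (gridPts N h n)) (gridPts N h n) := rfl
  rw [e, h0, min_self, min_eq_left, min_eq_right]
  · simp only [gridPts]; ring
  · simp only [gridPts]; push_cast; gcongr ?_ * h; linarith
  · simp only [gridPts]; gcongr; linarith

/-! ### The amplitude estimators on a uniform grid -/

/-- Both losses have this form, and log u < u - 1 for u ≠ 1 makes Q/N the unique minimiser. -/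
theorem argminPos_eq {L : ℝ → ℝ} {Q c : ℝ} {N : ℕ} (hN : 0 < N) (hQ : 0 ≤ Q)
    (hL : ∀ t, 0 < t → L t = Q / t + N * Real.log t + c) : argminPos L = Q / N := by
  have hN' : (0 : ℝ) < N := by exact_mod_cast hN
  rcases hQ.eq_or_lt with rfl | hQ
  -- If Q = 0 there is no minimiser, since halving t decreases the loss; the default value 0 agrees
  -- with Q/N.
  · rw [zero_div, argminPos, dif_neg]
    rintro ⟨t, ht, hmin⟩
    have h1 := hmin (t / 2) (by positivity)
    rw [hL t ht, hL _ (by positivity), Real.log_div ht.ne' two_ne_zero] at h1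
    have := Real.log_pos one_lt_two
    simp only [zero_div] at h1
    nlinarith
  · have ht0 : 0 < Q / N := by positivity
    have hdiff : ∀ u, 0 < u → L u - L (Q / N) = N * (Q / N / u - 1 - Real.log (Q / N / u)) := by
      intro u hu
      rw [hL u hu, hL _ ht0, Real.log_div ht0.ne' hu.ne']
      field_simp
      ring
    have hmin : ∀ u, 0 < u → L (Q / N) ≤ L u := fun u hu => by
      have h1 := Real.log_le_sub_one_of_pos (div_pos ht0 hu)
      have h2 := hdiff u hu
      have : 0 ≤ N * (Q / N / u - 1 - Real.log (Q / N / u)) :=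
        mul_nonneg hN'.le (by linarith)
      linarith
    have hex : ∃ t : ℝ, 0 < t ∧ ∀ u : ℝ, 0 < u → L t ≤ L u := ⟨Q / N, ht0, hmin⟩
    rw [argminPos, dif_pos hex]
    obtain ⟨hs0, hs⟩ := hex.choose_spec
    by_contra hne
    have h1 := Real.log_lt_sub_one_of_pos (div_pos ht0 hs0) (by
      rw [Ne, div_eq_one_iff_eq hs0.ne']; exact fun e => hne e.symm)
    have h2 := hdiff _ hs0
    have h3 := hs _ ht0
    have : 0 < N * (Q / N / hex.choose - 1 - Real.log (Q / N / hex.choose)) :=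
      mul_pos hN' (by linarith)
    linarith

theorem looWeight_le {N : ℕ} (n : Fin N) : 0 ≤ looWeight n ∧ looWeight n ≤ 1 / 2 := by
  unfold looWeight; split_ifs <;> norm_num

theorem tauSqCV_grid {N : ℕ} (hN : 0 < N) {h : ℝ} (hh : 0 < h) {g : ℝ → ℝ} (hg : g 0 = 0) :
    tauSqCV (gridPts N h) (fun i => g (gridPts N h i))
      = (∑ n : Fin N, (res (((n : ℕ) + 1) * h) ((n : ℕ) * h) (((n : ℕ) + 2) * h) (looWeight n) g) ^ 2
        / ((1 - looWeight n) * h)) / N := by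
  have hv : ∀ n : Fin N, 0 < (1 - looWeight n) * h := fun n =>
    mul_pos (by linarith [(looWeight_le n).2]) hh
  refine argminPos_eq (c := ∑ n : Fin N, Real.log ((1 - looWeight n) * h)) hN
    (Finset.sum_nonneg fun n _ => div_nonneg (sq_nonneg _) (hv n).le) fun t ht => ?_
  have e : ∀ n : Fin N, (g (gridPts N h n)
      - looMean (scaledKernel bmKernel t) (gridPts N h) (fun i => g (gridPts N h i)) n) ^ 2
        / looVar (scaledKernel bmKernel t) (gridPts N h) n
        + Real.log (looVar (scaledKernel bmKernel t) (gridPts N h) n)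
      = (res (((n : ℕ) + 1) * h) ((n : ℕ) * h) (((n : ℕ) + 2) * h) (looWeight n) g) ^ 2
        / ((1 - looWeight n) * h) / t + Real.log t + Real.log ((1 - looWeight n) * h) := fun n => by
    rw [looMean_grid hh ht n hg, looVar_grid hh ht, Real.log_mul ht.ne' (hv n).ne', ← add_assoc,
      div_div, mul_comm t]
    simp only [res, gridPts]
    push_cast
    rfl
  rw [cvLoss, Finset.sum_congr rfl fun n _ => e n, Finset.sum_add_distrib, Finset.sum_add_distrib,
    Finset.sum_div (f := fun n : Fin N => (res (((n : ℕ) + 1) * h) ((n : ℕ) * h)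
      (((n : ℕ) + 2) * h) (looWeight n) g) ^ 2 / ((1 - looWeight n) * h)) (a := t)]
  simp

/-- With K = h A Aᵀ and data y = A d, where d is the vector of increments, yᵀK⁻¹y reduces to |d|²/h.
-/
theorem quadForm_grid {N : ℕ} {h : ℝ} (hh : 0 < h) {g : ℝ → ℝ} (hg : g 0 = 0) :
    (fun i => g (gridPts N h i)) ⬝ᵥ
        ((gram bmKernel (gridPts N h))⁻¹ *ᵥ fun i => g (gridPts N h i))
      = ∑ n : Fin N, (g (((n : ℕ) + 1) * h) - g ((n : ℕ) * h)) ^ 2 / h := by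
  set A := sumMatrix N with hA
  set d : Fin N → ℝ := fun n => g (((n : ℕ) + 1) * h) - g ((n : ℕ) * h) with hd
  have hAu : IsUnit A.det := by rw [hA, det_sumMatrix]; exact isUnit_one
  have hAtu : IsUnit Aᵀ.det := by rwa [Matrix.det_transpose]
  have hy : (fun i => g (gridPts N h i)) = A *ᵥ d := by
    ext i
    have e1 : (A *ᵥ d) i = ∑ l : Fin N, if (l : ℕ) ≤ i then
        g (((l : ℕ) + 1) * h) - g ((l : ℕ) * h) else 0 := by
      simp only [Matrix.mulVec, dotProduct, hA, sumMatrix, Matrix.of_apply, hd, ite_mul, one_mul,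
        zero_mul, Fin.le_def]
    rw [e1, Fin.sum_univ_eq_sum_range (fun l : ℕ => if l ≤ (i : ℕ) then
        g (((l : ℕ) + 1) * h) - g ((l : ℕ) * h) else 0) N, ← Finset.sum_filter]
    have e2 : (Finset.range N).filter (fun l => l ≤ (i : ℕ)) = Finset.range (i + 1) := by
      ext l; simp only [Finset.mem_filter, Finset.mem_range]; omega
    rw [e2]
    have e3 := Finset.sum_range_sub (fun l : ℕ => g (l * h)) (i + 1)
    push_cast at e3
    rw [e3]
    simp [gridPts, hg]
  have hK : IsUnit (gram bmKernel (gridPts N h)).det :=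
    (Matrix.isUnit_iff_isUnit_det _).1 (posDef_gram_gridPts N hh).isUnit
  have hv : (gram bmKernel (gridPts N h))⁻¹ *ᵥ (A *ᵥ d) = h⁻¹ • (Aᵀ⁻¹ *ᵥ d) := by
    have : A *ᵥ d = gram bmKernel (gridPts N h) *ᵥ (h⁻¹ • (Aᵀ⁻¹ *ᵥ d)) := by
      rw [gram_gridPts N hh.le, Matrix.mulVec_smul, Matrix.smul_mulVec, smul_smul,
        inv_mul_cancel₀ hh.ne', one_smul, Matrix.mulVec_mulVec, Matrix.mul_assoc,
        Matrix.mul_nonsing_inv _ hAtu, Matrix.mul_one]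
    rw [this, Matrix.mulVec_mulVec, Matrix.nonsing_inv_mul _ hK, Matrix.one_mulVec]
  rw [hy, hv, dotProduct_smul, ← Matrix.vecMul_transpose, ← Matrix.dotProduct_mulVec,
    Matrix.mulVec_mulVec, Matrix.mul_nonsing_inv _ hAtu, Matrix.one_mulVec, smul_eq_mul,
    dotProduct, Finset.mul_sum]
  exact Finset.sum_congr rfl fun n _ => by rw [div_eq_inv_mul, sq]

theorem tauSqML_grid {N : ℕ} (hN : 0 < N) {h : ℝ} (hh : 0 < h) {g : ℝ → ℝ} (hg : g 0 = 0) :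
    tauSqML (gridPts N h) (fun i => g (gridPts N h i))
      = (∑ n : Fin N, (g (((n : ℕ) + 1) * h) - g ((n : ℕ) * h)) ^ 2 / h) / N := by
  refine argminPos_eq (c := Real.log (gram bmKernel (gridPts N h)).det) hN
    (Finset.sum_nonneg fun n _ => by positivity) fun t ht => ?_
  have hpd := posDef_gram_gridPts N hh
  have hdet : IsUnit (gram bmKernel (gridPts N h)).det :=
    (Matrix.isUnit_iff_isUnit_det _).1 hpd.isUnit
  have hinv : (t • gram bmKernel (gridPts N h))⁻¹ = t⁻¹ • (gram bmKernel (gridPts N h))⁻¹ := by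
    let _ := invertibleOfNonzero ht.ne'
    rw [Matrix.inv_smul _ _ hdet, invOf_eq_inv]
  rw [mlLoss, gram_scaledKernel, hinv, Matrix.smul_mulVec, dotProduct_smul, quadForm_grid hh hg,
    Matrix.det_smul, Real.log_mul (by positivity) hpd.det_pos.ne', Real.log_pow, Fintype.card_fin,
    smul_eq_mul, div_eq_inv_mul _ t]
  ring

end BQCalibration

namespace BQCalibration
open Set Filter Topology

/-! ### Second moments of the process -/

section CenteredGP

variable {Ω : Type*} [MeasurableSpace Ω] {μ : Measure Ω} {f : ℝ → Ω → ℝ}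
  {D : Set ℝ} {k : ℝ → ℝ → ℝ}

theorem IsCenteredGP.memLp (hf : IsCenteredGP f D k μ) {x : ℝ} (hx : x ∈ D) : MemLp (f x) 2 μ :=
  (hf.gaussian.hasGaussianLaw_eval ⟨x, hx⟩).memLp_two

theorem IsCenteredGP.integrable_mul (hf : IsCenteredGP f D k μ) {x x' : ℝ} (hx : x ∈ D)
    (hx' : x' ∈ D) : Integrable (fun ω => f x ω * f x' ω) μ :=
  (hf.memLp hx).integrable_mul (hf.memLp hx')

theorem IsCenteredGP.memLp_res (hf : IsCenteredGP f D k μ) {x a b : ℝ} (l : ℝ) (hx : x ∈ D)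
    (ha : a ∈ D) (hb : b ∈ D) : MemLp (fun ω => res x a b l fun y => f y ω) 2 μ :=
  (hf.memLp hx).sub (((hf.memLp ha).const_mul (1 - l)).add ((hf.memLp hb).const_mul l))

theorem IsCenteredGP.integrable_res_mul_res (hf : IsCenteredGP f D k μ) {x a b x' a' b' : ℝ}
    (l l' : ℝ) (hx : x ∈ D) (ha : a ∈ D) (hb : b ∈ D) (hx' : x' ∈ D) (ha' : a' ∈ D) (hb' : b' ∈ D) :
    Integrable (fun ω => res x a b l (fun z => f z ω) * res x' a' b' l' (fun z => f z ω)) μ :=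
  (hf.memLp_res l hx ha hb).integrable_mul (hf.memLp_res l' hx' ha' hb')

variable [IsProbabilityMeasure μ]

theorem IsCenteredGP.integral_mul (hf : IsCenteredGP f D k μ) {x x' : ℝ} (hx : x ∈ D)
    (hx' : x' ∈ D) : ∫ ω, f x ω * f x' ω ∂μ = k x x' := by
  have h := hf.cov_eq x hx x' hx'
  rw [covariance_eq_sub (hf.memLp hx) (hf.memLp hx'), hf.mean_eq x hx, zero_mul, sub_zero] at h
  exact h

/-- Used at the origin: it makes the formulas that assume g(0) = 0 available for almost every path.
-/
theorem IsCenteredGP.ae_eq_zero (hf : IsCenteredGP f D k μ) {x : ℝ} (hx : x ∈ D)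
    (hk : k x x = 0) : ∀ᵐ ω ∂μ, f x ω = 0 := by
  have h1 := hf.integral_mul hx hx
  rw [hk, integral_eq_zero_iff_of_nonneg (fun ω => mul_self_nonneg _) (hf.integrable_mul hx hx)]
    at h1
  filter_upwards [h1] with ω hω
  simpa using hω

theorem IsCenteredGP.integral_mul_res (hf : IsCenteredGP f D k μ) {x a b : ℝ} (l : ℝ) {y : ℝ}
    (hy : y ∈ D) (hx : x ∈ D) (ha : a ∈ D) (hb : b ∈ D) :
    ∫ ω, f y ω * res x a b l (fun z => f z ω) ∂μ = res x a b l (k y) := by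
  have i1 := hf.integrable_mul hy hx
  have i2 := (hf.integrable_mul hy ha).const_mul (1 - l)
  have i3 := (hf.integrable_mul hy hb).const_mul l
  have e : ∀ ω, f y ω * res x a b l (fun z => f z ω)
      = f y ω * f x ω - ((1 - l) * (f y ω * f a ω) + l * (f y ω * f b ω)) := fun ω => by
    simp only [res]; ring
  have e1 := integral_sub i1 (i2.add i3)
  simp only [Pi.add_apply] at e1
  simp only [e]
  rw [e1, integral_add i2 i3, integral_const_mul, integral_const_mul, hf.integral_mul hy hx,
    hf.integral_mul hy ha, hf.integral_mul hy hb, res]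

theorem IsCenteredGP.integral_res_mul_res (hf : IsCenteredGP f D k μ) {x a b x' a' b' : ℝ} (l l' : ℝ)
    (hx : x ∈ D) (ha : a ∈ D) (hb : b ∈ D) (hx' : x' ∈ D) (ha' : a' ∈ D) (hb' : b' ∈ D) :
    ∫ ω, res x a b l (fun z => f z ω) * res x' a' b' l' (fun z => f z ω) ∂μ
      = res x a b l (fun y => res x' a' b' l' (k y)) := by
  have hR := hf.memLp_res l' hx' ha' hb'
  have i1 := (hf.memLp hx).integrable_mul hR
  have i2 := ((hf.memLp ha).integrable_mul hR).const_mul (1 - l)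
  have i3 := ((hf.memLp hb).integrable_mul hR).const_mul l
  have e : ∀ ω, res x a b l (fun z => f z ω) * res x' a' b' l' (fun z => f z ω)
      = f x ω * res x' a' b' l' (fun z => f z ω)
        - ((1 - l) * (f a ω * res x' a' b' l' (fun z => f z ω))
          + l * (f b ω * res x' a' b' l' (fun z => f z ω))) := fun ω => by
    generalize res x' a' b' l' (fun z => f z ω) = r
    simp only [res]; ring
  have e1 := integral_sub i1 (i2.add i3)
  simp only [Pi.add_apply, Pi.mul_apply] at e1
  have e2 := integral_add i2 i3
  simp only [Pi.mul_apply] at e2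
  simp only [e]
  rw [e1, e2, integral_const_mul, integral_const_mul,
    hf.integral_mul_res l' hx hx' ha' hb', hf.integral_mul_res l' ha hx' ha' hb',
    hf.integral_mul_res l' hb hx' ha' hb']
  rfl

theorem cell_mem_Icc {h T : ℝ} (hh : 0 < h) {N : ℕ} (hT : T = N * h) {x : ℝ} (hx : x ∈ Ico 0 T) :
    x ∈ Icc 0 T ∧ h * (⌊x / h⌋ : ℝ) ∈ Icc 0 T ∧ h * (⌊x / h⌋ : ℝ) + h ∈ Icc 0 T := by
  have h1 := cell_nonneg hh hx.1
  have h2 := cell_le hh x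
  have h3 := cell_add_le hh hT hx.2
  exact ⟨⟨hx.1, hx.2.le⟩, ⟨h1, by linarith [hx.2]⟩, ⟨by linarith, h3⟩⟩

theorem IsCenteredGP.integral_resid_mul_resid {T h : ℝ} (hf : IsCenteredGP f (Icc 0 T) k μ)
    (hh : 0 < h) {N : ℕ} (hT : T = N * h) {x x' : ℝ} (hx : x ∈ Ico 0 T) (hx' : x' ∈ Ico 0 T) :
    Integrable (fun ω => resid h (fun z => f z ω) x * resid h (fun z => f z ω) x') μ ∧
      ∫ ω, resid h (fun z => f z ω) x * resid h (fun z => f z ω) x' ∂μ = resid2 h k x x' := by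
  obtain ⟨h1, h2, h3⟩ := cell_mem_Icc hh hT hx
  obtain ⟨h1', h2', h3'⟩ := cell_mem_Icc hh hT hx'
  exact ⟨hf.integrable_res_mul_res _ _ h1 h2 h3 h1' h2' h3',
    hf.integral_res_mul_res _ _ h1 h2 h3 h1' h2' h3'⟩

end CenteredGP

/-- The diagonal of the two-dimensional interpolation error of the kernel is bounded. -/
theorem exists_resid2_trueKernel_le (s : Fin 2) {H : ℝ} (hH0 : 0 < H) (hH1 : H < 1) {h : ℝ}
    (hh : 0 < h) : ∃ B, ∀ x, 0 ≤ x → |resid2 h (trueKernel s H) x x| ≤ B := by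
  obtain ⟨h1, h5⟩ := specExp_mem s hH0 hH1
  have im := (integrableOn_bound_sq 2 (2 + h ^ 2) h1 (by push_cast; linarith)).const_mul 2
  refine ⟨|specConst H| * ∫ ξ in Ioi 0, 2 * (((2 + h ^ 2) * min 1 (ξ ^ 2)) ^ 2
    * |ξ ^ (-specExp s H)|), fun x hx => ?_⟩
  rw [resid2_trueKernel s hH0 hH1 hh hx hx, abs_mul]
  gcongr
  rw [← Real.norm_eq_abs]
  refine norm_integral_le_of_norm_le im ?_
  filter_upwards [ae_restrict_mem measurableSet_Ioi] with ξ (hξ : 0 < ξ)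
  have hG : 0 ≤ (2 + h ^ 2) * min 1 (ξ ^ 2) := by positivity
  have hb : |resid h (fun y => Real.cos (ξ * y)) x| ≤ (2 + h ^ 2) * min 1 (ξ ^ 2) ∧
        |resid h (fun y => Real.sin (ξ * y)) x| ≤ (2 + h ^ 2) * min 1 (ξ ^ 2) := by
    obtain ⟨a1, a2, a3, a4⟩ := abs_resid_trig_le hh ξ x
    rcases le_total ξ 1 with h' | h'
    · rw [min_eq_right (pow_le_one₀ hξ.le h')]
      constructor <;> nlinarith [sq_nonneg ξ]
    · rw [min_eq_left (one_le_pow₀ h')]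
      constructor <;> nlinarith
  rw [norm_mul, Real.norm_eq_abs, Real.norm_eq_abs, ← mul_assoc]
  gcongr
  rw [← sq, ← sq, abs_of_nonneg (by positivity)]
  have := sq_le_sq' (abs_le.1 hb.1).1 (abs_le.1 hb.1).2
  have := sq_le_sq' (abs_le.1 hb.2).1 (abs_le.1 hb.2).2
  linarith

/-! ### Expected squared error and posterior variance as energies -/

theorem fbmKernel_zero_zero {H : ℝ} (hH0 : 0 < H) : fbmKernel H 0 0 = 0 := by
  simp [fbmKernel, Real.zero_rpow (by positivity : 2 * H ≠ 0)]

theorem trueKernel_zero_zero (s : Fin 2) {H : ℝ} (hH0 : 0 < H) : trueKernel s H 0 0 = 0 := by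
  fin_cases s
  · exact fbmKernel_zero_zero hH0
  · simp [trueKernel, ifbmKernel]

theorem memLp_two_of_sections {Ω : Type*} [MeasurableSpace Ω] {μ : Measure Ω} [SFinite μ]
    {P : Measure ℝ} [IsFiniteMeasure P] {R : ℝ × Ω → ℝ}
    (hR : AEStronglyMeasurable R (P.prod μ)) {B : ℝ}
    (h : ∀ᵐ x ∂P, Integrable (fun ω => R (x, ω) ^ 2) μ ∧ ∫ ω, R (x, ω) ^ 2 ∂μ ≤ B) :
    MemLp R 2 (P.prod μ) := by
  rw [memLp_two_iff_integrable_sq hR]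
  have hR2 : AEStronglyMeasurable (fun q => R q ^ 2) (P.prod μ) := hR.pow 2
  refine (integrable_prod_iff hR2).2 ⟨h.mono fun x hx => hx.1, ?_⟩
  refine Integrable.of_bound hR2.norm.integral_prod_right' B (h.mono fun x hx => ?_)
  have e : ∀ ω, ‖R (x, ω) ^ 2‖ = R (x, ω) ^ 2 := fun ω =>
    (Real.norm_eq_abs _).trans (abs_of_nonneg (sq_nonneg (R (x, ω))))
  simp only [e]
  rw [Real.norm_eq_abs, abs_of_nonneg (integral_nonneg fun ω => sq_nonneg (R (x, ω)))]
  exact hx.2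

theorem integral_sq_integral {Ω : Type*} [MeasurableSpace Ω] {μ : Measure Ω}
    [IsProbabilityMeasure μ] {P : Measure ℝ} [IsProbabilityMeasure P] {R : ℝ × Ω → ℝ}
    (hR : MemLp R 2 (P.prod μ)) :
    ∫ ω, (∫ x, R (x, ω) ∂P) ^ 2 ∂μ = ∫ x, ∫ x', (∫ ω, R (x, ω) * R (x', ω) ∂μ) ∂P ∂P := by
  have m1 : MeasurePreserving (fun q : (ℝ × ℝ) × Ω => (q.1.1, q.2)) ((P.prod P).prod μ) (P.prod μ) :=
    measurePreserving_fst.prod (MeasurePreserving.id μ)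
  have m2 : MeasurePreserving (fun q : (ℝ × ℝ) × Ω => (q.1.2, q.2)) ((P.prod P).prod μ) (P.prod μ) :=
    measurePreserving_snd.prod (MeasurePreserving.id μ)
  have i : Integrable (Function.uncurry fun (q : ℝ × ℝ) ω => R (q.1, ω) * R (q.2, ω))
      ((P.prod P).prod μ) :=
    (hR.comp_measurePreserving m1).integrable_mul (hR.comp_measurePreserving m2)
  rw [← integral_prod (fun q : ℝ × ℝ => ∫ ω, R (q.1, ω) * R (q.2, ω) ∂μ) i.integral_prod_left,
    integral_integral_swap i]
  refine integral_congr_ae (ae_of_all _ fun ω => ?_)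
  simp only
  rw [integral_prod_mul (fun x => R (x, ω)) (fun x => R (x, ω)), sq]

theorem integrable_postMean {P : Measure ℝ} [IsFiniteMeasure P] {T : ℝ} (hP : ∀ᵐ x ∂P, x ∈ Ico 0 T)
    {ι : Type*} [Fintype ι] [DecidableEq ι] (X y : ι → ℝ) (hX : ∀ i, 0 ≤ X i) :
    Integrable (fun x => postMean bmKernel X y x) P := by
  simp only [postMean, dotProduct]
  refine integrable_finsetSum _ fun i _ => Integrable.mul_const ?_ _
  refine Integrable.of_bound (by unfold bmKernel; fun_prop) T ?_
  filter_upwards [hP] with x hx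
  rw [Real.norm_eq_abs, bmKernel, abs_of_nonneg (le_min hx.1 (hX i))]
  exact (min_le_left _ _).trans hx.2.le

/-- The error process R is the residual of the path off the null event f(0) ≠ 0. Its uniformly
bounded variance puts it in L² of the product, so the square of its integral may be expanded and the
expectation exchanged. The half-open interval is used because every cell must have its right node at
most T. -/
theorem expSqError_eq {Ω : Type*} [MeasurableSpace Ω] {μ : Measure Ω} [IsProbabilityMeasure μ]
    {f : ℝ → Ω → ℝ} {s : Fin 2} {H T h : ℝ} (hH0 : 0 < H) (hH1 : H < 1)
    (hf : IsCenteredGP f (Icc 0 T) (trueKernel s H) μ) {P : Measure ℝ} [IsProbabilityMeasure P]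
    (hfm : AEStronglyMeasurable (fun q : ℝ × Ω => f q.1 q.2) (P.prod μ))
    (hP : ∀ᵐ x ∂P, x ∈ Ico 0 T) {N : ℕ} (hN : 0 < N) (hh : 0 < h) (hT : T = N * h) :
    expSqError μ f P (gridPts N h) = ∫ x, ∫ x', resid2 h (trueKernel s H) x x' ∂P ∂P := by
  have hT0 : 0 ≤ T := by rw [hT]; positivity
  have hX : ∀ i, 0 ≤ gridPts N h i := fun i => by unfold gridPts; positivity
  have hXm : ∀ i, gridPts N h i ∈ Icc 0 T := fun i => ⟨hX i, by
    rw [hT, gridPts]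
    have : ((i : ℕ) : ℝ) + 1 ≤ N := by exact_mod_cast i.2
    gcongr⟩
  have hf0 := hf.ae_eq_zero (left_mem_Icc.2 hT0) (trueKernel_zero_zero s hH0)
  set R : ℝ × Ω → ℝ := fun q => f q.1 q.2
    - postMean bmKernel (gridPts N h) (fun i => f (gridPts N h i) q.2) q.1 with hRdef
  have hRm : AEStronglyMeasurable R (P.prod μ) := by
    refine hfm.sub ?_
    simp only [postMean, dotProduct, Matrix.mulVec]
    refine Finset.aestronglyMeasurable_fun_sum _ fun i _ => AEStronglyMeasurable.mul ?_ ?_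
    · have : Measurable fun q : ℝ × Ω => bmKernel q.1 (gridPts N h i) := by
        unfold bmKernel; fun_prop
      exact this.aestronglyMeasurable
    · refine Finset.aestronglyMeasurable_fun_sum _ fun j _ => AEStronglyMeasurable.const_mul ?_ _
      exact (hf.memLp (hXm j)).1.comp_snd
  have hRr : ∀ x ∈ Ico 0 T, ∀ᵐ ω ∂μ, R (x, ω) = resid h (fun z => f z ω) x := fun x hx => by
    filter_upwards [hf0] with ω hω
    simp only [hRdef]
    rw [postMean_grid hh hx.1 (hT ▸ hx.2) (g := fun z => f z ω) hω]; ring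
  obtain ⟨B, hB⟩ := exists_resid2_trueKernel_le s hH0 hH1 hh
  have hR2 : MemLp R 2 (P.prod μ) := by
    refine memLp_two_of_sections hRm (B := B) ?_
    filter_upwards [hP] with x hx
    obtain ⟨i1, i2⟩ := hf.integral_resid_mul_resid hh hT hx hx
    have e : (fun ω => resid h (fun z => f z ω) x * resid h (fun z => f z ω) x)
        =ᵐ[μ] fun ω => R (x, ω) ^ 2 := by
      filter_upwards [hRr x hx] with ω hω
      rw [hω, sq]
    refine ⟨i1.congr e, ?_⟩
    rw [← integral_congr_ae e, i2]
    exact (le_abs_self _).trans (hB x hx.1)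
  have hRi : Integrable R (P.prod μ) := hR2.integrable one_le_two
  have e1 : expSqError μ f P (gridPts N h) = ∫ ω, (∫ x, R (x, ω) ∂P) ^ 2 ∂μ := by
    refine integral_congr_ae ?_
    -- Path integrability is not assumed: it follows from that of R(·, ω) and of the posterior mean,
    -- and allows I - I_BQ to be written as one integral.
    filter_upwards [hRi.prod_left_ae] with ω hω
    have ip := integrable_postMean hP (gridPts N h) (fun i => f (gridPts N h i) ω) hX
    have ifx : Integrable (fun x => f x ω) P := by
      refine (hω.add ip).congr (ae_of_all _ fun x => ?_)
      simp [hRdef]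
    rw [bqMean, ← integral_sub ifx ip]
  rw [e1, integral_sq_integral hR2]
  refine integral_congr_ae ?_
  filter_upwards [hP] with x hx
  refine integral_congr_ae ?_
  filter_upwards [hP] with x' hx'
  rw [← (hf.integral_resid_mul_resid hh hT hx hx').2]
  refine integral_congr_ae ?_
  filter_upwards [hRr x hx, hRr x' hx'] with ω h1 h2
  rw [h1, h2]

theorem fbmKernel_half {x x' : ℝ} (hx : 0 ≤ x) (hx' : 0 ≤ x') :
    fbmKernel (1 / 2) x x' = bmKernel x x' := by
  have e : fbmKernel (1 / 2) x x' = (x + x' - |x - x'|) / 2 := by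
    simp [fbmKernel, abs_of_nonneg hx, abs_of_nonneg hx']
  rw [e, bmKernel]
  rcases le_total x x' with h | h
  · rw [min_eq_left h, abs_of_nonpos (by linarith)]; ring
  · rw [min_eq_right h, abs_of_nonneg (by linarith)]; ring

/-- On the half line `bmKernel` is the fractional kernel with H = 1/2, and all arguments of the
residuals are nonnegative. -/
theorem bqVar_eq {T h : ℝ} {P : Measure ℝ} [IsFiniteMeasure P] (hP : ∀ᵐ x ∂P, x ∈ Ico 0 T) {N : ℕ}
    (hh : 0 < h) (hT : T = N * h) :
    bqVar P (gridPts N h) = specConst (1 / 2) * energy P h 2 := by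
  have h1 := integral_resid2_trueKernel P 0 (H := 1 / 2) (by norm_num) (by norm_num) hh
    (hP.mono fun x hx => hx.1)
  have h2 : specExp 0 (1 / 2) = 2 := by norm_num [specExp]
  rw [h2] at h1
  rw [← h1, bqVar]
  refine integral_congr_ae ?_
  filter_upwards [hP] with x hx
  refine integral_congr_ae ?_
  filter_upwards [hP] with x' hx'
  rw [postCov_grid hh hx.1 (hT ▸ hx.2) hx'.1]
  have a := cell_nonneg hh hx.1
  have a' := cell_nonneg hh hx'.1
  have key : ∀ y, 0 ≤ y → resid h (bmKernel y) x' = resid h (fbmKernel (1 / 2) y) x' := fun y hy =>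
    (res_congr (fbmKernel_half hy hx'.1) (fbmKernel_half hy a')
      (fbmKernel_half hy (by linarith))).symm
  exact res_congr (g := fun y => resid h (bmKernel y) x')
    (g' := fun y => resid h (fbmKernel (1 / 2) y) x') (key _ hx.1) (key _ a) (key _ (by linarith))

end BQCalibration

namespace BQCalibration
open Set Filter Topology

/-! ### Second differences and increments of the kernels -/

/-- The variance of the second difference at unit spacing. -/
noncomputable def secondDiffConst (s : Fin 2) (H : ℝ) : ℝ :=
  specConst H * ∫ ξ in Ioi (0 : ℝ), (1 - Real.cos ξ) ^ 2 * ξ ^ (-specExp s H)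

theorem secondDiffConst_pos (s : Fin 2) {H : ℝ} (hH0 : 0 < H) (hH1 : H < 1) :
    0 < secondDiffConst s H := by
  obtain ⟨h1, h5⟩ := specExp_mem s hH0 hH1
  refine mul_pos (specConst_pos hH0 hH1) (setIntegral_Ioi_pos ?_ ?_ ?_)
  · refine Integrable.mono' (integrableOn_bound_sq 2 2 h1 (by push_cast; linarith)) (by fun_prop) ?_
    filter_upwards [ae_restrict_mem measurableSet_Ioi] with ξ (hξ : 0 < ξ)
    rw [norm_mul, Real.norm_eq_abs, Real.norm_eq_abs, abs_of_nonneg (sq_nonneg _)]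
    have h0 : 0 ≤ 1 - Real.cos ξ := by linarith [Real.cos_le_one ξ]
    have h2 := Real.one_sub_sq_div_two_le_cos (x := ξ)
    have h3 := Real.neg_one_le_cos ξ
    gcongr
    rcases le_total ξ 1 with h | h
    · rw [min_eq_right (pow_le_one₀ hξ.le h)]; nlinarith [sq_nonneg ξ]
    · rw [min_eq_left (one_le_pow₀ h)]; linarith
  · intro ξ hξ
    exact mul_nonneg (sq_nonneg _) (Real.rpow_nonneg hξ.le _)
  · intro ξ hξ h
    have := cos_lt_one_of_mem hξ h
    exact mul_pos (pow_pos (by linarith) 2) (Real.rpow_pos_of_pos hξ _)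

/-- The squared modulus of the second difference of exp(iξ·) is (1 - cos ξh)², independently of `a`;
scaling then extracts the power of h. -/
theorem res_res_secondDiff (s : Fin 2) {H : ℝ} (hH0 : 0 < H) (hH1 : H < 1) {a h : ℝ} (hh : 0 < h)
    (ha : 0 ≤ a) :
    res (a + h) a (a + 2 * h) (1 / 2)
        (fun y => res (a + h) a (a + 2 * h) (1 / 2) (trueKernel s H y))
      = secondDiffConst s H * h ^ (specExp s H - 1) := by
  rw [res_res_trueKernel s hH0 hH1 (by linarith) ha (by linarith) (by linarith) ha (by linarith)
    (by ring) (by ring), secondDiffConst, mul_assoc, mul_comm (∫ ξ in Ioi 0, _) (h ^ _),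
    ← integral_comp_mul_rpow (fun u => (1 - Real.cos u) ^ 2) hh]
  congr 1
  refine setIntegral_congr_fun measurableSet_Ioi fun ξ _ => ?_
  congr 1
  have e1 : ξ * a = ξ * (a + h) - ξ * h := by ring
  have e2 : ξ * (a + 2 * h) = ξ * (a + h) + ξ * h := by ring
  simp only [res]
  rw [e1, e2, Real.cos_sub, Real.cos_add, Real.sin_sub, Real.sin_add]
  have := Real.sin_sq_add_cos_sq (ξ * (a + h))
  linear_combination (1 - Real.cos (ξ * h)) ^ 2 * this

/-- The variance of an increment. -/
def incrVar (k : ℝ → ℝ → ℝ) (x a : ℝ) : ℝ := res x a a 0 fun y => res x a a 0 (k y)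

theorem incrVar_fbmKernel {H : ℝ} (hH0 : 0 < H) {x a : ℝ} (hxa : a ≤ x) :
    incrVar (fbmKernel H) x a = (x - a) ^ (2 * H) := by
  simp only [incrVar, res, fbmKernel, sub_self, abs_zero,
    Real.zero_rpow (by positivity : 2 * H ≠ 0), abs_sub_comm a x, abs_of_nonneg (sub_nonneg.2 hxa)]
  ring

theorem continuous_fbmKernel {H : ℝ} (hH0 : 0 < H) :
    Continuous (Function.uncurry (fbmKernel H)) := by
  have h : 0 ≤ 2 * H := by positivity
  simp only [Function.uncurry_def, fbmKernel]
  have c : ∀ g : ℝ × ℝ → ℝ, Continuous g → Continuous fun q => |g q| ^ (2 * H) := fun g hg =>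
    hg.abs.rpow_const fun _ => Or.inr h
  exact (((c _ continuous_fst).add (c _ continuous_snd)).sub
    (c _ (continuous_fst.sub continuous_snd))).div_const 2

/-- The larger of z^(2H) and z'^(2H) dominates |z - z'|^(2H), which leaves half the smaller one. -/
theorem fbmKernel_bounds {H : ℝ} (hH0 : 0 < H) {a T z z' : ℝ} (ha : 0 ≤ a) (hz : a ≤ z) (hzT : z ≤ T)
    (hz' : a ≤ z') (hzT' : z' ≤ T) :
    a ^ (2 * H) / 2 ≤ fbmKernel H z z' ∧ fbmKernel H z z' ≤ T ^ (2 * H) := by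
  have h : 0 ≤ 2 * H := by positivity
  have b1 := Real.rpow_le_rpow ha hz h
  have b2 := Real.rpow_le_rpow ha hz' h
  have b3 := Real.rpow_le_rpow (ha.trans hz) hzT h
  have b4 := Real.rpow_le_rpow (ha.trans hz') hzT' h
  have b5 : 0 ≤ |z - z'| ^ (2 * H) := by positivity
  simp only [fbmKernel, abs_of_nonneg (ha.trans hz), abs_of_nonneg (ha.trans hz')]
  refine ⟨?_, by linarith⟩
  rcases le_total z z' with hle | hle
  · have : |z - z'| ^ (2 * H) ≤ z' ^ (2 * H) := by
      rw [abs_sub_comm, abs_of_nonneg (by linarith)]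
      exact Real.rpow_le_rpow (by linarith) (by linarith) h
    linarith
  · have : |z - z'| ^ (2 * H) ≤ z ^ (2 * H) := by
      rw [abs_of_nonneg (by linarith)]
      exact Real.rpow_le_rpow (by linarith) (by linarith) h
    linarith

theorem incrVar_ifbmKernel {H : ℝ} (hH0 : 0 < H) (x a : ℝ) :
    incrVar (ifbmKernel H) x a = ∫ z in a..x, ∫ z' in a..x, fbmKernel H z z' := by
  have hc := continuous_fbmKernel hH0
  have ci : ∀ u v : ℝ, Continuous fun z => ∫ z' in u..v, fbmKernel H z z' := fun u v =>
    intervalIntegral.continuous_parametric_intervalIntegral_of_continuous' hc u v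
  have ii : ∀ z u v, IntervalIntegrable (fbmKernel H z) volume u v := fun z u v =>
    (hc.comp (by fun_prop : Continuous fun z' => (z, z'))).intervalIntegrable u v
  have e1 : ∀ y, ifbmKernel H y x - ifbmKernel H y a
      = ∫ z in (0 : ℝ)..y, ∫ z' in a..x, fbmKernel H z z' := fun y => by
    rw [ifbmKernel, ifbmKernel, ← intervalIntegral.integral_sub ((ci _ _).intervalIntegrable _ _)
      ((ci _ _).intervalIntegrable _ _)]
    refine intervalIntegral.integral_congr fun z _ => ?_
    exact intervalIntegral.integral_interval_sub_left (ii _ _ _) (ii _ _ _)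
  have e2 : incrVar (ifbmKernel H) x a = (ifbmKernel H x x - ifbmKernel H x a)
      - (ifbmKernel H a x - ifbmKernel H a a) := by
    simp only [incrVar, res]; ring
  rw [e2, e1, e1]
  exact intervalIntegral.integral_interval_sub_left ((ci _ _).intervalIntegrable _ _)
    ((ci _ _).intervalIntegrable _ _)

theorem incrVar_ifbmKernel_bounds {H : ℝ} (hH0 : 0 < H) {x a T : ℝ} (ha : 0 ≤ a) (hxa : a ≤ x)
    (hxT : x ≤ T) :
    a ^ (2 * H) / 2 * (x - a) ^ 2 ≤ incrVar (ifbmKernel H) x a ∧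
      incrVar (ifbmKernel H) x a ≤ T ^ (2 * H) * (x - a) ^ 2 := by
  have hc := continuous_fbmKernel hH0
  have ci : Continuous fun z => ∫ z' in a..x, fbmKernel H z z' :=
    intervalIntegral.continuous_parametric_intervalIntegral_of_continuous' hc a x
  have ii : ∀ z, IntervalIntegrable (fbmKernel H z) volume a x := fun z =>
    (hc.comp (by fun_prop : Continuous fun z' => (z, z'))).intervalIntegrable a x
  have hb : ∀ z ∈ Icc a x, ∀ z' ∈ Icc a x, _ := fun z hz z' hz' =>
    fbmKernel_bounds hH0 ha hz.1 (hz.2.trans hxT) hz'.1 (hz'.2.trans hxT)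
  rw [incrVar_ifbmKernel hH0]
  have inner : ∀ z ∈ Icc a x, a ^ (2 * H) / 2 * (x - a) ≤ ∫ z' in a..x, fbmKernel H z z' ∧
      ∫ z' in a..x, fbmKernel H z z' ≤ T ^ (2 * H) * (x - a) := fun z hz => by
    have i1 := intervalIntegral.integral_mono_on hxa (intervalIntegrable_const (μ := volume) (c := a ^ (2 * H) / 2))
      (ii z) fun z' hz' => (hb z hz z' hz').1
    have i2 := intervalIntegral.integral_mono_on hxa (ii z)
      (intervalIntegrable_const (μ := volume) (c := T ^ (2 * H))) fun z' hz' => (hb z hz z' hz').2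
    rw [intervalIntegral.integral_const, smul_eq_mul] at i1 i2
    constructor <;> linarith
  have o1 := intervalIntegral.integral_mono_on hxa
    (intervalIntegrable_const (μ := volume) (c := a ^ (2 * H) / 2 * (x - a)))
    (ci.intervalIntegrable a x) fun z hz => (inner z hz).1
  have o2 := intervalIntegral.integral_mono_on hxa (ci.intervalIntegrable a x)
    (intervalIntegrable_const (μ := volume) (c := T ^ (2 * H) * (x - a))) fun z hz => (inner z hz).2
  rw [intervalIntegral.integral_const, smul_eq_mul] at o1 o2
  constructor <;> nlinarith

theorem ifbmKernel_self_pos {H : ℝ} (hH0 : 0 < H) (hH1 : H < 1) {T : ℝ} (hT : 0 < T) :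
    0 < ifbmKernel H T T := by
  obtain ⟨i, e⟩ := ifbmKernel_spectral hH0 hH1 hT.le hT.le
  rw [e]
  have hA : ∀ ξ : ℝ, 0 < ξ → 0 < (specA 1 ξ T * specA 1 ξ T + specB 1 ξ T * specB 1 ξ T)
      * ξ ^ (-(1 + 2 * H)) := fun ξ hξ => by
    have h1 : 0 < specA 1 ξ T := by
      have := Real.sin_lt (mul_pos hξ hT)
      rw [specA, sub_pos, div_lt_iff₀ hξ]; linarith
    have := Real.rpow_pos_of_pos hξ (-(1 + 2 * H))
    have := mul_self_nonneg (specB 1 ξ T)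
    positivity
  exact mul_pos (specConst_pos hH0 hH1)
    (setIntegral_Ioi_pos i (fun ξ hξ => (hA ξ hξ).le) fun ξ hξ _ => hA ξ hξ)

/-! ### Expectations of the amplitude estimators -/

section Estimators

variable {Ω : Type*} [MeasurableSpace Ω] {μ : Measure Ω} [IsProbabilityMeasure μ] {f : ℝ → Ω → ℝ}
  {k : ℝ → ℝ → ℝ} {T h : ℝ}

theorem node_mem {N : ℕ} (hh : 0 < h) (hT : T = N * h) {n : ℕ} (hn : n ≤ N) :
    (n : ℝ) * h ∈ Icc 0 T := by
  have : (n : ℝ) ≤ N := by exact_mod_cast hn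
  refine ⟨by positivity, ?_⟩
  rw [hT]; gcongr

theorem integral_tauSqML (hf : IsCenteredGP f (Icc 0 T) k μ) (hk : k 0 0 = 0) {N : ℕ} (hN : 0 < N)
    (hh : 0 < h) (hT : T = N * h) :
    ∫ ω, tauSqML (gridPts N h) (fun i => f (gridPts N h i) ω) ∂μ
      = (∑ n : Fin N, incrVar k (((n : ℕ) + 1) * h) ((n : ℕ) * h) / h) / N := by
  have h0 := hf.ae_eq_zero (x := 0) (by simpa using node_mem hh hT (Nat.zero_le N)) hk
  have m1 : ∀ n : Fin N, (((n : ℕ) : ℝ) + 1) * h ∈ Icc 0 T := fun n => by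
    simpa using node_mem hh hT (n := n + 1) n.2
  have m0 : ∀ n : Fin N, ((n : ℕ) : ℝ) * h ∈ Icc 0 T := fun n => node_mem hh hT n.2.le
  have e : (fun ω => tauSqML (gridPts N h) (fun i => f (gridPts N h i) ω)) =ᵐ[μ] fun ω =>
      (∑ n : Fin N, (res (((n : ℕ) + 1) * h) ((n : ℕ) * h) ((n : ℕ) * h) 0 (fun z => f z ω)
        * res (((n : ℕ) + 1) * h) ((n : ℕ) * h) ((n : ℕ) * h) 0 (fun z => f z ω)) / h) / N := by
    filter_upwards [h0] with ω hω
    rw [tauSqML_grid hN hh (g := fun z => f z ω) hω]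
    congr 1
    refine Finset.sum_congr rfl fun n _ => ?_
    simp only [res]; ring
  have hi : ∀ n : Fin N, _ := fun n =>
    hf.integrable_res_mul_res 0 0 (m1 n) (m0 n) (m0 n) (m1 n) (m0 n) (m0 n)
  rw [integral_congr_ae e, integral_div, integral_finsetSum _ fun n _ => (hi n).div_const h]
  congr 1
  refine Finset.sum_congr rfl fun n _ => ?_
  rw [integral_div, hf.integral_res_mul_res 0 0 (m1 n) (m0 n) (m0 n) (m1 n) (m0 n) (m0 n)]
  rfl

/-- Cauchy–Schwarz applied to f(T) as the telescoping sum of its increments. This keeps the ML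
estimator from vanishing faster than h for the integrated process. -/
theorem le_sum_incrVar (hf : IsCenteredGP f (Icc 0 T) k μ) (hk : k 0 0 = 0) {N : ℕ}
    (hh : 0 < h) (hT : T = N * h) :
    k T T ≤ N * ∑ n : Fin N, incrVar k (((n : ℕ) + 1) * h) ((n : ℕ) * h) := by
  have h0 := hf.ae_eq_zero (x := 0) (by simpa using node_mem hh hT (Nat.zero_le N)) hk
  have m1 : ∀ n : Fin N, (((n : ℕ) : ℝ) + 1) * h ∈ Icc 0 T := fun n => by
    simpa using node_mem hh hT (n := n + 1) n.2
  have m0 : ∀ n : Fin N, ((n : ℕ) : ℝ) * h ∈ Icc 0 T := fun n => node_mem hh hT n.2.le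
  have mT : T ∈ Icc 0 T := by
    have := node_mem hh hT le_rfl
    rwa [← hT] at this
  have hi : ∀ n : Fin N, _ := fun n =>
    hf.integrable_res_mul_res 0 0 (m1 n) (m0 n) (m0 n) (m1 n) (m0 n) (m0 n)
  have e : ∀ n : Fin N, incrVar k (((n : ℕ) + 1) * h) ((n : ℕ) * h) = _ := fun n =>
    (hf.integral_res_mul_res 0 0 (m1 n) (m0 n) (m0 n) (m1 n) (m0 n) (m0 n)).symm
  rw [← hf.integral_mul mT mT, Finset.sum_congr rfl fun n _ => e n,
    ← integral_finsetSum _ fun n _ => hi n, ← integral_const_mul]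
  refine integral_mono_ae (hf.integrable_mul mT mT)
    ((integrable_finsetSum _ fun n _ => hi n).const_mul _) ?_
  filter_upwards [h0] with ω hω
  have tel : ∑ n : Fin N, res (((n : ℕ) + 1) * h) ((n : ℕ) * h) ((n : ℕ) * h) 0 (fun z => f z ω)
      = f T ω := by
    have := Finset.sum_range_sub (fun l : ℕ => f (l * h) ω) N
    rw [← Fin.sum_univ_eq_sum_range (fun l : ℕ => f ((l + 1 : ℕ) * h) ω - f (l * h) ω) N] at this
    simp only [Nat.cast_zero, zero_mul, hω, sub_zero, ← hT] at this
    rw [← this]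
    refine Finset.sum_congr rfl fun n _ => ?_
    simp [res]
  have cs := sq_sum_le_card_mul_sum_sq (s := (Finset.univ : Finset (Fin N)))
    (f := fun n => res (((n : ℕ) + 1) * h) ((n : ℕ) * h) ((n : ℕ) * h) 0 (fun z => f z ω))
  rw [tel, Finset.card_univ, Fintype.card_fin] at cs
  simpa [sq] using cs

/-- The first M points have leave-one-out variance h/2, hence the factor 2/h on squared second
differences. The last one has variance h and contributes a plain increment. -/
theorem integral_tauSqCV (hf : IsCenteredGP f (Icc 0 T) k μ) (hk : k 0 0 = 0) {M : ℕ}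
    (hh : 0 < h) (hT : T = (M + 1 : ℕ) * h) {v : ℝ}
    (hv : ∀ a, 0 ≤ a → res (a + h) a (a + 2 * h) (1 / 2)
      (fun y => res (a + h) a (a + 2 * h) (1 / 2) (k y)) = v) :
    ∫ ω, tauSqCV (gridPts (M + 1) h) (fun i => f (gridPts (M + 1) h i) ω) ∂μ
      = (M * (2 * v / h) + incrVar k T (T - h) / h) / (M + 1) := by
  have h0 := hf.ae_eq_zero (x := 0) (by simpa using node_mem hh hT (Nat.zero_le _)) hk
  have m : ∀ n : ℕ, n ≤ M + 1 → (n : ℝ) * h ∈ Icc 0 T := fun n hn => node_mem hh hT hn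
  have m0 : ∀ n : Fin M, ((n : ℕ) : ℝ) * h ∈ Icc 0 T := fun n => m n (by omega)
  have m1 : ∀ n : Fin M, ((n : ℕ) : ℝ) * h + h ∈ Icc 0 T := fun n => by
    have := m (n + 1) (by omega)
    push_cast at this
    rwa [add_one_mul] at this
  have m2 : ∀ n : Fin M, ((n : ℕ) : ℝ) * h + 2 * h ∈ Icc 0 T := fun n => by
    have := m (n + 2) (by omega)
    push_cast at this
    rwa [add_mul] at this
  have mT : T ∈ Icc 0 T := by
    have := m (M + 1) le_rfl
    rwa [← hT] at this
  have eTh : T - h = M * h := by rw [hT]; push_cast; ring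
  have mTh : T - h ∈ Icc 0 T := by rw [eTh]; exact m M (by omega)
  have e : (fun ω => tauSqCV (gridPts (M + 1) h) (fun i => f (gridPts (M + 1) h i) ω)) =ᵐ[μ] fun ω =>
      (∑ n : Fin M, (res ((n : ℕ) * h + h) ((n : ℕ) * h) ((n : ℕ) * h + 2 * h) (1 / 2)
          (fun z => f z ω) * res ((n : ℕ) * h + h) ((n : ℕ) * h) ((n : ℕ) * h + 2 * h) (1 / 2)
          (fun z => f z ω)) * (2 / h)
        + (res T (T - h) (T - h) 0 (fun z => f z ω) * res T (T - h) (T - h) 0 (fun z => f z ω)) / h)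
        / (M + 1) := by
    filter_upwards [h0] with ω hω
    rw [tauSqCV_grid (Nat.succ_pos M) hh (g := fun z => f z ω) hω, Fin.sum_univ_castSucc]
    push_cast
    congr 2
    · refine Finset.sum_congr rfl fun n _ => ?_
      have hw : looWeight n.castSucc = 1 / 2 := by simp [looWeight]
      rw [hw, Fin.val_castSucc, add_mul _ 1, one_mul, add_mul _ 2, sq]
      field_simp
      norm_num
    · have hw : looWeight (Fin.last M) = 0 := by simp [looWeight]
      rw [hw, hT]
      push_cast
      simp only [res, sub_zero, one_mul, zero_mul, add_zero, sq]
      have e1 : ((M : ℝ) + 1) * h - h = M * h := by ring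
      rw [e1]
  have hi : ∀ n : Fin M, _ := fun n => (hf.integrable_res_mul_res (1 / 2) (1 / 2)
    (m1 n) (m0 n) (m2 n) (m1 n) (m0 n) (m2 n)).mul_const (2 / h)
  have hj := (hf.integrable_res_mul_res 0 0 mT mTh mTh mT mTh mTh).div_const h
  have e2 := integral_add (integrable_finsetSum (Finset.univ : Finset (Fin M)) fun n _ => hi n) hj
  rw [integral_congr_ae e, integral_div, e2, integral_finsetSum _ fun n _ => hi n, integral_div,
    hf.integral_res_mul_res 0 0 mT mTh mTh mT mTh mTh]
  congr 2
  have e3 : ∀ n : Fin M, ∫ ω, res ((n : ℕ) * h + h) ((n : ℕ) * h) ((n : ℕ) * h + 2 * h) (1 / 2)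
          (fun z => f z ω) * res ((n : ℕ) * h + h) ((n : ℕ) * h) ((n : ℕ) * h + 2 * h) (1 / 2)
          (fun z => f z ω) * (2 / h) ∂μ = 2 * v / h := fun n => by
    rw [integral_mul_const, hf.integral_res_mul_res _ _ (m1 n) (m0 n) (m2 n) (m1 n) (m0 n) (m2 n),
      hv _ (m0 n).1]
    ring
  simp only [e3]
  simp

end Estimators

end BQCalibration

namespace BQCalibration
open Set Filter Topology Asymptotics

/-! ### Asymptotics along uniform partitions -/

theorem isTheta_of_bounds {F : ℕ → ℝ} {T e c C : ℝ} (hT : 0 < T) (hc : 0 < c)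
    (hlo : ∀ᶠ N : ℕ in atTop, c * (T / N) ^ e ≤ F N)
    (hhi : ∀ᶠ N : ℕ in atTop, F N ≤ C * (T / N) ^ e) :
    F =Θ[atTop] fun N : ℕ => (T / (N : ℝ)) ^ e := by
  have hp : ∀ N : ℕ, 0 ≤ (T / (N : ℝ)) ^ e := fun N => by positivity
  refine ⟨IsBigO.of_bound C ?_, IsBigO.of_bound c⁻¹ ?_⟩
  · filter_upwards [hlo, hhi] with N h1 h2
    have : 0 ≤ F N := (mul_nonneg hc.le (hp N)).trans h1
    rwa [Real.norm_of_nonneg this, Real.norm_of_nonneg (hp N)]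
  · filter_upwards [hlo] with N h1
    have : 0 ≤ F N := (mul_nonneg hc.le (hp N)).trans h1
    rw [Real.norm_of_nonneg this, Real.norm_of_nonneg (hp N), inv_mul_eq_div, le_div_iff₀ hc]
    linarith

theorem isTheta_mesh_rpow {T : ℝ} (hT : 0 < T) (e : ℝ) :
    (fun N : ℕ => (T / (N : ℝ)) ^ e) =Θ[atTop] fun N : ℕ => (N : ℝ) ^ (-e) := by
  have : (fun N : ℕ => (T / (N : ℝ)) ^ e) = fun N : ℕ => T ^ e * (N : ℝ) ^ (-e) := by
    funext N
    rw [Real.div_rpow hT.le (Nat.cast_nonneg N), Real.rpow_neg (Nat.cast_nonneg N), div_eq_mul_inv]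
  rw [this]
  exact (isTheta_refl _ _).const_mul_left (Real.rpow_pos_of_pos hT e).ne'

theorem isTheta_ratio {T : ℝ} (hT : 0 < T) {F G V : ℕ → ℝ} {e₁ e₂ e : ℝ}
    (hF : F =Θ[atTop] fun N : ℕ => (T / (N : ℝ)) ^ e₁)
    (hG : G =Θ[atTop] fun N : ℕ => (T / (N : ℝ)) ^ e₂)
    (hV : V =Θ[atTop] fun N : ℕ => (T / (N : ℝ)) ^ (2 : ℝ)) (he : e₁ - (e₂ + 2) = e) :
    (fun N => F N / (G N * V N)) =Θ[atTop] fun N : ℕ => (N : ℝ) ^ (-e) := by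
  refine ((hF.div (hG.mul hV)).trans_eventuallyEq ?_).trans (isTheta_mesh_rpow hT e)
  filter_upwards [eventually_ge_atTop 1] with N hN
  have h : 0 < T / (N : ℝ) := div_pos hT (by exact_mod_cast hN)
  rw [← Real.rpow_add h, ← Real.rpow_sub h, he]

/-- A supremum equal to 1 forces the longest gap to be at most the shortest one. -/
theorem uniform_points {T : ℝ} {x : ℕ → ℕ → ℝ} (hx : IsPartitionSeq T x) (hxu : IsUniform x) {N : ℕ}
    (hN : 1 ≤ N) : points x N = gridPts N (T / N) := by
  have hNe : Nonempty (Fin N) := ⟨⟨0, hN⟩⟩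
  have hbdd : BddAbove (range fun n : Fin N => x N (n + 1) - x N n) := (finite_range _).bddAbove
  have hbdd' : BddBelow (range fun n : Fin N => x N (n + 1) - x N n) := (finite_range _).bddBelow
  have hmin : 0 < minGap x N := by
    obtain ⟨n, hn⟩ := exists_eq_ciInf_of_finite (f := fun n : Fin N => x N (n + 1) - x N n)
    rw [minGap, ← hn]
    exact sub_pos.2 (hx.lt N hN n n.2)
  have hle : maxGap x N ≤ minGap x N := by
    have := hxu.2.1 ⟨N, hN, rfl⟩
    rwa [div_le_one hmin] at this
  have hgap : ∀ n, n < N → x N (n + 1) - x N n = minGap x N := fun n hn =>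
    le_antisymm ((le_ciSup hbdd ⟨n, hn⟩).trans hle) (ciInf_le hbdd' ⟨n, hn⟩)
  have hpt : ∀ n, n ≤ N → x N n = n * minGap x N := by
    intro n
    induction n with
    | zero => intro _; simp [hx.left N hN]
    | succ m ih =>
      intro hm
      have h1 := hgap m hm
      have h2 := ih (by omega)
      push_cast
      linarith
  have hN0 : (N : ℝ) ≠ 0 := by positivity
  have hTN : T / N = minGap x N := by
    rw [← hx.right N hN, hpt N le_rfl]; field_simp
  funext n
  rw [hTN, points, hpt _ n.2, gridPts]
  push_cast
  rfl

theorem isTheta_energy_of_le_four {P : Measure ℝ} [IsProbabilityMeasure P] {C T : ℝ} (hC : 0 ≤ C)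
    (hPC : P ≤ ENNReal.ofReal C • volume) (hT : 0 < T) (hP : ∀ᵐ x ∂P, x ∈ Ico 0 T) {α : ℝ}
    (h1 : 1 < α) (h4 : α ≤ 4) :
    (fun N : ℕ => energy P (T / N) α) =Θ[atTop] fun N : ℕ => (T / (N : ℝ)) ^ α := by
  obtain ⟨K, hK⟩ := energy_le_of_le_four hC hPC (hP.mono fun x hx => hx.1) h1 h4
  have hac : P ≪ volume :=
    (Measure.absolutelyContinuous_of_le hPC).trans Measure.smul_absolutelyContinuous
  obtain ⟨c, hc, hlo⟩ := energy_ge hac hT hP h1 (by linarith)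
  refine isTheta_of_bounds hT hc (C := K) hlo ?_
  filter_upwards [eventually_ge_atTop 1] with N hN
  exact hK _ (div_pos hT (by exact_mod_cast hN))

theorem isTheta_energy_of_four_le {P : Measure ℝ} [IsProbabilityMeasure P] {c C T : ℝ} (hc : 0 < c)
    (hC : 0 ≤ C) (hPC : P ≤ ENNReal.ofReal C • volume)
    (hPc : ENNReal.ofReal c • volume.restrict (Icc 0 T) ≤ P) (hT : 0 < T)
    (hP : ∀ᵐ x ∂P, x ∈ Ico 0 T) {α : ℝ} (h4 : 4 ≤ α) (h5 : α < 5) :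
    (fun N : ℕ => energy P (T / N) α) =Θ[atTop] fun N : ℕ => (T / (N : ℝ)) ^ (4 : ℝ) := by
  obtain ⟨K, hK⟩ := energy_le_of_four_le hC hPC (hP.mono fun x hx => hx.1) h4 h5
  obtain ⟨k, hk, hlo⟩ := energy_ge_pow_four hT hc hP hPc (α := α) (by linarith) h5
  have e : ∀ N : ℕ, (T / (N : ℝ)) ^ (4 : ℝ) = (T / (N : ℝ)) ^ 4 := fun N => by norm_cast
  refine isTheta_of_bounds (c := k) (C := K) hT hk ?_ ?_
  · filter_upwards [eventually_ge_atTop 1] with N hN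
    rw [e]; exact hlo N hN
  · filter_upwards [eventually_ge_atTop 1] with N hN
    rw [e]; exact hK _ (div_pos hT (by exact_mod_cast hN))

section Estimators

variable {Ω : Type*} [MeasurableSpace Ω] {μ : Measure Ω} [IsProbabilityMeasure μ] {f : ℝ → Ω → ℝ}
  {T H : ℝ}

theorem mesh_eq {T : ℝ} {N : ℕ} (hN : 1 ≤ N) : T = N * (T / N) := by
  have : (N : ℝ) ≠ 0 := by positivity
  field_simp

theorem mesh_pos (hT : 0 < T) {N : ℕ} (hN : 1 ≤ N) : 0 < T / (N : ℝ) :=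
  div_pos hT (by exact_mod_cast hN)

theorem mesh_le (hT : 0 < T) {N : ℕ} (hN : 1 ≤ N) : T / (N : ℝ) ≤ T :=
  div_le_self hT.le (by exact_mod_cast hN)

theorem integral_tauSqCV_trueKernel {s : Fin 2} (hH0 : 0 < H) (hH1 : H < 1) (hT : 0 < T)
    (hf : IsCenteredGP f (Icc 0 T) (trueKernel s H) μ) {N : ℕ} (hN : 1 ≤ N) :
    ∫ ω, tauSqCV (gridPts N (T / N)) (fun i => f (gridPts N (T / N) i) ω) ∂μ
      = (1 - 1 / N) * (2 * secondDiffConst s H * (T / N) ^ (specExp s H - 2))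
        + incrVar (trueKernel s H) T (T - T / N) / T := by
  obtain ⟨M, rfl⟩ : ∃ M, N = M + 1 := ⟨N - 1, by omega⟩
  have hh := mesh_pos hT hN
  have hTe := mesh_eq (T := T) hN
  rw [integral_tauSqCV hf (trueKernel_zero_zero s hH0) hh hTe
    (fun a ha => res_res_secondDiff s hH0 hH1 hh ha)]
  have e : (T / ((M + 1 : ℕ) : ℝ)) ^ (specExp s H - 1)
      = (T / ((M + 1 : ℕ) : ℝ)) ^ (specExp s H - 2) * (T / ((M + 1 : ℕ) : ℝ)) := by
    rw [← Real.rpow_add_one hh.ne']; congr 1; ring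
  rw [e]
  generalize (T / ((M + 1 : ℕ) : ℝ)) ^ (specExp s H - 2) = W
  generalize incrVar (trueKernel s H) T _ = V
  push_cast
  have : (M : ℝ) + 1 ≠ 0 := by positivity
  field_simp
  ring

/-- The case where the bulk of second differences sets the order and the boundary increment is at
most comparable. -/
theorem isTheta_tauSqCV_of_le {s : Fin 2} (hH0 : 0 < H) (hH1 : H < 1) (hT : 0 < T)
    (hf : IsCenteredGP f (Icc 0 T) (trueKernel s H) μ) {K : ℝ}
    (hV : ∀ h, 0 < h → h ≤ T → 0 ≤ incrVar (trueKernel s H) T (T - h) ∧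
      incrVar (trueKernel s H) T (T - h) ≤ K * h ^ (specExp s H - 2)) :
    (fun N : ℕ => ∫ ω, tauSqCV (gridPts N (T / N)) (fun i => f (gridPts N (T / N) i) ω) ∂μ)
      =Θ[atTop] fun N : ℕ => (T / (N : ℝ)) ^ (specExp s H - 2) := by
  have hD := secondDiffConst_pos s hH0 hH1
  refine isTheta_of_bounds (c := secondDiffConst s H) (C := 2 * secondDiffConst s H + K / T)
    hT hD ?_ ?_
  all_goals
    filter_upwards [eventually_ge_atTop 2] with N hN
    have hN1 : 1 ≤ N := by omega
    have hN2 : (2 : ℝ) ≤ N := by exact_mod_cast hN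
    have hh := mesh_pos hT hN1
    obtain ⟨v0, v1⟩ := hV _ hh (mesh_le hT hN1)
    rw [integral_tauSqCV_trueKernel hH0 hH1 hT hf hN1]
    have hW : 0 < (T / (N : ℝ)) ^ (specExp s H - 2) := Real.rpow_pos_of_pos hh _
    generalize (T / (N : ℝ)) ^ (specExp s H - 2) = W at *
    generalize incrVar (trueKernel s H) T _ = V at *
    have i1 : 1 / (N : ℝ) ≤ 1 / 2 := by gcongr
    have i0 : 0 ≤ 1 / (N : ℝ) := by positivity
    have hDW : 0 < secondDiffConst s H * W := mul_pos hD hW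
  · have : 0 ≤ V / T := by positivity
    nlinarith
  · have : V / T ≤ K / T * W := by
      rw [div_mul_eq_mul_div]; gcongr
    nlinarith

theorem isTheta_tauSqCV_fbm (hH0 : 0 < H) (hH1 : H < 1) (hT : 0 < T)
    (hf : IsCenteredGP f (Icc 0 T) (trueKernel 0 H) μ) :
    (fun N : ℕ => ∫ ω, tauSqCV (gridPts N (T / N)) (fun i => f (gridPts N (T / N) i) ω) ∂μ)
      =Θ[atTop] fun N : ℕ => (T / (N : ℝ)) ^ (2 * H - 1) := by
  have e : specExp 0 H - 2 = 2 * H - 1 := by simp [specExp]; ring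
  rw [← e]
  refine isTheta_tauSqCV_of_le hH0 hH1 hT hf (K := T) fun h hh hhT => ?_
  have : incrVar (trueKernel 0 H) T (T - h) = h ^ (2 * H) :=
    (incrVar_fbmKernel hH0 (by linarith)).trans (by rw [sub_sub_cancel])
  rw [this, e]
  refine ⟨by positivity, ?_⟩
  have e2 : h ^ (2 * H) = h * h ^ (2 * H - 1) := by
    rw [mul_comm h, ← Real.rpow_add_one hh.ne']; congr 1; ring
  rw [e2]
  gcongr

theorem isTheta_tauSqCV_ifbm_lt (hH0 : 0 < H) (hH1 : H < 1 / 2) (hT : 0 < T)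
    (hf : IsCenteredGP f (Icc 0 T) (trueKernel 1 H) μ) :
    (fun N : ℕ => ∫ ω, tauSqCV (gridPts N (T / N)) (fun i => f (gridPts N (T / N) i) ω) ∂μ)
      =Θ[atTop] fun N : ℕ => (T / (N : ℝ)) ^ (1 + 2 * H) := by
  have e : specExp 1 H - 2 = 1 + 2 * H := by simp [specExp]; ring
  rw [← e]
  refine isTheta_tauSqCV_of_le hH0 (by linarith) hT hf (K := T ^ (2 * H) * T ^ (1 - 2 * H))
    fun h hh hhT => ?_
  obtain ⟨b1, b2⟩ := incrVar_ifbmKernel_bounds hH0 (x := T) (a := T - h) (T := T) (by linarith)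
    (by linarith) le_rfl
  rw [sub_sub_cancel] at b1 b2
  have hTh : 0 ≤ T - h := by linarith
  refine ⟨le_trans (by positivity) b1, b2.trans ?_⟩
  have e2 : h ^ 2 = h ^ (1 - 2 * H) * h ^ (1 + 2 * H) := by
    rw [← Real.rpow_add hh, ← Real.rpow_natCast]; congr 1; push_cast; ring
  have e3 : h ^ (1 - 2 * H) ≤ T ^ (1 - 2 * H) := Real.rpow_le_rpow hh.le hhT (by linarith)
  rw [e, e2, mul_assoc]
  gcongr

/-- From H = 1/2 on, the boundary increment, of variance comparable to h², is no longer negligible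
against the bulk h^(1+2H) and supplies the lower bound. -/
theorem isTheta_tauSqCV_ifbm_ge (hH0 : 1 / 2 ≤ H) (hH1 : H < 1) (hT : 0 < T)
    (hf : IsCenteredGP f (Icc 0 T) (trueKernel 1 H) μ) :
    (fun N : ℕ => ∫ ω, tauSqCV (gridPts N (T / N)) (fun i => f (gridPts N (T / N) i) ω) ∂μ)
      =Θ[atTop] fun N : ℕ => (T / (N : ℝ)) ^ (2 : ℝ) := by
  have hH : 0 < H := by linarith
  have e : specExp 1 H - 2 = 1 + 2 * H := by simp [specExp]; ring
  have hD := secondDiffConst_pos 1 hH hH1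
  refine isTheta_of_bounds (c := (T / 2) ^ (2 * H) / 2 / T)
    (C := 2 * secondDiffConst 1 H * T ^ (2 * H - 1) + T ^ (2 * H) / T) hT (by positivity) ?_ ?_
  all_goals
    filter_upwards [eventually_ge_atTop 2] with N hN
    have hN1 : 1 ≤ N := by omega
    have hN2 : (2 : ℝ) ≤ N := by exact_mod_cast hN
    have hh := mesh_pos hT hN1
    have hhT := mesh_le hT hN1
    have hhT2 : T / (N : ℝ) ≤ T / 2 := by gcongr
    rw [integral_tauSqCV_trueKernel hH hH1 hT hf hN1, e]
    have i1 : 1 / (N : ℝ) ≤ 1 / 2 := by gcongr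
    have i0 : 0 ≤ 1 / (N : ℝ) := by positivity
    generalize T / (N : ℝ) = h at *
    generalize 1 / (N : ℝ) = r at *
    obtain ⟨b1, b2⟩ := incrVar_ifbmKernel_bounds hH (x := T) (a := T - h) (T := T) (by linarith)
      (by linarith) le_rfl
    rw [sub_sub_cancel] at b1 b2
    have e4 : h ^ (2 : ℝ) = h ^ 2 := by norm_cast
    have hV : incrVar (trueKernel 1 H) T (T - h) = incrVar (ifbmKernel H) T (T - h) := rfl
    rw [hV, e4]
    generalize incrVar (ifbmKernel H) T (T - h) = V at *
    have hW : 0 < secondDiffConst 1 H * h ^ (1 + 2 * H) := by positivity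
  -- For N ≥ 2 the last cell lies in [T/2, T], where the variance of the derivative is bounded away
  -- from 0.
  · have b3 : (T / 2) ^ (2 * H) ≤ (T - h) ^ (2 * H) :=
      Real.rpow_le_rpow (by positivity) (by linarith) (by positivity)
    have b4 : (T / 2) ^ (2 * H) / 2 / T * h ^ 2 ≤ V / T := by
      rw [div_mul_eq_mul_div]
      gcongr
      refine le_trans ?_ b1
      gcongr
    nlinarith
  · have e2 : h ^ (1 + 2 * H) = h ^ (2 * H - 1) * h ^ 2 := by
      rw [← Real.rpow_natCast, ← Real.rpow_add hh]; congr 1; push_cast; ring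
    have e3 : h ^ (2 * H - 1) ≤ T ^ (2 * H - 1) := Real.rpow_le_rpow hh.le hhT (by linarith)
    have b4 : V / T ≤ T ^ (2 * H) / T * h ^ 2 := by
      rw [div_mul_eq_mul_div]; gcongr
    have b5 : 2 * (secondDiffConst 1 H * h ^ (1 + 2 * H))
        ≤ 2 * secondDiffConst 1 H * T ^ (2 * H - 1) * h ^ 2 := by
      rw [e2, ← mul_assoc, ← mul_assoc]
      gcongr
    nlinarith

theorem isTheta_tauSqML_fbm (hH0 : 0 < H) (hT : 0 < T)
    (hf : IsCenteredGP f (Icc 0 T) (trueKernel 0 H) μ) :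
    (fun N : ℕ => ∫ ω, tauSqML (gridPts N (T / N)) (fun i => f (gridPts N (T / N) i) ω) ∂μ)
      =Θ[atTop] fun N : ℕ => (T / (N : ℝ)) ^ (2 * H - 1) := by
  have key : ∀ N : ℕ, 1 ≤ N →
      ∫ ω, tauSqML (gridPts N (T / N)) (fun i => f (gridPts N (T / N) i) ω) ∂μ
        = 1 * (T / (N : ℝ)) ^ (2 * H - 1) := fun N hN => by
    have hh := mesh_pos hT hN
    have hN0 : (N : ℝ) ≠ 0 := by positivity
    rw [integral_tauSqML hf (trueKernel_zero_zero 0 hH0) hN hh (mesh_eq hN)]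
    have e : ∀ n : Fin N, incrVar (trueKernel 0 H) (((n : ℕ) + 1) * (T / N)) ((n : ℕ) * (T / N))
        = (T / (N : ℝ)) ^ (2 * H) := fun n =>
      (incrVar_fbmKernel hH0 (by gcongr; linarith)).trans (by congr 1; ring)
    simp only [e]
    rw [Finset.sum_const, Finset.card_univ, Fintype.card_fin, nsmul_eq_mul,
      mul_div_cancel_left₀ _ hN0, one_mul, Real.rpow_sub_one hh.ne']
  refine isTheta_of_bounds hT one_pos (C := 1) ?_ ?_ <;>
    filter_upwards [eventually_ge_atTop 1] with N hN
  · exact (key N hN).ge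
  · exact (key N hN).le

/-- Increments of an integrated process have variance O(h²) whatever H is, which gives the upper
bound; `le_sum_incrVar` gives the lower one. -/
theorem isTheta_tauSqML_ifbm (hH0 : 0 < H) (hH1 : H < 1) (hT : 0 < T)
    (hf : IsCenteredGP f (Icc 0 T) (trueKernel 1 H) μ) :
    (fun N : ℕ => ∫ ω, tauSqML (gridPts N (T / N)) (fun i => f (gridPts N (T / N) i) ω) ∂μ)
      =Θ[atTop] fun N : ℕ => (T / (N : ℝ)) ^ (1 : ℝ) := by
  have hk := ifbmKernel_self_pos hH0 hH1 hT
  refine isTheta_of_bounds (c := ifbmKernel H T T / T ^ 2) (C := T ^ (2 * H)) hT (by positivity)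
    ?_ ?_
  all_goals
    filter_upwards [eventually_ge_atTop 1] with N hN
    have hh := mesh_pos hT hN
    have hN0 : (0 : ℝ) < N := by exact_mod_cast hN
    rw [integral_tauSqML hf (trueKernel_zero_zero 1 hH0) hN hh (mesh_eq hN), Real.rpow_one]
  · have h1 := le_sum_incrVar hf (trueKernel_zero_zero 1 hH0) hh (mesh_eq hN)
    have h2 : ifbmKernel H T T ≤ N * ∑ n : Fin N,
      incrVar (trueKernel 1 H) (((n : ℕ) + 1) * (T / N)) ((n : ℕ) * (T / N)) := h1
    rw [← Finset.sum_div]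
    generalize ∑ n : Fin N,
      incrVar (trueKernel 1 H) (((n : ℕ) + 1) * (T / N)) ((n : ℕ) * (T / N)) = S at h2
    have e1 : S / (T / N) / N = N * S / T * (1 / N) := by field_simp
    have e2 : ifbmKernel H T T / T ^ 2 * (T / N) = ifbmKernel H T T / T * (1 / N) := by field_simp
    rw [e1, e2]
    gcongr
  · have e : ∀ n : Fin N, incrVar (trueKernel 1 H) (((n : ℕ) + 1) * (T / N)) ((n : ℕ) * (T / N))
        / (T / N) ≤ T ^ (2 * H) * (T / N) := fun n => by
      have m1 := (node_mem hh (mesh_eq (T := T) hN) (n := n + 1) n.2).2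
      push_cast at m1
      have := (incrVar_ifbmKernel_bounds hH0 (x := ((n : ℕ) + 1) * (T / N))
        (a := (n : ℕ) * (T / N)) (T := T) (by positivity) (by gcongr; linarith) m1).2
      rw [div_le_iff₀ hh]
      refine this.trans (le_of_eq ?_)
      ring
    rw [div_le_iff₀ hN0]
    refine (Finset.sum_le_sum fun n _ => e n).trans (le_of_eq ?_)
    rw [Finset.sum_const, Finset.card_univ, Fintype.card_fin, nsmul_eq_mul]
    ring

end Estimators

/-! ### Measure bounds from the density, and the final comparison of orders -/

theorem density_bounds {T c₀ C₀ : ℝ} {P : Measure ℝ} {p : ℝ → ℝ}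
    (hp : ∀ y ∈ Icc (0 : ℝ) T, p y ∈ Icc c₀ C₀)
    (hP : P = (volume.restrict (Icc (0 : ℝ) T)).withDensity fun y => ENNReal.ofReal (p y)) :
    ENNReal.ofReal c₀ • volume.restrict (Icc 0 T) ≤ P ∧ P ≤ ENNReal.ofReal C₀ • volume ∧
      P ≪ volume.restrict (Icc (0 : ℝ) T) ∧ ∀ᵐ x ∂P, x ∈ Ico 0 T := by
  have hac : P ≪ volume.restrict (Icc (0 : ℝ) T) := hP ▸ withDensity_absolutelyContinuous _ _
  refine ⟨?_, ?_, hac, ?_⟩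
  · rw [hP, ← withDensity_const]
    refine withDensity_mono ?_
    filter_upwards [ae_restrict_mem measurableSet_Icc] with y hy
    exact ENNReal.ofReal_le_ofReal (hp y hy).1
  · have h1 : P ≤ ENNReal.ofReal C₀ • volume.restrict (Icc 0 T) := by
      rw [hP, ← withDensity_const]
      refine withDensity_mono ?_
      filter_upwards [ae_restrict_mem measurableSet_Icc] with y hy
      exact ENNReal.ofReal_le_ofReal (hp y hy).2
    refine h1.trans ?_
    gcongr
    exact Measure.restrict_le_self
  · refine hac.ae_le ?_
    rw [← restrict_Ico_eq_restrict_Icc]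
    exact ae_restrict_mem measurableSet_Ico

end BQCalibration

theorem mainTheorem7 {Ω : Type*} [MeasurableSpace Ω] (μ : Measure Ω) [IsProbabilityMeasure μ]
    (T : ℝ) (hT : 0 < T) (s : Fin 2) (H : ℝ) (hH0 : 0 < H) (hH1 : H < 1)
    (f : ℝ → Ω → ℝ)
    (hf : BQCalibration.IsCenteredGP f (Set.Icc 0 T) (BQCalibration.trueKernel s H) μ)
    (hf_meas : AEMeasurable (fun q : ℝ × Ω => f q.1 q.2)
      ((volume.restrict (Set.Icc (0 : ℝ) T)).prod μ))
    (x : ℕ → ℕ → ℝ) (hx : BQCalibration.IsPartitionSeq T x) (hxu : BQCalibration.IsUniform x)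
    (P : Measure ℝ) [IsProbabilityMeasure P] (p : ℝ → ℝ)
    (hp_meas : AEMeasurable p (volume.restrict (Set.Icc (0 : ℝ) T)))
    (c₀ C₀ : ℝ) (hc₀ : 0 < c₀) (hp : ∀ y ∈ Set.Icc (0 : ℝ) T, p y ∈ Set.Icc c₀ C₀)
    (hP : P = (volume.restrict (Set.Icc (0 : ℝ) T)).withDensity fun y => ENNReal.ofReal (p y)) :
    Asymptotics.IsTheta Filter.atTop
        (fun N : ℕ => BQCalibration.ratioCV μ f P (BQCalibration.points x N))
        (fun _ : ℕ => (1 : ℝ)) ∧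
      (s = 0 →
        Asymptotics.IsTheta Filter.atTop
          (fun N : ℕ => BQCalibration.ratioML μ f P (BQCalibration.points x N))
          (fun _ : ℕ => (1 : ℝ))) ∧
      (s = 1 → H < 1 / 2 →
        Asymptotics.IsTheta Filter.atTop
          (fun N : ℕ => BQCalibration.ratioML μ f P (BQCalibration.points x N))
          (fun N : ℕ => (N : ℝ) ^ (-(2 * H)))) ∧
      (s = 1 → 1 / 2 ≤ H →
        Asymptotics.IsTheta Filter.atTop
          (fun N : ℕ => BQCalibration.ratioML μ f P (BQCalibration.points x N))
          (fun N : ℕ => (N : ℝ) ^ (-1 : ℝ))) := by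
  open BQCalibration Filter Asymptotics in
  obtain ⟨hPc, hPC, hac, hPae⟩ := density_bounds hp hP
  have hC : 0 ≤ C₀ := by
    have := hp 0 ⟨le_rfl, hT.le⟩
    linarith [this.1, this.2]
  have hfm : AEStronglyMeasurable (fun q : ℝ × Ω => f q.1 q.2) (P.prod μ) :=
    (hf_meas.mono_ac (hac.prod Measure.AbsolutelyContinuous.rfl)).aestronglyMeasurable
  have hErr : ∀ e : ℝ, (fun N : ℕ => energy P (T / N) (specExp s H)) =Θ[atTop]
      (fun N : ℕ => (T / (N : ℝ)) ^ e) →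
      (fun N : ℕ => expSqError μ f P (points x N)) =Θ[atTop] fun N : ℕ => (T / (N : ℝ)) ^ e := by
    intro e he
    refine EventuallyEq.trans_isTheta ?_ (he.const_mul_left (specConst_pos hH0 hH1).ne')
    filter_upwards [eventually_ge_atTop 1] with N hN
    rw [uniform_points hx hxu hN, expSqError_eq hH0 hH1 hf hfm hPae hN (mesh_pos hT hN) (mesh_eq hN),
      integral_resid2_trueKernel P s hH0 hH1 (mesh_pos hT hN) (hPae.mono fun y hy => hy.1)]
  have hVar : (fun N : ℕ => bqVar P (points x N)) =Θ[atTop] fun N : ℕ => (T / (N : ℝ)) ^ (2 : ℝ) := by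
    refine EventuallyEq.trans_isTheta ?_
      ((isTheta_energy_of_le_four hC hPC hT hPae (α := 2) (by norm_num) (by norm_num)).const_mul_left
        (specConst_pos (H := 1 / 2) (by norm_num) (by norm_num)).ne')
    filter_upwards [eventually_ge_atTop 1] with N hN
    rw [uniform_points hx hxu hN, bqVar_eq hPae (mesh_pos hT hN) (mesh_eq hN)]
  have hCV : (fun N : ℕ => ∫ ω, tauSqCV (points x N) (fun i => f (points x N i) ω) ∂μ) =ᶠ[atTop]
      fun N : ℕ => ∫ ω, tauSqCV (gridPts N (T / N)) (fun i => f (gridPts N (T / N) i) ω) ∂μ := by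
    filter_upwards [eventually_ge_atTop 1] with N hN
    rw [uniform_points hx hxu hN]
  have hML : (fun N : ℕ => ∫ ω, tauSqML (points x N) (fun i => f (points x N i) ω) ∂μ) =ᶠ[atTop]
      fun N : ℕ => ∫ ω, tauSqML (gridPts N (T / N)) (fun i => f (gridPts N (T / N) i) ω) ∂μ := by
    filter_upwards [eventually_ge_atTop 1] with N hN
    rw [uniform_points hx hxu hN]
  have one : (fun N : ℕ => (N : ℝ) ^ (-0 : ℝ)) = fun _ => 1 := by simp
  have s0 : specExp 0 H = 1 + 2 * H := by simp [specExp]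
  have s1 : specExp 1 H = 3 + 2 * H := by simp [specExp]; ring
  have cases : s = 0 ∨ s = 1 := by fin_cases s <;> simp
  rcases cases with rfl | rfl
  · have hE := hErr _ (isTheta_energy_of_le_four hC hPC hT hPae (α := specExp 0 H)
      (by linarith) (by linarith))
    refine ⟨?_, fun _ => ?_, fun h => absurd h (by decide), fun h => absurd h (by decide)⟩
    · rw [← one]
      exact isTheta_ratio hT hE (hCV.trans_isTheta (isTheta_tauSqCV_fbm hH0 hH1 hT hf)) hVar
        (by rw [s0]; ring)
    · rw [← one]
      exact isTheta_ratio hT hE (hML.trans_isTheta (isTheta_tauSqML_fbm hH0 hT hf)) hVar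
        (by rw [s0]; ring)
  -- For s = 1 the exponent 3 + 2H crosses 4 at H = 1/2. From there on the error stays at h⁴ and the
  -- CV mean at h², while the ML mean is of order h on both sides.
  · rcases lt_or_ge H (1 / 2) with hlt | hge
    · have hE := hErr _ (isTheta_energy_of_le_four hC hPC hT hPae (α := specExp 1 H)
        (by linarith) (by linarith))
      refine ⟨?_, fun h => absurd h (by decide), fun _ _ => ?_, fun _ h => absurd h hlt.not_ge⟩
      · rw [← one]
        exact isTheta_ratio hT hE (hCV.trans_isTheta (isTheta_tauSqCV_ifbm_lt hH0 hlt hT hf)) hVar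
          (by rw [s1]; ring)
      · exact isTheta_ratio hT hE (hML.trans_isTheta (isTheta_tauSqML_ifbm hH0 hH1 hT hf)) hVar
          (by rw [s1]; ring)
    · have hE := hErr _ (isTheta_energy_of_four_le hc₀ hC hPC hPc hT hPae (α := specExp 1 H)
        (by linarith) (by linarith))
      refine ⟨?_, fun h => absurd h (by decide), fun _ h => absurd h hge.not_gt, fun _ _ => ?_⟩
      · rw [← one]
        exact isTheta_ratio hT hE (hCV.trans_isTheta (isTheta_tauSqCV_ifbm_ge hge hH1 hT hf)) hVar
          (by norm_num)
      · exact isTheta_ratio hT hE (hML.trans_isTheta (isTheta_tauSqML_ifbm hH0 hH1 hT hf)) hVar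
          (by norm_num)
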